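/- Let $N\in\mathbb N$, $\alpha\in(0,2]$, $N>\alpha$, and put $2^*_\alpha:=\frac{2N}{N-\alpha}$. Let $\hat u$ denote the unitary Fourier transform, $\hat u(\xi)=(2\pi)^{-N/2}\int_{\mathbb R^N}e^{-i\xi\cdot x}u(x)\,dx$, extended to $L^2(\mathbb R^N)$. Consider the equation $$(-\Delta)^{\alpha/2}u+V(x)u=f(x,u)-\Gamma(x)|u|^{q-2}u\quad\text{on }\mathbb R^N,$$ where $(-\Delta)^{\alpha/2}$ has Fourier symbol $|\xi|^\alpha$, under the following assumptions. * $V:\mathbb R^N\to\mathbb R$ is continuous, $\lim_{|x|\to\infty}V(x)=\infty$ and $\inf_{\mathbb R^N}V>0$. * ($\Gamma$) $\Gamma\in L^\infty(\mathbb R^N)$ is $\mathbb Z^N$-periodic and $\Gamma(x)\ge 0$ for a.e. $x$. * (F1) $f:\mathbb R^N\times\mathbb R\to\mathbb R$ is measurable, $\mathbb Z^N$-periodic in $x$, continuous in $u$ for a.e. $x$, and there are $c>0$ and $p$ with $2<q<p<2^*_\alpha$ such that $|f(x,u)|\le c(1+|u|^{p-1})$ for all $u\in\mathbb R$ and a.e.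 $x\in\mathbb R^N$. * (F2) $f(x,u)=o(|u|)$ as $u\to0$, uniformly in (almost every) $x$. * (F3) $F(x,u)/|u|^q\to\infty$ as $|u|\to\infty$, uniformly in (almost every) $x$, where $F(x,u)=\int_0^u f(x,s)\,ds$. * (F4) For a.e. $x$, the map $u\mapsto f(x,u)/|u|^{q-1}$ is strictly increasing on $(-\infty,0)$ and on $(0,\infty)$. Let $E^{\alpha/2}$ be the space of all real-valued $u\in L^2(\mathbb R^N)$ for which $$\|u\|^2:=\int_{\mathbb R^N}|\xi|^\alpha|\hat u(\xi)|^2\,d\xi+\int_{\mathbb R^N}V(x)|u(x)|^2\,dx<\infty,$$ normed by $\|\cdot\|$, and let $$\mathcal J(u):=\frac12 K(u)+\frac12\int_{\mathbb R^N}V(x)|u|^2\,dx-\int_{\mathbb R^N}\Big(F(x,u(x))-\frac1q\Gamma(x)|u(x)|^q\Big)dx,\qquad u\in E^{\alpha/2},$$ where $K(u)=\int_{\mathbb R^N}|\xi|^\alpha|\hat u(\xi)|^2\,d\xi$ if $\alpha<2$, and $K(u)=\int_{\mathbb R^N}|\nabla u|^2\,dx$, with the weak gradient, if $\alpha=2$.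 Then $\mathcal J$ is well defined (for every $u\in E^{\alpha/2}$ the last integrand is integrable and, if $\alpha=2$, $u$ has a weak gradient in $L^2$) and of class $C^1$ on $E^{\alpha/2}$, and the equation has a ground state: there is $u\in E^{\alpha/2}\setminus\{0\}$ with $\mathcal J'(u)=0$ which minimizes $\mathcal J$ on the Nehari manifold $\mathcal N:=\{v\in E^{\alpha/2}\setminus\{0\}:\mathcal J'(v)(v)=0\}$, that is, $u\in\mathcal N$ and $\mathcal J(u)=\min_{\mathcal N}\mathcal J=\inf_{\mathcal N}\mathcal J$. -/

import Mathlib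

open MeasureTheory Filter
open scoped FourierTransform ENNReal ContDiff

namespace FractionalSchrodinger

noncomputable section

/-- The Euclidean space `ℝ^N`. -/
abbrev Space (N : ℕ) : Type := EuclideanSpace ℝ (Fin N)

/-- Real-valued square-integrable functions on `ℝ^N`. -/
abbrev RealL2 (N : ℕ) : Type := Lp ℝ 2 (volume : Measure (Space N))

/-- Complex-valued square-integrable functions on `ℝ^N`. -/
abbrev ComplexL2 (N : ℕ) : Type := Lp ℂ 2 (volume : Measure (Space N))

/-- The vector of `ℝ^N` with integer coordinates `k`. -/
def latticeVector {N : ℕ} (k : Fin N → ℤ) : Space N := WithLp.toLp 2 (fun i => (k i : ℝ))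

/-! ### The Fourier transform -/

/-- A real-valued `L²` function, seen as a complex-valued one. -/
def toComplexL2 {N : ℕ} (u : RealL2 N) : ComplexL2 N :=
  Complex.ofRealCLM.compLpL 2 volume u

/-- The usual unitary Fourier transform `û(ξ) = (2π)^(-N/2) ∫ e^(-i ξ·x) u(x) dx` of a real-valued
`u ∈ L²(ℝ^N)`, as a function defined almost everywhere. It is obtained by a dilation from Mathlib's
unitary transform `𝓕 u(η) = ∫ e^(-2πi η·x) u(x) dx` on `L²`. -/
def fourierHat {N : ℕ} (u : RealL2 N) (ξ : Space N) : ℂ :=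
  (((2 * Real.pi) ^ (-(N : ℝ) / 2) : ℝ) : ℂ) *
    (𝓕 (toComplexL2 u) : ComplexL2 N) ((2 * Real.pi)⁻¹ • ξ)

/-! ### Coercive potentials -/

/-- A continuous potential `V : ℝ^N → ℝ` with `V(x) → ∞` as `|x| → ∞` and `inf V > 0`. -/
structure CoercivePotential (N : ℕ) where
  /-- The underlying function. -/
  toFun : Space N → ℝ
  continuous_toFun : Continuous toFun
  tendsto_atTop : Tendsto toFun (Bornology.cobounded (Space N)) atTop
  iInf_pos : 0 < ⨅ x, toFun x

instance instCoeFunPotential (N : ℕ) : CoeFun (CoercivePotential N) (fun _ => Space N → ℝ) where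
  coe V := V.toFun

theorem CoercivePotential.pos {N : ℕ} (V : CoercivePotential N) (x : Space N) : 0 < V x := by
  have hb : BddBelow (Set.range V.toFun) := by
    by_contra h
    have h1 := V.iInf_pos
    rw [Real.iInf_of_not_bddBelow h] at h1
    exact lt_irrefl _ h1
  exact V.iInf_pos.trans_le (ciInf_le hb x)

/-! ### Facts needed for the scalar product of the energy space -/

theorem fourierHat_aestronglyMeasurable {N : ℕ} (u : RealL2 N) :
    AEStronglyMeasurable (fourierHat u) volume := by
  have h0 : (2 * Real.pi)⁻¹ ≠ (0 : ℝ) := by positivity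
  have hm : StronglyMeasurable
      (fun ξ : Space N => (𝓕 (toComplexL2 u) : ComplexL2 N) ((2 * Real.pi)⁻¹ • ξ)) :=
    (Lp.stronglyMeasurable _).comp_measurable (measurable_const_smul _)
  exact (hm.const_mul _).aestronglyMeasurable

theorem quasiMeasurePreserving_dilation {N : ℕ} {c : ℝ} (hc : c ≠ 0) :
    Measure.QuasiMeasurePreserving (fun ξ : Space N => c • ξ) volume volume := by
  refine ⟨measurable_const_smul c, ?_⟩
  rw [Measure.map_addHaar_smul volume hc]
  exact Measure.smul_absolutelyContinuous

theorem fourierHat_add {N : ℕ} (u v : RealL2 N) :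
    fourierHat (u + v) =ᵐ[volume] fun ξ => fourierHat u ξ + fourierHat v ξ := by
  have h0 : (2 * Real.pi)⁻¹ ≠ (0 : ℝ) := by positivity
  have h1 : (𝓕 (toComplexL2 (u + v)) : ComplexL2 N)
      = 𝓕 (toComplexL2 u) + 𝓕 (toComplexL2 v) := by
    rw [toComplexL2, map_add, FourierTransform.fourier_add]; rfl
  have h2 := (quasiMeasurePreserving_dilation (N := N) h0).ae
    (Lp.coeFn_add (𝓕 (toComplexL2 u) : ComplexL2 N) (𝓕 (toComplexL2 v)))
  filter_upwards [h2] with ξ hξ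
  simp only [fourierHat, h1, hξ, Pi.add_apply, mul_add]

theorem fourierHat_smul {N : ℕ} (c : ℝ) (u : RealL2 N) :
    fourierHat (c • u) =ᵐ[volume] fun ξ => (c : ℂ) * fourierHat u ξ := by
  have h0 : (2 * Real.pi)⁻¹ ≠ (0 : ℝ) := by positivity
  have hc : toComplexL2 (c • u) = (c : ℂ) • toComplexL2 u := by
    rw [toComplexL2, map_smul]
    rfl
  have h1 : (𝓕 (toComplexL2 (c • u)) : ComplexL2 N) = (c : ℂ) • 𝓕 (toComplexL2 u) := by
    rw [hc, FourierTransform.fourier_smul]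
  have h2 := (quasiMeasurePreserving_dilation (N := N) h0).ae
    (Lp.coeFn_smul (c : ℂ) (𝓕 (toComplexL2 u) : ComplexL2 N))
  filter_upwards [h2] with ξ hξ
  simp only [fourierHat, h1, hξ, Pi.smul_apply, smul_eq_mul]
  ring

theorem measurable_weight {N : ℕ} (α : ℝ) : Measurable (fun ξ : Space N => ‖ξ‖ ^ α) := by
  fun_prop

/-! ### The energy space -/

/-- `u ∈ L²(ℝ^N)` with `∫ |ξ|^α |û(ξ)|² dξ + ∫ V |u|² dx < ∞`. -/
def energySubmodule {N : ℕ} (α : ℝ) (V : CoercivePotential N) : Submodule ℝ (RealL2 N) where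
  carrier := {u | Integrable (fun ξ : Space N => ‖ξ‖ ^ α * ‖fourierHat u ξ‖ ^ 2) ∧
    Integrable (fun x : Space N => V x * |u x| ^ 2)}
  zero_mem' := by
    have h : fourierHat (0 : RealL2 N) =ᵐ[volume] fun _ => 0 := by
      have := fourierHat_smul (0 : ℝ) (0 : RealL2 N)
      simpa using this
    constructor
    · refine (integrable_zero (Space N) ℝ volume).congr ?_
      filter_upwards [h] with ξ hξ
      simp [hξ]
    · refine (integrable_zero (Space N) ℝ volume).congr ?_
      filter_upwards [Lp.coeFn_zero ℝ 2 (volume : Measure (Space N))] with x hx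
      simp [hx]
  add_mem' := by
    rintro u v ⟨hu1, hu2⟩ ⟨hv1, hv2⟩
    constructor
    · refine Integrable.mono' ((hu1.add hv1).const_mul 2) ?_ ?_
      · exact (measurable_weight α).aestronglyMeasurable.mul
          ((fourierHat_aestronglyMeasurable _).norm.pow 2)
      · filter_upwards [fourierHat_add u v] with ξ hξ
        have hw : 0 ≤ ‖ξ‖ ^ α := by positivity
        have h1 : ‖fourierHat (u + v) ξ‖ ≤ ‖fourierHat u ξ‖ + ‖fourierHat v ξ‖ := by
          rw [hξ]; exact norm_add_le _ _
        have h2 : ‖fourierHat (u + v) ξ‖ ^ 2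
            ≤ 2 * (‖fourierHat u ξ‖ ^ 2 + ‖fourierHat v ξ‖ ^ 2) := by
          nlinarith [sq_nonneg (‖fourierHat u ξ‖ - ‖fourierHat v ξ‖),
            norm_nonneg (fourierHat (u + v) ξ)]
        rw [Real.norm_of_nonneg (by positivity), Pi.add_apply]
        nlinarith [mul_le_mul_of_nonneg_left h2 hw]
    · refine Integrable.mono' ((hu2.add hv2).const_mul 2) ?_ ?_
      · exact V.continuous_toFun.aestronglyMeasurable.mul
          ((Lp.aestronglyMeasurable (u + v)).norm.pow 2)
      · filter_upwards [Lp.coeFn_add u v] with x hx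
        have hw := (V.pos x).le
        rw [Real.norm_of_nonneg (by positivity), Pi.add_apply, hx, Pi.add_apply, sq_abs, sq_abs,
          sq_abs]
        have h2 : (u x + v x) ^ 2 ≤ 2 * (u x ^ 2 + v x ^ 2) := by
          nlinarith [sq_nonneg (u x - v x)]
        nlinarith [mul_le_mul_of_nonneg_left h2 hw]
  smul_mem' := by
    rintro c u ⟨hu1, hu2⟩
    constructor
    · refine (hu1.const_mul (c ^ 2)).congr ?_
      filter_upwards [fourierHat_smul c u] with ξ hξ
      rw [hξ, norm_mul, mul_pow, Complex.norm_real, Real.norm_eq_abs, sq_abs]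
      ring
    · refine (hu2.const_mul (c ^ 2)).congr ?_
      filter_upwards [Lp.coeFn_smul c u] with x hx
      rw [hx, Pi.smul_apply, smul_eq_mul, abs_mul, mul_pow, sq_abs c]
      ring

/-- The energy space `E^{α/2}`. It carries its own norm, not the one of `L²`. -/
def EnergySpace {N : ℕ} (α : ℝ) (V : CoercivePotential N) : Type := energySubmodule α V

namespace EnergySpace

variable {N : ℕ} {α : ℝ} {V : CoercivePotential N}

/-- The underlying `L²` function. -/
def toL2 (u : EnergySpace α V) : RealL2 N := Subtype.val (p := (· ∈ energySubmodule α V)) u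

instance instAddCommGroup : AddCommGroup (EnergySpace α V) :=
  inferInstanceAs (AddCommGroup (energySubmodule α V))

instance instModule : Module ℝ (EnergySpace α V) :=
  inferInstanceAs (Module ℝ (energySubmodule α V))

theorem toL2_injective : Function.Injective (toL2 : EnergySpace α V → RealL2 N) :=
  Subtype.val_injective

theorem toL2_add (u v : EnergySpace α V) : (u + v).toL2 = u.toL2 + v.toL2 := rfl

theorem toL2_smul (c : ℝ) (u : EnergySpace α V) : (c • u).toL2 = c • u.toL2 := rfl

theorem toL2_zero : (0 : EnergySpace α V).toL2 = 0 := rfl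

theorem integrable_fourier (u : EnergySpace α V) :
    Integrable (fun ξ : Space N => ‖ξ‖ ^ α * ‖fourierHat u.toL2 ξ‖ ^ 2) := u.2.1

theorem integrable_potential (u : EnergySpace α V) :
    Integrable (fun x : Space N => V x * |u.toL2 x| ^ 2) := u.2.2

/-- The scalar product `⟨u, v⟩ = ∫ |ξ|^α û(ξ) conj(v̂(ξ)) dξ + ∫ V u v dx`. For real-valued `u`, `v`
the first integral is real, so that only the real part of the integrand is kept. -/
def scalarProduct (u v : EnergySpace α V) : ℝ :=
  (∫ ξ : Space N, ‖ξ‖ ^ α *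
      (fourierHat u.toL2 ξ * (starRingEnd ℂ) (fourierHat v.toL2 ξ)).re) +
    ∫ x : Space N, V x * (u.toL2 x * v.toL2 x)

theorem integrable_fourier_mul (u v : EnergySpace α V) :
    Integrable (fun ξ : Space N => ‖ξ‖ ^ α *
      (fourierHat u.toL2 ξ * (starRingEnd ℂ) (fourierHat v.toL2 ξ)).re) := by
  refine Integrable.mono' (u.integrable_fourier.add v.integrable_fourier) ?_ ?_
  · refine (measurable_weight α).aestronglyMeasurable.mul ?_
    exact Complex.continuous_re.comp_aestronglyMeasurable
      ((fourierHat_aestronglyMeasurable _).mul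
        (Complex.continuous_conj.comp_aestronglyMeasurable (fourierHat_aestronglyMeasurable _)))
  · refine Eventually.of_forall fun ξ => ?_
    have hw : 0 ≤ ‖ξ‖ ^ α := by positivity
    have h1 : |(fourierHat u.toL2 ξ * (starRingEnd ℂ) (fourierHat v.toL2 ξ)).re|
        ≤ ‖fourierHat u.toL2 ξ‖ * ‖fourierHat v.toL2 ξ‖ := by
      refine (Complex.abs_re_le_norm _).trans ?_
      rw [norm_mul, RCLike.norm_conj]
    have h2 : ‖fourierHat u.toL2 ξ‖ * ‖fourierHat v.toL2 ξ‖
        ≤ ‖fourierHat u.toL2 ξ‖ ^ 2 + ‖fourierHat v.toL2 ξ‖ ^ 2 := by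
      nlinarith [sq_nonneg (‖fourierHat u.toL2 ξ‖ - ‖fourierHat v.toL2 ξ‖),
        sq_nonneg (‖fourierHat u.toL2 ξ‖), sq_nonneg (‖fourierHat v.toL2 ξ‖)]
    rw [norm_mul, Real.norm_of_nonneg hw, Real.norm_eq_abs, Pi.add_apply, ← mul_add]
    exact mul_le_mul_of_nonneg_left (h1.trans h2) hw

theorem integrable_potential_mul (u v : EnergySpace α V) :
    Integrable (fun x : Space N => V x * (u.toL2 x * v.toL2 x)) := by
  refine Integrable.mono' (u.integrable_potential.add v.integrable_potential) ?_ ?_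
  · exact V.continuous_toFun.aestronglyMeasurable.mul
      ((Lp.aestronglyMeasurable _).mul (Lp.aestronglyMeasurable _))
  · refine Eventually.of_forall fun x => ?_
    have hw := (V.pos x).le
    have h2 : |u.toL2 x| * |v.toL2 x| ≤ |u.toL2 x| ^ 2 + |v.toL2 x| ^ 2 := by
      nlinarith [sq_nonneg (|u.toL2 x| - |v.toL2 x|),
        sq_nonneg (|u.toL2 x|), sq_nonneg (|v.toL2 x|)]
    rw [norm_mul, Real.norm_of_nonneg hw, Real.norm_eq_abs, Pi.add_apply, ← mul_add, abs_mul]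
    exact mul_le_mul_of_nonneg_left h2 hw

theorem scalarProduct_self (u : EnergySpace α V) :
    scalarProduct u u = (∫ ξ : Space N, ‖ξ‖ ^ α * ‖fourierHat u.toL2 ξ‖ ^ 2) +
      ∫ x : Space N, V x * |u.toL2 x| ^ 2 := by
  unfold scalarProduct
  congr 1
  · refine integral_congr_ae (Eventually.of_forall fun ξ => ?_)
    simp only [Complex.mul_conj, Complex.ofReal_re, Complex.normSq_eq_norm_sq]
  · refine integral_congr_ae (Eventually.of_forall fun x => ?_)
    simp only [sq_abs]
    ring

/-- The scalar product of the energy space satisfies the axioms of an inner product. -/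
@[reducible] def innerCore : InnerProductSpace.Core ℝ (EnergySpace α V) where
  inner := scalarProduct
  conj_inner_symm u v := by
    simp only [scalarProduct, conj_trivial]
    congr 1
    · refine integral_congr_ae (Eventually.of_forall fun ξ => ?_)
      simp only [Complex.mul_re, Complex.conj_re, Complex.conj_im]
      ring
    · refine integral_congr_ae (Eventually.of_forall fun x => ?_)
      simp only
      ring
  re_inner_nonneg u := by
    simp only [scalarProduct_self, RCLike.re_to_real]
    refine add_nonneg (integral_nonneg fun ξ => ?_) (integral_nonneg fun x => ?_)
    · simp only [Pi.zero_apply]; positivity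
    · exact mul_nonneg (V.pos x).le (by positivity)
  add_left u v w := by
    simp only [scalarProduct]
    have h1 : (∫ ξ : Space N, ‖ξ‖ ^ α *
        (fourierHat (u + v).toL2 ξ * (starRingEnd ℂ) (fourierHat w.toL2 ξ)).re) =
        (∫ ξ : Space N, ‖ξ‖ ^ α *
          (fourierHat u.toL2 ξ * (starRingEnd ℂ) (fourierHat w.toL2 ξ)).re) +
        ∫ ξ : Space N, ‖ξ‖ ^ α *
          (fourierHat v.toL2 ξ * (starRingEnd ℂ) (fourierHat w.toL2 ξ)).re := by
      rw [← integral_add (integrable_fourier_mul u w) (integrable_fourier_mul v w)]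
      refine integral_congr_ae ?_
      filter_upwards [fourierHat_add u.toL2 v.toL2] with ξ hξ
      rw [toL2_add, hξ, add_mul, Complex.add_re, mul_add]
    have h2 : (∫ x : Space N, V x * ((u + v).toL2 x * w.toL2 x)) =
        (∫ x : Space N, V x * (u.toL2 x * w.toL2 x)) +
        ∫ x : Space N, V x * (v.toL2 x * w.toL2 x) := by
      rw [← integral_add (integrable_potential_mul u w) (integrable_potential_mul v w)]
      refine integral_congr_ae ?_
      filter_upwards [Lp.coeFn_add u.toL2 v.toL2] with x hx
      rw [toL2_add, hx, Pi.add_apply]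
      ring
    rw [h1, h2]
    ring
  smul_left u v c := by
    simp only [scalarProduct, conj_trivial]
    rw [mul_add, ← integral_const_mul, ← integral_const_mul]
    congr 1
    · refine integral_congr_ae ?_
      filter_upwards [fourierHat_smul c u.toL2] with ξ hξ
      rw [toL2_smul, hξ, mul_assoc, Complex.re_ofReal_mul]
      ring
    · refine integral_congr_ae ?_
      filter_upwards [Lp.coeFn_smul c u.toL2] with x hx
      rw [toL2_smul, hx, Pi.smul_apply, smul_eq_mul]
      ring
  definite u hu := by
    have hu' : scalarProduct u u = 0 := hu
    rw [scalarProduct_self] at hu'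
    have hA : 0 ≤ ∫ ξ : Space N, ‖ξ‖ ^ α * ‖fourierHat u.toL2 ξ‖ ^ 2 :=
      integral_nonneg fun ξ => by simp only [Pi.zero_apply]; positivity
    have hnn : 0 ≤ fun x : Space N => V x * |u.toL2 x| ^ 2 :=
      fun x => mul_nonneg (V.pos x).le (by positivity)
    have hB : 0 ≤ ∫ x : Space N, V x * |u.toL2 x| ^ 2 := integral_nonneg hnn
    have hB0 : ∫ x : Space N, V x * |u.toL2 x| ^ 2 = 0 := by linarith
    have h0 := (integral_eq_zero_iff_of_nonneg hnn u.integrable_potential).1 hB0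
    refine toL2_injective ?_
    rw [toL2_zero]
    refine (Lp.eq_zero_iff_ae_eq_zero).2 ?_
    filter_upwards [h0] with x hx
    have hV := (V.pos x).ne'
    simpa [hV] using hx

/-- The norm `‖u‖² = ∫ |ξ|^α |û(ξ)|² dξ + ∫ V |u|² dx`. -/
instance instNormedAddCommGroup : NormedAddCommGroup (EnergySpace α V) :=
  innerCore.toNormedAddCommGroup

instance instInnerProductSpace : InnerProductSpace ℝ (EnergySpace α V) :=
  InnerProductSpace.ofCore innerCore.toCore

theorem norm_sq_eq (u : EnergySpace α V) :
    ‖u‖ ^ 2 = (∫ ξ : Space N, ‖ξ‖ ^ α * ‖fourierHat u.toL2 ξ‖ ^ 2) +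
      ∫ x : Space N, V x * |u.toL2 x| ^ 2 := by
  rw [← real_inner_self_eq_norm_sq]
  exact scalarProduct_self u

end EnergySpace

/-! ### Weak gradients -/

/-- `g ∈ L²(ℝ^N; ℝ^N)` is the weak gradient of `u`. -/
def IsL2WeakGradient {N : ℕ} (u : Space N → ℝ) (g : Space N → Space N) : Prop :=
  MemLp g 2 volume ∧
    ∀ φ : Space N → ℝ, ContDiff ℝ ∞ φ → HasCompactSupport φ → ∀ i : Fin N,
      ∫ x, u x * fderiv ℝ φ x (EuclideanSpace.single i 1) = - ∫ x, g x i * φ x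

open Classical in
/-- The Dirichlet integral `∫ |∇u|² dx` of a function with weak gradient in `L²` (the weak gradient
is unique almost everywhere, so that the choice is irrelevant). -/
def dirichletIntegral {N : ℕ} (u : Space N → ℝ) : ℝ :=
  if h : ∃ g, IsL2WeakGradient u g then ∫ x, ‖h.choose x‖ ^ 2 else 0

/-! ### The nonlinearity -/

/-- The primitive `F(x, u) = ∫_0^u f(x, s) ds`. -/
def primitive {N : ℕ} (f : Space N → ℝ → ℝ) (x : Space N) (u : ℝ) : ℝ :=
  ∫ s in (0 : ℝ)..u, f x s

/-- The hypotheses on the nonlinearity `f`, with respect to the exponents `2 < q < p < 2N/(N-α)`. -/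
structure NonlinearityAssumptions {N : ℕ} (α q : ℝ) (f : Space N → ℝ → ℝ) : Prop where
  /-- `f` is Lebesgue measurable on `ℝ^N × ℝ`. -/
  aemeasurable : AEMeasurable (Function.uncurry f) (volume : Measure (Space N × ℝ))
  /-- `f` is `ℤ^N`-periodic in `x`. -/
  periodic : ∀ k : Fin N → ℤ, ∀ᵐ x : Space N, ∀ u, f (x + latticeVector k) u = f x u
  continuous : ∀ᵐ x : Space N, Continuous (f x)
  growth : ∃ c p : ℝ, 0 < c ∧ 2 < q ∧ q < p ∧ p < 2 * N / (N - α) ∧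
    ∀ᵐ x : Space N, ∀ u, |f x u| ≤ c * (1 + |u| ^ (p - 1))
  /-- `f(x, u) = o(|u|)` as `u → 0`, uniformly in `x`. -/
  small_at_zero : ∀ ε > 0, ∃ δ > 0, ∀ᵐ x : Space N, ∀ u, 0 < |u| → |u| < δ → |f x u| ≤ ε * |u|
  /-- `F(x, u) / |u|^q → ∞` as `|u| → ∞`, uniformly in `x`. -/
  superlinear : ∀ M : ℝ, ∃ R > 0, ∀ᵐ x : Space N, ∀ u, R ≤ |u| → M ≤ primitive f x u / |u| ^ q
  /-- `u ↦ f(x, u) / |u|^(q-1)` is strictly increasing on both half-lines. -/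
  strictMono : ∀ᵐ x : Space N,
    StrictMonoOn (fun u => f x u / |u| ^ (q - 1)) (Set.Iio 0) ∧
      StrictMonoOn (fun u => f x u / |u| ^ (q - 1)) (Set.Ioi 0)

/-- The hypotheses on the coefficient `Γ`. -/
structure CoefficientAssumptions {N : ℕ} (Γ : Space N → ℝ) : Prop where
  memLp_top : MemLp Γ ∞ volume
  /-- `Γ` is `ℤ^N`-periodic. -/
  periodic : ∀ k : Fin N → ℤ, ∀ᵐ x : Space N, Γ (x + latticeVector k) = Γ x
  nonneg : ∀ᵐ x : Space N, 0 ≤ Γ x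

/-! ### The energy functional -/

/-- The integrand `F(x, u(x)) - (1/q) Γ(x) |u(x)|^q` of the nonlinear part of the functional. -/
def nonlinearIntegrand {N : ℕ} (q : ℝ) (f : Space N → ℝ → ℝ) (Γ : Space N → ℝ)
    (u : Space N → ℝ) (x : Space N) : ℝ :=
  primitive f x (u x) - 1 / q * Γ x * |u x| ^ q

/-- The functional `J` on the energy space: the kinetic part is `½ ∫ |ξ|^α |û|² dξ` for `α ≠ 2` and
`½ ∫ |∇u|² dx` for `α = 2`. -/
def energyFunctional {N : ℕ} {α : ℝ} {V : CoercivePotential N} (q : ℝ) (f : Space N → ℝ → ℝ)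
    (Γ : Space N → ℝ) (u : EnergySpace α V) : ℝ :=
  1 / 2 * (if α = 2 then dirichletIntegral u.toL2
      else ∫ ξ : Space N, ‖ξ‖ ^ α * ‖fourierHat u.toL2 ξ‖ ^ 2) +
    1 / 2 * (∫ x : Space N, V x * |u.toL2 x| ^ 2) -
    ∫ x : Space N, nonlinearIntegrand q f Γ u.toL2 x

/-- The Nehari manifold `{u ≠ 0 : J'(u)(u) = 0}` of a functional `J`. -/
def nehariManifold {E : Type*} [NormedAddCommGroup E] [NormedSpace ℝ E] (J : E → ℝ) : Set E :=
  {u | u ≠ 0 ∧ DifferentiableAt ℝ J u ∧ fderiv ℝ J u u = 0}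

/-- A ground state of `J`: a nontrivial critical point minimizing `J` on the Nehari manifold. -/
def IsGroundState {E : Type*} [NormedAddCommGroup E] [NormedSpace ℝ E] (J : E → ℝ) (u : E) : Prop :=
  u ≠ 0 ∧ HasFDerivAt J (0 : E →L[ℝ] ℝ) u ∧ IsLeast (J '' nehariManifold J) (J u)

end

end FractionalSchrodinger

/-!
The functional is `J(u) = ½‖u‖² - Ψ(u)`, where `‖·‖` is the Hilbert norm of the energy space and
`Ψ(u) = ∫ G(x, u(x)) dx` for a primitive `G` of `g(x, s) = f(x, s) - Γ(x)|s|^(q-2) s`. Since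
`s ↦ f(x, s)/|s|^(q-1)` is increasing and `Γ(x)|s|^(q-2) s` is homogeneous of degree `q - 1`, the map
`t ↦ Ψ'(tu)u / t^(q-1)` is nondecreasing on `(0, ∞)`; as `q > 2`, along each ray `t ↦ J(tu)` first
increases up to a single point of the Nehari manifold and then decreases. The same monotonicity,
integrated, gives `qΨ(u) ≤ Ψ'(u)u`, so that `J ≥ (½ - 1/q)‖·‖²` on the Nehari manifold and minimizing
sequences are bounded.

The ground state is then obtained by the direct method (`exists_isGroundState`, for abstract `Ψ`).
Along a bounded minimizing sequence `u n ⇀ v` all nonlinear terms converge, because the coercive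
potential makes the embedding into `L^p` compact; `v ≠ 0` since the Nehari manifold stays away from
`0`; and the multiple `t • v` on the Nehari manifold satisfies
`J(tv) ≤ lim inf J(t u n) ≤ lim J(u n) = inf J`. A minimizer `w` on the Nehari manifold is a critical
point: if `J'(w)v < 0` for some `v`, then the intermediate value theorem gives a point `s w + ε v` of
the Nehari manifold with `s` near `1`, at which `J` is smaller than `J(sw) ≤ J(w)`
(`deriv_eq_zero_of_minimizer`).

The analytic ingredients rest on the Fourier transform on `L²`. Splitting `u` into frequencies
below and above `K`, the low part is bounded by `C K^((N-α)/2)` and the high part is small in `L²`;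
choosing `K` according to the level `t` yields the weak-type bound `|{|u| > t}| ≤ C t^(-2N/(N-α))`
(`exists_volume_lt_abs_le`), which implies the Sobolev embedding for all subcritical exponents
(`exists_integral_rpow_le`). The same splitting gives compactness in `L²`: outside of a large ball
the potential controls the mass, and on the ball the low frequencies converge pointwise and
boundedly along a weakly convergent subsequence of Fourier transforms (`exists_subseq_tendsto_toL2`);
interpolation gives compactness in `L^p`. The functional is `C¹` because superposition operators
`u ↦ g(·, u)` are continuous from the energy space into its dual (`exists_hasFDerivAt_primitive`). For
`α = 2`, the inverse Fourier transform of `2πiη û(η)` is the weak gradient, and the Plancherel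
identity turns the Dirichlet integral into the kinetic term (`dirichletIntegral_eq`).
-/

namespace FractionalSchrodinger

open Topology

/-! ### The Fourier transform on `L²` -/

theorem norm_sq_eq_integral {N : ℕ} {𝕜 : Type*} [RCLike 𝕜]
    (h : Lp 𝕜 2 (volume : Measure (Space N))) : ‖h‖ ^ 2 = ∫ x, ‖h x‖ ^ 2 := by
  have h1 := L2.inner_def (𝕜 := 𝕜) h h
  rw [inner_self_eq_norm_sq_to_K] at h1
  simp_rw [inner_self_eq_norm_sq_to_K] at h1
  have h2 : (((∫ x, ‖h x‖ ^ 2 : ℝ)) : 𝕜) = ∫ x, ((‖h x‖ : 𝕜)) ^ 2 := by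
    rw [← integral_ofReal]; simp
  rw [← h2] at h1
  exact_mod_cast h1

theorem integrable_norm_sq {N : ℕ} {𝕜 : Type*} [RCLike 𝕜]
    (h : Lp 𝕜 2 (volume : Measure (Space N))) : Integrable (fun x => ‖h x‖ ^ 2) := by
  simpa using (Lp.memLp h).integrable_norm_rpow (by norm_num) (by norm_num)

theorem toComplexL2_coeFn {N : ℕ} (u : RealL2 N) :
    toComplexL2 u =ᵐ[volume] fun x => (u x : ℂ) :=
  Complex.ofRealCLM.coeFn_compLpL u

theorem norm_toComplexL2 {N : ℕ} (u : RealL2 N) : ‖toComplexL2 u‖ = ‖u‖ := by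
  have h : ‖toComplexL2 u‖ ^ 2 = ‖u‖ ^ 2 := by
    rw [norm_sq_eq_integral, norm_sq_eq_integral]
    refine integral_congr_ae ?_
    filter_upwards [toComplexL2_coeFn u] with x hx
    rw [hx, Complex.norm_real]
  exact (pow_left_inj₀ (norm_nonneg _) (norm_nonneg _) two_ne_zero).1 h

theorem toComplexL2_sub {N : ℕ} (u v : RealL2 N) :
    toComplexL2 (u - v) = toComplexL2 u - toComplexL2 v := by
  rw [toComplexL2, map_sub]; rfl

/-- Mathlib's unitary Fourier transform of a real-valued `L²` function. -/
noncomputable def fourierL2 {N : ℕ} (u : RealL2 N) : ComplexL2 N := 𝓕 (toComplexL2 u)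

theorem norm_fourierL2 {N : ℕ} (u : RealL2 N) : ‖fourierL2 u‖ = ‖u‖ := by
  rw [fourierL2, Lp.norm_fourier_eq, norm_toComplexL2]

theorem fourierL2_sub {N : ℕ} (u v : RealL2 N) :
    fourierL2 (u - v) = fourierL2 u - fourierL2 v := by
  rw [fourierL2, toComplexL2_sub]
  exact (Lp.fourierTransformₗᵢ (Space N) ℂ).map_sub _ _

theorem fourierInv_fourierL2 {N : ℕ} (u : RealL2 N) :
    𝓕⁻ (fourierL2 u) = toComplexL2 u := by
  rw [fourierL2, FourierTransform.fourierInv_fourier_eq]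

/-- The symbol `|ξ|^α |û(ξ)|²` in the frequency variable `η = ξ / 2π`, up to the Jacobian. -/
theorem kinetic_integrand_eq {N : ℕ} (α : ℝ) (u : RealL2 N) (ξ : Space N) :
    ‖ξ‖ ^ α * ‖fourierHat u ξ‖ ^ 2 = (2 * Real.pi) ^ (-(N : ℝ)) *
      ((2 * Real.pi * ‖(2 * Real.pi)⁻¹ • ξ‖) ^ α * ‖fourierL2 u ((2 * Real.pi)⁻¹ • ξ)‖ ^ 2) := by
  have hp : 0 < 2 * Real.pi := by positivity
  have h1 : 2 * Real.pi * ‖(2 * Real.pi)⁻¹ • ξ‖ = ‖ξ‖ := by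
    rw [norm_smul, Real.norm_of_nonneg (by positivity)]
    field_simp
  have h2 : ((2 * Real.pi) ^ (-(N : ℝ) / 2)) ^ 2 = (2 * Real.pi) ^ (-(N : ℝ)) := by
    rw [← Real.rpow_natCast, ← Real.rpow_mul hp.le]
    congr 1; push_cast; ring
  rw [h1, fourierHat, norm_mul, mul_pow, Complex.norm_real,
    Real.norm_of_nonneg (by positivity), h2]
  simp only [fourierL2]
  ring

theorem integrable_kinetic_iff {N : ℕ} (α : ℝ) (u : RealL2 N) :
    Integrable (fun ξ : Space N => ‖ξ‖ ^ α * ‖fourierHat u ξ‖ ^ 2) ↔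
      Integrable (fun η : Space N => (2 * Real.pi * ‖η‖) ^ α * ‖fourierL2 u η‖ ^ 2) := by
  have hp : 0 < 2 * Real.pi := by positivity
  simp_rw [kinetic_integrand_eq]
  rw [integrable_const_mul_iff (IsUnit.mk0 _ (by positivity))]
  exact integrable_comp_smul_iff volume
    (fun η : Space N => (2 * Real.pi * ‖η‖) ^ α * ‖fourierL2 u η‖ ^ 2) (inv_ne_zero hp.ne')

theorem integral_kinetic_eq {N : ℕ} (α : ℝ) (u : RealL2 N) :
    ∫ ξ : Space N, ‖ξ‖ ^ α * ‖fourierHat u ξ‖ ^ 2 =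
      ∫ η : Space N, (2 * Real.pi * ‖η‖) ^ α * ‖fourierL2 u η‖ ^ 2 := by
  have hp : 0 < 2 * Real.pi := by positivity
  simp_rw [kinetic_integrand_eq]
  rw [integral_const_mul, Measure.integral_comp_smul volume
    (fun η : Space N => (2 * Real.pi * ‖η‖) ^ α * ‖fourierL2 u η‖ ^ 2)]
  rw [finrank_euclideanSpace_fin, inv_pow, inv_inv, abs_of_pos (by positivity), smul_eq_mul,
    ← mul_assoc, Real.rpow_neg hp.le, Real.rpow_natCast, inv_mul_cancel₀ (by positivity), one_mul]

/-- On `L¹ ∩ L²` the inverse Fourier transform of `L²` is given by the usual integral. -/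
theorem fourierInv_coeFn_of_integrable {N : ℕ} (h : ComplexL2 N) (hi : Integrable h) :
    (𝓕⁻ h : ComplexL2 N) =ᵐ[volume] fun x => 𝓕⁻ (h : Space N → ℂ) x := by
  have hcont : Continuous (𝓕⁻ (h : Space N → ℂ)) :=
    VectorFourier.fourierIntegral_continuous Real.continuous_fourierChar
      (by exact continuous_inner.neg) hi
  refine ae_eq_of_integral_contDiff_smul_eq ((Lp.memLp _).locallyIntegrable (by norm_num))
    hcont.locallyIntegrable fun g hg hgc => ?_
  have hg₁ : HasCompactSupport (Complex.ofRealCLM ∘ g) := hgc.comp_left rfl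
  have hg₂ : ContDiff ℝ ∞ (Complex.ofRealCLM ∘ g) := by fun_prop
  set φ : SchwartzMap (Space N) ℂ := hg₁.toSchwartzMap hg₂ with hφ
  have h1 : ∫ x, g x • (𝓕⁻ h : ComplexL2 N) x
      = (Lp.toTemperedDistribution (𝓕⁻ h : ComplexL2 N)) φ := by
    rw [Lp.toTemperedDistribution_apply]; rfl
  have h3 := VectorFourier.integral_bilin_fourierIntegral_eq_flip (μ := volume) (ν := volume)
    (L := -(innerₗ (Space N))) (ContinuousLinearMap.mul ℂ ℂ) Real.continuous_fourierChar
      (by exact continuous_inner.neg) (φ.integrable (μ := volume)) hi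
  rw [h1, ← Lp.fourierInv_toTemperedDistribution_eq, TemperedDistribution.fourierInv_apply,
    Lp.toTemperedDistribution_apply]
  have hflip : (-(innerₗ (Space N))).flip = -(innerₗ (Space N)) := by
    ext x y; simp [real_inner_comm]
  rw [hflip] at h3
  have h4 : ∀ x, g x • 𝓕⁻ (h : Space N → ℂ) x = φ x * 𝓕⁻ (h : Space N → ℂ) x := fun x =>
    Complex.real_smul
  simp_rw [h4, smul_eq_mul]
  rw [SchwartzMap.fourierInv_coe]
  exact h3

variable {N : ℕ} {α : ℝ} {V : CoercivePotential N}

/-! ### Comparison of the energy norm with the `L²` norm and the kinetic energy -/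

theorem kinetic_le_norm_sq (u : EnergySpace α V) :
    ∫ η : Space N, (2 * Real.pi * ‖η‖) ^ α * ‖fourierL2 u.toL2 η‖ ^ 2 ≤ ‖u‖ ^ 2 := by
  rw [u.norm_sq_eq, ← integral_kinetic_eq]
  have : 0 ≤ ∫ x : Space N, V x * |u.toL2 x| ^ 2 :=
    integral_nonneg fun x => mul_nonneg (V.pos x).le (by positivity)
  linarith

theorem potential_le_norm_sq (u : EnergySpace α V) :
    ∫ x : Space N, V x * |u.toL2 x| ^ 2 ≤ ‖u‖ ^ 2 := by
  rw [u.norm_sq_eq]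
  have : 0 ≤ ∫ ξ : Space N, ‖ξ‖ ^ α * ‖fourierHat u.toL2 ξ‖ ^ 2 :=
    integral_nonneg fun x => by simp only [Pi.zero_apply]; positivity
  linarith

theorem integrable_fourierL2_weight (u : EnergySpace α V) :
    Integrable (fun η : Space N => (2 * Real.pi * ‖η‖) ^ α * ‖fourierL2 u.toL2 η‖ ^ 2) :=
  (integrable_kinetic_iff α _).1 u.integrable_fourier

theorem exists_norm_toL2_sq_le (V : CoercivePotential N) :
    ∃ C > 0, ∀ (α : ℝ) (u : EnergySpace α V), ‖u.toL2‖ ^ 2 ≤ C * ‖u‖ ^ 2 := by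
  refine ⟨(⨅ x, V.toFun x)⁻¹, inv_pos.2 V.iInf_pos, fun α u => ?_⟩
  have hb : BddBelow (Set.range V.toFun) := by
    by_contra h
    have h1 := V.iInf_pos
    rw [Real.iInf_of_not_bddBelow h] at h1
    exact lt_irrefl _ h1
  rw [← div_eq_inv_mul, le_div_iff₀ V.iInf_pos, mul_comm, norm_sq_eq_integral,
    ← integral_const_mul]
  refine le_trans (integral_mono ((integrable_norm_sq u.toL2).const_mul _)
    u.integrable_potential fun x => ?_) (potential_le_norm_sq u)
  exact mul_le_mul_of_nonneg_right (ciInf_le hb x) (by positivity)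

theorem volume_norm_ge_le (h : ComplexL2 N) {ε : ℝ} (hε : 0 < ε) :
    volume {x | ε ≤ ‖h x‖} ≤ ENNReal.ofReal (‖h‖ ^ 2 / ε ^ 2) := by
  have h1 : {x | ε ≤ ‖h x‖} = {x | ENNReal.ofReal (ε ^ 2) ≤ ENNReal.ofReal (‖h x‖ ^ 2)} := by
    ext x
    simp only [Set.mem_ofPred_eq]
    rw [ENNReal.ofReal_le_ofReal_iff (by positivity), pow_le_pow_iff_left₀ hε.le (norm_nonneg _)
      two_ne_zero]
  rw [h1, norm_sq_eq_integral, ENNReal.ofReal_div_of_pos (by positivity),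
    ofReal_integral_eq_lintegral_ofReal (integrable_norm_sq h)
      (Eventually.of_forall fun x => by positivity)]
  exact meas_ge_le_lintegral_div
    ((Lp.aestronglyMeasurable h).norm.pow 2).aemeasurable.ennreal_ofReal (by simpa using hε.ne')
    ENNReal.ofReal_ne_top

/-! ### Frequency cut-off -/

/-- The restriction of `w` to the frequencies `|η| < K`. -/
noncomputable def lowFreq (K : ℝ) (w : ComplexL2 N) : ComplexL2 N :=
  ((Lp.memLp w).indicator (Metric.isOpen_ball (x := (0 : Space N)) (ε := K)).measurableSet).toLp _

theorem lowFreq_coeFn (K : ℝ) (w : ComplexL2 N) :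
    lowFreq K w =ᵐ[volume] (Metric.ball (0 : Space N) K).indicator w :=
  MemLp.coeFn_toLp _

theorem integrable_lowFreq (K : ℝ) (w : ComplexL2 N) : Integrable (lowFreq K w) := by
  refine Integrable.congr ?_ (lowFreq_coeFn K w).symm
  rw [integrable_indicator_iff Metric.isOpen_ball.measurableSet]
  exact ((Lp.memLp w).locallyIntegrable (by norm_num)).integrableOn_isCompact
    (isCompact_closedBall 0 K) |>.mono_set Metric.ball_subset_closedBall

theorem norm_sub_lowFreq_sq_le (hα : 0 < α) (u : EnergySpace α V) {K : ℝ} (hK : 0 < K) :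
    ‖fourierL2 u.toL2 - lowFreq K (fourierL2 u.toL2)‖ ^ 2 ≤ K ^ (-α) * ‖u‖ ^ 2 := by
  refine le_trans ?_ (mul_le_mul_of_nonneg_left (kinetic_le_norm_sq u) (by positivity))
  rw [norm_sq_eq_integral, ← integral_const_mul]
  refine integral_mono_ae (integrable_norm_sq _) ((integrable_fourierL2_weight u).const_mul _) ?_
  filter_upwards [lowFreq_coeFn K (fourierL2 u.toL2), Lp.coeFn_sub (fourierL2 u.toL2)
    (lowFreq K (fourierL2 u.toL2))] with η h1 h2
  rw [h2, Pi.sub_apply, h1]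
  by_cases hη : η ∈ Metric.ball (0 : Space N) K
  · rw [Set.indicator_of_mem hη, sub_self, norm_zero, zero_pow two_ne_zero]
    positivity
  · rw [Set.indicator_of_notMem hη, sub_zero]
    have h3 : K ≤ ‖η‖ := by simpa using hη
    have h4 : K ^ α ≤ (2 * Real.pi * ‖η‖) ^ α := by
      refine Real.rpow_le_rpow hK.le (h3.trans ?_) hα.le
      have : 1 ≤ 2 * Real.pi := by linarith [Real.pi_gt_three]
      nlinarith [norm_nonneg η]
    have h5 : 1 ≤ K ^ (-α) * (2 * Real.pi * ‖η‖) ^ α := by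
      rw [Real.rpow_neg hK.le, ← div_eq_inv_mul, one_le_div (by positivity)]
      exact h4
    rw [← mul_assoc]
    nlinarith [sq_nonneg ‖fourierL2 u.toL2 η‖]

theorem norm_fourierInv_lowFreq_le (K : ℝ) (w : ComplexL2 N) (x : Space N) :
    ‖𝓕⁻ (lowFreq K w : Space N → ℂ) x‖ ≤ ∫ η in Metric.ball (0 : Space N) K, ‖w η‖ := by
  have h := VectorFourier.norm_fourierIntegral_le_integral_norm Real.fourierChar volume
    (-(innerₗ (Space N))) (lowFreq K w : Space N → ℂ) x
  refine h.trans_eq ?_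
  rw [← integral_indicator Metric.isOpen_ball.measurableSet]
  refine integral_congr_ae ?_
  filter_upwards [lowFreq_coeFn K w] with η hη
  rw [hη, norm_indicator_eq_indicator_norm]

theorem integrableOn_weight_inv (hN : α < N) (hα : 0 < α) (K : ℝ) :
    IntegrableOn (fun η : Space N => (2 * Real.pi * ‖η‖) ^ (-α)) (Metric.ball 0 K) := by
  have hN1 : 1 ≤ N := by
    have : (0 : ℝ) < N := hα.trans hN
    exact_mod_cast this
  refine integrableOn_ball_of_norm_le_rpow (C := (2 * Real.pi) ^ (-α)) (α := α) (by simpa using hN1)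
    (by simpa using hN) (Eventually.of_forall fun x => ?_) ?_
  · rw [Real.norm_of_nonneg (by positivity), Real.mul_rpow (by positivity) (norm_nonneg _)]
  · have : Measurable (fun η : Space N => (2 * Real.pi * ‖η‖) ^ (-α)) := by fun_prop
    exact this.aestronglyMeasurable

/-- `∫_{|η| < K} (2π|η|)^(-α) dη` scales like `K^(N-α)`. -/
theorem setIntegral_weight_inv {K : ℝ} (hK : 0 < K) :
    ∫ η in Metric.ball (0 : Space N) K, (2 * Real.pi * ‖η‖) ^ (-α) =
      K ^ (N - α) * ∫ η in Metric.ball (0 : Space N) 1, (2 * Real.pi * ‖η‖) ^ (-α) := by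
  have h := Measure.setIntegral_comp_smul volume
    (fun η : Space N => (2 * Real.pi * ‖η‖) ^ (-α)) (Metric.ball 0 1) hK.ne'
  have h2 : ∀ x : Space N, (2 * Real.pi * ‖K • x‖) ^ (-α)
      = K ^ (-α) * (2 * Real.pi * ‖x‖) ^ (-α) := fun x => by
    rw [norm_smul, Real.norm_of_nonneg hK.le, ← Real.mul_rpow hK.le (by positivity)]
    congr 1; ring
  simp_rw [h2] at h
  rw [integral_const_mul, smul_unitBall_of_pos hK, finrank_euclideanSpace_fin,
    abs_of_pos (by positivity), smul_eq_mul] at h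
  rw [sub_eq_add_neg, Real.rpow_add hK, mul_assoc, h, Real.rpow_natCast, ← mul_assoc,
    mul_inv_cancel₀ (by positivity), one_mul]

/-- The low-frequency part of a function of energy norm at most one is bounded. -/
theorem exists_lowFreq_bound (hN : α < N) (hα : 0 < α) :
    ∃ C > 0, ∀ {V : CoercivePotential N} (u : EnergySpace α V), ‖u‖ ≤ 1 → ∀ K > 0, ∀ x,
      ‖𝓕⁻ (lowFreq K (fourierL2 u.toL2) : Space N → ℂ) x‖ ≤ C * K ^ ((N - α) / 2) := by
  set c := ∫ η in Metric.ball (0 : Space N) 1, (2 * Real.pi * ‖η‖) ^ (-α) with hc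
  have hc0 : 0 ≤ c := setIntegral_nonneg Metric.isOpen_ball.measurableSet
    fun x _ => by positivity
  refine ⟨c + 1, by positivity, fun {V} u hu K hK x => (norm_fourierInv_lowFreq_le _ _ _).trans ?_⟩
  set t := K ^ (-((N - α) / 2)) with ht
  have ht0 : 0 < t := by positivity
  have hcast : (0 : ℝ) < N := hα.trans hN
  have : Nonempty (Fin N) := ⟨⟨0, by exact_mod_cast hcast⟩⟩
  have hne : ∀ᵐ η : Space N, η ≠ 0 := by
    have : (volume : Measure (Space N)) {0} = 0 := measure_singleton 0
    exact compl_mem_ae_iff.2 this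
  have hint : Integrable (fun η : Space N =>
      t⁻¹ * ((2 * Real.pi * ‖η‖) ^ α * ‖fourierL2 u.toL2 η‖ ^ 2)) :=
    (integrable_fourierL2_weight u).const_mul _
  have hint2 : IntegrableOn (fun η : Space N => t * (2 * Real.pi * ‖η‖) ^ (-α))
      (Metric.ball 0 K) := (integrableOn_weight_inv hN hα K).const_mul _
  -- Young's inequality with the weight `t`, which balances the two resulting integrals
  have hle : ∫ η in Metric.ball (0 : Space N) K, ‖fourierL2 u.toL2 η‖ ≤
      ∫ η in Metric.ball (0 : Space N) K, (t * (2 * Real.pi * ‖η‖) ^ (-α) +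
        t⁻¹ * ((2 * Real.pi * ‖η‖) ^ α * ‖fourierL2 u.toL2 η‖ ^ 2)) := by
    refine integral_mono_ae ?_ (hint2.add hint.integrableOn) ?_
    · exact (((Lp.memLp (fourierL2 u.toL2)).locallyIntegrable (by norm_num)).integrableOn_isCompact
        (isCompact_closedBall 0 K) |>.mono_set Metric.ball_subset_closedBall).norm
    · filter_upwards [ae_restrict_of_ae hne] with η hη
      have hpos : 0 < 2 * Real.pi * ‖η‖ := by
        have := norm_pos_iff.2 hη
        positivity
      have hσ : 0 < (2 * Real.pi * ‖η‖) ^ α := by positivity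
      rw [Real.rpow_neg hpos.le]
      set σ := (2 * Real.pi * ‖η‖) ^ α
      set y := ‖fourierL2 u.toL2 η‖
      have hy : 0 ≤ y := norm_nonneg _
      have : t * σ⁻¹ + t⁻¹ * (σ * y ^ 2) - y = (σ * y - t) ^ 2 / (t * σ) + y := by
        field_simp; ring
      have h0 : 0 ≤ (σ * y - t) ^ 2 / (t * σ) := by positivity
      linarith
  refine hle.trans ?_
  rw [integral_add hint2 hint.integrableOn, integral_const_mul, setIntegral_weight_inv hK, ← hc]
  have h1 : ∫ η in Metric.ball (0 : Space N) K,
      t⁻¹ * ((2 * Real.pi * ‖η‖) ^ α * ‖fourierL2 u.toL2 η‖ ^ 2) ≤ t⁻¹ := by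
    refine (setIntegral_le_integral hint (Eventually.of_forall fun η => by positivity)).trans ?_
    rw [integral_const_mul]
    have := kinetic_le_norm_sq u
    have h2 : ‖u‖ ^ 2 ≤ 1 := pow_le_one₀ (norm_nonneg _) hu
    have h3 : 0 < t⁻¹ := by positivity
    nlinarith
  have h2 : t⁻¹ = K ^ ((N - α) / 2) := by rw [ht, Real.rpow_neg hK.le, inv_inv]
  have h3 : t * K ^ (N - α) = K ^ ((N - α) / 2) := by
    rw [ht, ← Real.rpow_add hK]; congr 1; ring
  calc _ ≤ t * (K ^ (N - α) * c) + t⁻¹ := by linarith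
    _ = (c + 1) * K ^ ((N - α) / 2) := by rw [← mul_assoc, h3, h2]; ring

/-! ### The subcritical Sobolev embedding -/

/-- The `L²` function `u` is the sum of its low- and high-frequency parts. -/
theorem toComplexL2_ae_eq_add (K : ℝ) (u : RealL2 N) :
    ∀ᵐ x, (u x : ℂ) = 𝓕⁻ (lowFreq K (fourierL2 u) : Space N → ℂ) x +
      (𝓕⁻ (fourierL2 u - lowFreq K (fourierL2 u)) : ComplexL2 N) x := by
  have h1 : toComplexL2 u = 𝓕⁻ (lowFreq K (fourierL2 u)) +
      𝓕⁻ (fourierL2 u - lowFreq K (fourierL2 u)) := by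
    rw [← FourierTransform.fourierInv_add, add_sub_cancel, fourierInv_fourierL2]
  filter_upwards [toComplexL2_coeFn u, Lp.coeFn_add (𝓕⁻ (lowFreq K (fourierL2 u)))
    (𝓕⁻ (fourierL2 u - lowFreq K (fourierL2 u))),
    fourierInv_coeFn_of_integrable _ (integrable_lowFreq K (fourierL2 u))] with x h2 h3 h4
  rw [← h2, h1, h3, Pi.add_apply, h4]

theorem norm_fourierInv_L2 (w : ComplexL2 N) : ‖(𝓕⁻ w : ComplexL2 N)‖ = ‖w‖ :=
  (Lp.fourierTransformₗᵢ (Space N) ℂ).symm.norm_map w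

/-- The weak-type Sobolev inequality with the critical exponent. -/
theorem exists_volume_lt_abs_le (hN : α < N) (hα : 0 < α) (V : CoercivePotential N) :
    ∃ C > 0, ∀ u : EnergySpace α V, ‖u‖ ≤ 1 → ∀ t > 0,
      volume {x | t < |u.toL2 x|} ≤ ENNReal.ofReal (C * t ^ (-(2 * N / (N - α)))) := by
  obtain ⟨C, hC, hb⟩ := exists_lowFreq_bound hN hα
  have hNα : 0 < N - α := sub_pos.2 hN
  refine ⟨4 * (2 * C) ^ (2 * α / (N - α)), by positivity, fun u hu t ht => ?_⟩
  -- at this frequency the low-frequency part is bounded by `t / 2`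
  set K := (t / (2 * C)) ^ (2 / (N - α)) with hK
  have hK0 : 0 < K := by positivity
  have hKb : C * K ^ ((N - α) / 2) = t / 2 := by
    rw [hK, ← Real.rpow_mul (by positivity)]
    rw [show 2 / (N - α) * ((N - α) / 2) = 1 by field_simp, Real.rpow_one]
    field_simp
  have hlow := fun x => (hb u hu K hK0 x).trans_eq hKb
  set w := fourierL2 u.toL2
  set h : ComplexL2 N := 𝓕⁻ (w - lowFreq K w) with hh
  have hsub : volume {x | t < |u.toL2 x|} ≤ volume {x | t / 2 ≤ ‖h x‖} := by
    refine measure_mono_ae ?_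
    filter_upwards [toComplexL2_ae_eq_add K u.toL2] with x hx hxt
    have hxt' : t < |u.toL2 x| := hxt
    have h1 : |u.toL2 x| ≤ t / 2 + ‖h x‖ := by
      rw [← Real.norm_eq_abs, ← Complex.norm_real, hx]
      exact (norm_add_le _ _).trans (add_le_add_left (hlow x) _)
    show t / 2 ≤ ‖h x‖
    linarith
  refine hsub.trans ((volume_norm_ge_le h (by positivity)).trans (ENNReal.ofReal_le_ofReal ?_))
  have h1 : ‖h‖ ^ 2 ≤ K ^ (-α) := by
    rw [hh, norm_fourierInv_L2]
    refine (norm_sub_lowFreq_sq_le hα u hK0).trans ?_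
    have h2 : ‖u‖ ^ 2 ≤ 1 := pow_le_one₀ (norm_nonneg _) hu
    have h3 : 0 < K ^ (-α) := by positivity
    nlinarith
  have h2 : K ^ (-α) = (2 * C) ^ (2 * α / (N - α)) * t ^ (-(2 * α / (N - α))) := by
    rw [hK, ← Real.rpow_mul (by positivity), Real.div_rpow ht.le (by positivity),
      show 2 / (N - α) * -α = -(2 * α / (N - α)) by ring, Real.rpow_neg (by positivity : 0 ≤ 2 * C)]
    field_simp
  have h3 : t ^ (-(2 * N / (N - α))) = t ^ (-(2 * α / (N - α))) / t ^ 2 := by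
    rw [← Real.rpow_natCast t 2, ← Real.rpow_sub ht]
    congr 1
    field_simp
    push_cast
    ring
  rw [h3]
  calc ‖h‖ ^ 2 / (t / 2) ^ 2 ≤ K ^ (-α) / (t / 2) ^ 2 := by gcongr
    _ = _ := by rw [h2]; field_simp; norm_num

/-- The layer-cake formula, with the Chebyshev bound in `L²` for the levels `t ≤ 1` and the weak-type
Sobolev bound for the levels `t > 1`. -/
theorem exists_lintegral_rpow_le (hN : α < N) (hα : 0 < α) (V : CoercivePotential N) {p : ℝ}
    (hp : 2 < p) (hp' : p < 2 * N / (N - α)) :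
    ∃ M : ℝ, 0 < M ∧ ∀ u : EnergySpace α V, ‖u‖ ≤ 1 →
      ∫⁻ x, ENNReal.ofReal (|u.toL2 x| ^ p) ≤ ENNReal.ofReal M := by
  obtain ⟨C₁, hC₁, h₁⟩ := exists_norm_toL2_sq_le V
  obtain ⟨C₂, hC₂, h₂⟩ := exists_volume_lt_abs_le hN hα V
  set s := 2 * N / (N - α)
  have hi₁ : IntegrableOn (fun t : ℝ => C₁ * t ^ (p - 3)) (Set.Ioc 0 1) := by
    refine Integrable.const_mul ?_ _
    exact ((intervalIntegrable_iff_integrableOn_Ioc_of_le zero_le_one).1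
      (intervalIntegral.intervalIntegrable_rpow' (by linarith)))
  have hi₂ : IntegrableOn (fun t : ℝ => C₂ * t ^ (p - 1 - s)) (Set.Ioi 1) :=
    Integrable.const_mul (integrableOn_Ioi_rpow_of_lt (by linarith) one_pos) _
  set M₁ := ∫ t in Set.Ioc (0 : ℝ) 1, C₁ * t ^ (p - 3)
  set M₂ := ∫ t in Set.Ioi (1 : ℝ), C₂ * t ^ (p - 1 - s)
  have hM₁ : 0 ≤ M₁ := setIntegral_nonneg measurableSet_Ioc
    fun t ht => by have := ht.1; positivity
  have hM₂ : 0 ≤ M₂ := setIntegral_nonneg measurableSet_Ioi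
    fun t ht => by have : 0 < t := one_pos.trans ht; positivity
  refine ⟨p * (M₁ + M₂) + 1, by positivity, fun u hu => ?_⟩
  have hl2 : ∀ t > 0, volume {x | t < |u.toL2 x|} ≤ ENNReal.ofReal (C₁ / t ^ 2) := fun t ht => by
    refine le_trans (measure_mono_ae ?_) ((volume_norm_ge_le (toComplexL2 u.toL2) ht).trans
      (ENNReal.ofReal_le_ofReal ?_))
    · filter_upwards [toComplexL2_coeFn u.toL2] with x hx (hxt : t < |u.toL2 x|)
      show t ≤ ‖toComplexL2 u.toL2 x‖
      rw [hx, Complex.norm_real]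
      exact hxt.le
    · rw [norm_toComplexL2]
      gcongr
      refine (h₁ α u).trans ?_
      have h2 : ‖u‖ ^ 2 ≤ 1 := pow_le_one₀ (norm_nonneg _) hu
      nlinarith
  rw [lintegral_rpow_eq_lintegral_meas_lt_mul volume
    (Eventually.of_forall fun x => abs_nonneg (u.toL2 x))
    (Lp.aestronglyMeasurable u.toL2).norm.aemeasurable (by linarith)]
  have hsplit : Set.Ioi (0 : ℝ) = Set.Ioc 0 1 ∪ Set.Ioi 1 := by
    rw [Set.Ioc_union_Ioi_eq_Ioi zero_le_one]
  have hA : ∫⁻ t in Set.Ioc (0 : ℝ) 1, volume {x | t < |u.toL2 x|} * ENNReal.ofReal (t ^ (p - 1))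
      ≤ ENNReal.ofReal M₁ := by
    rw [ofReal_integral_eq_lintegral_ofReal hi₁
      (ae_restrict_of_forall_mem measurableSet_Ioc fun t ht => by have := ht.1; positivity)]
    refine setLIntegral_mono' measurableSet_Ioc fun t ht => ?_
    have ht0 := ht.1
    refine (mul_le_mul_left (hl2 t ht0) _).trans_eq ?_
    rw [← ENNReal.ofReal_mul (by positivity)]
    congr 1
    rw [show p - 3 = p - 1 - (2 : ℕ) by push_cast; ring, Real.rpow_sub ht0 (p - 1),
      Real.rpow_natCast]
    ring
  have hB : ∫⁻ t in Set.Ioi (1 : ℝ), volume {x | t < |u.toL2 x|} * ENNReal.ofReal (t ^ (p - 1))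
      ≤ ENNReal.ofReal M₂ := by
    rw [ofReal_integral_eq_lintegral_ofReal hi₂
      (ae_restrict_of_forall_mem measurableSet_Ioi
        fun t ht => by have : 0 < t := one_pos.trans ht; positivity)]
    refine setLIntegral_mono' measurableSet_Ioi fun t ht => ?_
    have ht0 : 0 < t := one_pos.trans ht
    refine (mul_le_mul_left (h₂ u hu t ht0) _).trans_eq ?_
    rw [← ENNReal.ofReal_mul (by positivity)]
    congr 1
    rw [sub_eq_add_neg (p - 1) s, Real.rpow_add ht0 (p - 1)]
    ring
  calc _ ≤ ENNReal.ofReal p * (ENNReal.ofReal M₁ + ENNReal.ofReal M₂) := by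
        rw [hsplit]
        gcongr
        exact (lintegral_union_le _ _ _).trans (add_le_add hA hB)
    _ = ENNReal.ofReal (p * (M₁ + M₂)) := by
        rw [← ENNReal.ofReal_add hM₁ hM₂, ENNReal.ofReal_mul (by linarith)]
    _ ≤ _ := ENNReal.ofReal_le_ofReal (by linarith)

theorem abs_smul_toL2_rpow (c p : ℝ) (u : EnergySpace α V) :
    (fun x => |(c • u).toL2 x| ^ p) =ᵐ[volume] fun x => |c| ^ p * |u.toL2 x| ^ p := by
  filter_upwards [Lp.coeFn_smul c u.toL2] with x hx
  rw [EnergySpace.toL2_smul, hx, Pi.smul_apply, smul_eq_mul, abs_mul,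
    Real.mul_rpow (abs_nonneg _) (abs_nonneg _)]

/-- The Sobolev embedding `E^{α/2} ⊂ L^p` for subcritical `p`. -/
theorem exists_integral_rpow_le (hN : α < N) (hα : 0 < α) (V : CoercivePotential N) {p : ℝ}
    (hp : 2 < p) (hp' : p < 2 * N / (N - α)) :
    ∃ C > 0, ∀ u : EnergySpace α V, Integrable (fun x => |u.toL2 x| ^ p) ∧
      ∫ x, |u.toL2 x| ^ p ≤ C * ‖u‖ ^ p := by
  obtain ⟨M, hM, h⟩ := exists_lintegral_rpow_le hN hα V hp hp'
  have key : ∀ u : EnergySpace α V, ‖u‖ ≤ 1 → Integrable (fun x => |u.toL2 x| ^ p) ∧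
      ∫ x, |u.toL2 x| ^ p ≤ M := fun u hu => by
    have hm : AEStronglyMeasurable (fun x => |u.toL2 x| ^ p) volume :=
      ((Lp.aestronglyMeasurable u.toL2).norm.aemeasurable.pow_const p).aestronglyMeasurable
    have hnn : 0 ≤ᵐ[volume] fun x => |u.toL2 x| ^ p := Eventually.of_forall fun x => by
      simp only [Pi.zero_apply]; positivity
    refine ⟨⟨hm, ?_⟩, ?_⟩
    · rw [hasFiniteIntegral_iff_ofReal hnn]
      exact (h u hu).trans_lt ENNReal.ofReal_lt_top
    · rw [integral_eq_lintegral_of_nonneg_ae hnn hm]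
      exact ENNReal.toReal_le_of_le_ofReal hM.le (h u hu)
  refine ⟨M, hM, fun u => ?_⟩
  rcases eq_or_ne u 0 with rfl | hu
  · have h0 := key 0 (by simp)
    refine ⟨h0.1, ?_⟩
    have : (fun x => |(0 : EnergySpace α V).toL2 x| ^ p) =ᵐ[volume] fun _ => 0 := by
      filter_upwards [Lp.coeFn_zero ℝ 2 (volume : Measure (Space N))] with x hx
      rw [EnergySpace.toL2_zero, hx, Pi.zero_apply, abs_zero, Real.zero_rpow (by linarith)]
    rw [integral_congr_ae this, norm_zero, Real.zero_rpow (by linarith)]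
    simp
  · have hn : 0 < ‖u‖ := norm_pos_iff.2 hu
    set v := ‖u‖⁻¹ • u
    have huv : u = ‖u‖ • v := by simp [v, smul_smul, hn.ne']
    have hv : ‖v‖ ≤ 1 := by
      simp only [v]
      rw [norm_smul, norm_inv, norm_norm, inv_mul_cancel₀ hn.ne']
    have hae := abs_smul_toL2_rpow ‖u‖ p v
    rw [← huv, abs_of_pos hn] at hae
    refine ⟨((key v hv).1.const_mul _).congr hae.symm, ?_⟩
    rw [integral_congr_ae hae, integral_const_mul, mul_comm]
    exact mul_le_mul_of_nonneg_right (key v hv).2 (by positivity)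

/-! ### Compactness of the embedding into `L²` -/

theorem exists_subseq_weak_tendsto {H : Type*} [NormedAddCommGroup H] [InnerProductSpace ℂ H]
    [CompleteSpace H] [TopologicalSpace.SeparableSpace H] {w : ℕ → H} {M : ℝ}
    (hw : ∀ n, ‖w n‖ ≤ M) :
    ∃ (φ : ℕ → ℕ) (f : H → ℂ), StrictMono φ ∧
      ∀ h, Tendsto (fun n => inner ℂ (w (φ n)) h) atTop (𝓝 (f h)) := by
  have hmem : ∀ n, (WeakDual.toStrongDual.symm (InnerProductSpace.toDual ℂ H (w n))) ∈
      (WeakDual.toStrongDual ⁻¹' Metric.closedBall (0 : StrongDual ℂ H) M) := fun n => by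
    simpa using hw n
  obtain ⟨f, -, φ, hφ, hf⟩ := WeakDual.isSeqCompact_closedBall ℂ H 0 M hmem
  refine ⟨φ, f, hφ, fun h => ?_⟩
  exact ((WeakDual.eval_continuous h).tendsto f).comp hf

theorem toL2_sub (u v : EnergySpace α V) : (u - v).toL2 = u.toL2 - v.toL2 := rfl

/-- Functions of bounded energy are, up to a small error in `L²`, controlled by their low
frequencies on a large ball: the potential is large outside of the ball and the high frequencies
are controlled by the kinetic energy. -/
theorem norm_toL2_sq_le_lowFreq (hα : 0 < α) (V : CoercivePotential N) (M : ℝ) {ε : ℝ}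
    (hε : 0 < ε) : ∃ K > 0, ∃ R > 0, ∀ u : EnergySpace α V, ‖u‖ ≤ M → ‖u.toL2‖ ^ 2 ≤
      ε + 2 * ∫ x in Metric.ball (0 : Space N) R,
        ‖𝓕⁻ (lowFreq K (fourierL2 u.toL2) : Space N → ℂ) x‖ ^ 2 := by
  set A := M ^ 2 + 1 with hA
  have hA0 : 0 < A := by positivity
  obtain ⟨K, hK0, hK⟩ : ∃ K > 0, K ^ (-α) * A ≤ ε / 4 := by
    have h := (tendsto_rpow_neg_atTop hα).mul_const A
    rw [zero_mul] at h
    obtain ⟨K, h1, h2⟩ := ((h.eventually (gt_mem_nhds (by positivity : 0 < ε / 4))).and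
      (eventually_gt_atTop 0)).exists
    exact ⟨K, h2, h1.le⟩
  obtain ⟨R, hR0, hR⟩ : ∃ R > 0, ∀ x : Space N, R ≤ ‖x‖ → 2 * A / ε ≤ V x := by
    have h := V.tendsto_atTop.eventually_ge_atTop (2 * A / ε)
    obtain ⟨r, -, hr⟩ := (Metric.hasBasis_cobounded_compl_closedBall (0 : Space N)).eventually_iff.1 h
    refine ⟨max r 0 + 1, by positivity, fun x hx => hr ?_⟩
    simp only [Set.mem_compl_iff, Metric.mem_closedBall, dist_zero_right, not_le]
    linarith [le_max_left r 0]
  refine ⟨K, hK0, R, hR0, fun u hu => ?_⟩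
  have hu2 : ‖u‖ ^ 2 ≤ A := by
    have : ‖u‖ ^ 2 ≤ M ^ 2 := pow_le_pow_left₀ (norm_nonneg _) hu 2
    linarith
  have hu_int : Integrable (fun x => ‖u.toL2 x‖ ^ 2) := integrable_norm_sq _
  set w := fourierL2 u.toL2 with hw
  set g : Space N → ℂ := 𝓕⁻ (lowFreq K w : Space N → ℂ) with hg
  set h : ComplexL2 N := 𝓕⁻ (w - lowFreq K w) with hh
  have hgcont : Continuous g := VectorFourier.fourierIntegral_continuous Real.continuous_fourierChar
      (by exact continuous_inner.neg) (integrable_lowFreq K w)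
  have hg_int : IntegrableOn (fun x => ‖g x‖ ^ 2) (Metric.ball 0 R) :=
    ((hgcont.norm.pow 2).locallyIntegrable.integrableOn_isCompact
      (isCompact_closedBall 0 R)).mono_set Metric.ball_subset_closedBall
  have hh_int : Integrable (fun x => ‖h x‖ ^ 2) := integrable_norm_sq h
  have hh2 : ‖h‖ ^ 2 ≤ ε / 4 := by
    rw [hh, norm_fourierInv_L2]
    refine (norm_sub_lowFreq_sq_le hα u hK0).trans (le_trans ?_ hK)
    gcongr
  have hin : ∫ x in Metric.ball (0 : Space N) R, ‖u.toL2 x‖ ^ 2 ≤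
      2 * (∫ x in Metric.ball (0 : Space N) R, ‖g x‖ ^ 2) + ε / 2 := by
    have h1 : ∫ x in Metric.ball (0 : Space N) R, ‖u.toL2 x‖ ^ 2 ≤
        ∫ x in Metric.ball (0 : Space N) R, (2 * ‖g x‖ ^ 2 + 2 * ‖h x‖ ^ 2) := by
      refine integral_mono_ae hu_int.integrableOn
        ((hg_int.const_mul 2).add (hh_int.integrableOn.const_mul 2)) (ae_restrict_of_ae ?_)
      filter_upwards [toComplexL2_ae_eq_add K u.toL2] with x hx
      have h2 : ‖u.toL2 x‖ ≤ ‖g x‖ + ‖h x‖ := by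
        rw [← Complex.norm_real, hx]; exact norm_add_le _ _
      nlinarith [norm_nonneg (u.toL2 x), sq_nonneg (‖g x‖ - ‖h x‖)]
    rw [integral_add (hg_int.const_mul 2) (hh_int.integrableOn.const_mul 2), integral_const_mul,
      integral_const_mul] at h1
    have h3 : ∫ x in Metric.ball (0 : Space N) R, ‖h x‖ ^ 2 ≤ ‖h‖ ^ 2 := by
      rw [norm_sq_eq_integral]
      exact setIntegral_le_integral hh_int (Eventually.of_forall fun x => by positivity)
    linarith
  have hout : ∫ x in (Metric.ball (0 : Space N) R)ᶜ, ‖u.toL2 x‖ ^ 2 ≤ ε / 2 := by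
    have h1 : ∫ x in (Metric.ball (0 : Space N) R)ᶜ, ‖u.toL2 x‖ ^ 2 ≤
        ∫ x in (Metric.ball (0 : Space N) R)ᶜ, ε / (2 * A) * (V x * |u.toL2 x| ^ 2) := by
      refine setIntegral_mono_on hu_int.integrableOn
        (u.integrable_potential.const_mul _).integrableOn
        Metric.isOpen_ball.measurableSet.compl fun x hx => ?_
      have h2 : R ≤ ‖x‖ := by simpa using hx
      have h3 : 1 ≤ ε / (2 * A) * V x := by
        have := mul_le_mul_of_nonneg_left (hR x h2) (by positivity : 0 ≤ ε / (2 * A))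
        refine le_trans (le_of_eq ?_) this
        field_simp
      rw [Real.norm_eq_abs, ← mul_assoc]
      nlinarith [sq_nonneg |u.toL2 x|]
    refine h1.trans ((setIntegral_le_integral (u.integrable_potential.const_mul _)
      (Eventually.of_forall fun x => ?_)).trans ?_)
    · have := (V.pos x).le
      simp only [Pi.zero_apply]; positivity
    · rw [integral_const_mul]
      have h4 := (potential_le_norm_sq u).trans hu2
      have h5 := mul_le_mul_of_nonneg_left h4 (by positivity : 0 ≤ ε / (2 * A))
      refine h5.trans (le_of_eq ?_)
      field_simp
  rw [norm_sq_eq_integral, ← integral_add_compl Metric.isOpen_ball.measurableSet hu_int]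
  linarith

/-- The low-frequency part at a point is a continuous linear functional on `L²`. -/
theorem exists_fourierInv_lowFreq_eq_inner (K : ℝ) (x : Space N) :
    ∃ e : ComplexL2 N, ∀ w : ComplexL2 N,
      𝓕⁻ (lowFreq K w : Space N → ℂ) x = inner ℂ e w := by
  set e₀ : Space N → ℂ := (Metric.ball (0 : Space N) K).indicator
    fun η => (starRingEnd ℂ) (Real.fourierChar (inner ℝ η x) : ℂ) with he₀
  have hcont : Continuous fun η : Space N =>
      (starRingEnd ℂ) (Real.fourierChar (inner ℝ η x) : ℂ) := by
    refine Complex.continuous_conj.comp (continuous_subtype_val.comp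
      (Real.continuous_fourierChar.comp ?_))
    fun_prop
  have hfin : IsFiniteMeasure ((volume : Measure (Space N)).restrict (Metric.ball 0 K)) :=
    ⟨by simpa using measure_ball_lt_top⟩
  have he : MemLp e₀ 2 volume := by
    rw [he₀, memLp_indicator_iff_restrict Metric.isOpen_ball.measurableSet]
    exact MemLp.of_bound hcont.aestronglyMeasurable 1 (Eventually.of_forall fun η => by
      rw [RCLike.norm_conj, Circle.norm_coe])
  refine ⟨he.toLp e₀, fun w => ?_⟩
  rw [L2.inner_def, Real.fourierInv_eq]
  refine integral_congr_ae ?_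
  filter_upwards [he.coeFn_toLp, lowFreq_coeFn K w] with η h1 h2
  rw [h1, h2, he₀]
  by_cases hη : η ∈ Metric.ball (0 : Space N) K
  · rw [Set.indicator_of_mem hη, Set.indicator_of_mem hη, Circle.smul_def, smul_eq_mul]
    simp [mul_comm]
  · rw [Set.indicator_of_notMem hη, Set.indicator_of_notMem hη]
    simp

theorem exists_norm_fourierInv_lowFreq_le (K : ℝ) :
    ∃ C, ∀ (w : ComplexL2 N) (x : Space N),
      ‖𝓕⁻ (lowFreq K w : Space N → ℂ) x‖ ≤ C + ‖w‖ ^ 2 := by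
  refine ⟨∫ _ in Metric.ball (0 : Space N) K, (1 : ℝ),
    fun w x => (norm_fourierInv_lowFreq_le K w x).trans ?_⟩
  have hfin : IsFiniteMeasure ((volume : Measure (Space N)).restrict (Metric.ball 0 K)) :=
    ⟨by simpa using measure_ball_lt_top⟩
  have h2 : ∫ η in Metric.ball (0 : Space N) K, ‖w η‖ ^ 2 ≤ ‖w‖ ^ 2 := by
    rw [norm_sq_eq_integral]
    exact setIntegral_le_integral (integrable_norm_sq w) (Eventually.of_forall fun x => by positivity)
  refine le_trans ?_ (add_le_add_right h2 _)
  rw [← integral_add (integrable_const _) (integrable_norm_sq w).integrableOn]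
  refine integral_mono ?_ ((integrable_const _).add (integrable_norm_sq w).integrableOn)
    fun η => ?_
  · exact (((Lp.memLp w).locallyIntegrable (by norm_num)).integrableOn_isCompact
        (isCompact_closedBall 0 K) |>.mono_set Metric.ball_subset_closedBall).norm
  · simp only
    nlinarith [sq_nonneg (‖w η‖ - 1), norm_nonneg (w η)]

/-- Bounded sequences of the energy space have subsequences that converge in `L²`. -/
theorem exists_subseq_tendsto_toL2 (hα : 0 < α) {u : ℕ → EnergySpace α V} {M : ℝ}
    (hu : ∀ n, ‖u n‖ ≤ M) :
    ∃ φ : ℕ → ℕ, StrictMono φ ∧ ∃ v : RealL2 N,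
      Tendsto (fun n => (u (φ n)).toL2) atTop (𝓝 v) := by
  obtain ⟨C₁, hC₁, h₁⟩ := exists_norm_toL2_sq_le V
  have hM : 0 ≤ M := (norm_nonneg _).trans (hu 0)
  have hw2 : ∀ v : EnergySpace α V, ∀ M' : ℝ, ‖v‖ ≤ M' →
      ‖fourierL2 v.toL2‖ ^ 2 ≤ C₁ * M' ^ 2 := fun v M' hv => by
    rw [norm_fourierL2]
    refine (h₁ α v).trans ?_
    gcongr
  have hw : ∀ n, ‖fourierL2 (u n).toL2‖ ≤ √(C₁ * M ^ 2) := fun n =>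
    Real.le_sqrt_of_sq_le (hw2 _ _ (hu n))
  have : Fact ((2 : ℝ≥0∞) ≠ ⊤) := ⟨by norm_num⟩
  have : SecondCountableTopology (ComplexL2 N) := inferInstance
  obtain ⟨φ, f, hφ, hf⟩ := exists_subseq_weak_tendsto hw
  refine ⟨φ, hφ, cauchySeq_tendsto_of_complete ?_⟩
  rw [cauchySeq_iff_tendsto_dist_atTop_0]
  set d : ℕ × ℕ → EnergySpace α V := fun n => u (φ n.1) - u (φ n.2) with hd
  have hdM : ∀ n, ‖d n‖ ≤ 2 * M := fun n => by
    refine (norm_sub_le _ _).trans ?_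
    linarith [hu (φ n.1), hu (φ n.2)]
  suffices h : Tendsto (fun n => ‖(d n).toL2‖ ^ 2) atTop (𝓝 0) by
    have h2 := (Real.continuous_sqrt.tendsto 0).comp h
    rw [Real.sqrt_zero] at h2
    refine h2.congr fun n => ?_
    simp only [Function.comp, Real.sqrt_sq (norm_nonneg _)]
    rw [dist_eq_norm]
    rfl
  rw [Metric.tendsto_nhds]
  intro ε hε
  obtain ⟨K, hK, R, hR, hKR⟩ := norm_toL2_sq_le_lowFreq hα V (2 * M) (half_pos hε)
  have hlim : Tendsto (fun n => ∫ x in Metric.ball (0 : Space N) R,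
      ‖𝓕⁻ (lowFreq K (fourierL2 (d n).toL2) : Space N → ℂ) x‖ ^ 2) atTop
      (𝓝 (∫ _ in Metric.ball (0 : Space N) R, (0 : ℝ))) := by
    obtain ⟨C, hC⟩ := exists_norm_fourierInv_lowFreq_le (N := N) K
    have hfin : IsFiniteMeasure ((volume : Measure (Space N)).restrict (Metric.ball 0 R)) :=
      ⟨by simpa using measure_ball_lt_top⟩
    refine tendsto_integral_filter_of_dominated_convergence
      (fun _ => (C + C₁ * (2 * M) ^ 2) ^ 2) (Eventually.of_forall fun n => ?_)
      (Eventually.of_forall fun n => Eventually.of_forall fun x => ?_) (integrable_const _)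
      (Eventually.of_forall fun x => ?_)
    · have hgcont : Continuous (𝓕⁻ (lowFreq K (fourierL2 (d n).toL2) : Space N → ℂ)) :=
        VectorFourier.fourierIntegral_continuous Real.continuous_fourierChar
          (by exact continuous_inner.neg) (integrable_lowFreq K _)
      exact (hgcont.norm.pow 2).aestronglyMeasurable
    · rw [Real.norm_of_nonneg (by positivity)]
      refine pow_le_pow_left₀ (norm_nonneg _) ((hC _ x).trans ?_) 2
      gcongr
      exact hw2 _ _ (hdM n)
    · obtain ⟨e, he⟩ := exists_fourierInv_lowFreq_eq_inner K x
      have h1 : Tendsto (fun n => inner ℂ e (fourierL2 (u (φ n)).toL2)) atTop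
          (𝓝 ((starRingEnd ℂ) (f e))) := by
        refine ((Complex.continuous_conj.tendsto _).comp (hf e)).congr fun n => ?_
        exact inner_conj_symm _ _
      have h2 : Tendsto (fun n : ℕ × ℕ => inner ℂ e (fourierL2 (d n).toL2)) atTop (𝓝 0) := by
        have h3 := (h1.comp tendsto_fst).sub (h1.comp (tendsto_snd (f := (atTop : Filter ℕ))))
        rw [sub_self, prod_atTop_atTop_eq] at h3
        refine h3.congr fun n => ?_
        rw [hd, toL2_sub, fourierL2_sub, inner_sub_right]
        rfl
      simp_rw [he]
      simpa using h2.norm.pow 2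
  rw [integral_zero] at hlim
  filter_upwards [hlim.eventually (gt_mem_nhds (by positivity : 0 < ε / 4))] with n hn
  rw [Real.dist_eq, sub_zero, abs_of_nonneg (by positivity)]
  linarith [hKR (d n) (hdM n)]

/-! ### Lower semicontinuity of the energy norm -/

theorem integrable_and_integral_le_of_tendsto_ae {X : Type*} [MeasurableSpace X] {μ : Measure X}
    {f : ℕ → X → ℝ} {g : X → ℝ} {c : ℕ → ℝ} {c' : ℝ} (hf : ∀ n, Integrable (f n) μ)
    (hf0 : ∀ n x, 0 ≤ f n x) (hfg : ∀ᵐ x ∂μ, Tendsto (fun n => f n x) atTop (𝓝 (g x)))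
    (hc : ∀ n, ∫ x, f n x ∂μ ≤ c n) (hcc : Tendsto c atTop (𝓝 c')) :
    Integrable g μ ∧ ∫ x, g x ∂μ ≤ c' := by
  have hgm : AEStronglyMeasurable g μ :=
    aestronglyMeasurable_of_tendsto_ae atTop (fun n => (hf n).1) hfg
  have hg0 : 0 ≤ᵐ[μ] g := by
    filter_upwards [hfg] with x hx
    exact ge_of_tendsto' hx fun n => hf0 n x
  have hc0 : 0 ≤ c' := ge_of_tendsto' hcc fun n => (integral_nonneg (hf0 n)).trans (hc n)
  have key : ∫⁻ x, ENNReal.ofReal (g x) ∂μ ≤ ENNReal.ofReal c' := by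
    have h1 : ∫⁻ x, ENNReal.ofReal (g x) ∂μ
        = ∫⁻ x, liminf (fun n => ENNReal.ofReal (f n x)) atTop ∂μ := by
      refine lintegral_congr_ae ?_
      filter_upwards [hfg] with x hx
      exact ((ENNReal.continuous_ofReal.tendsto _).comp hx).liminf_eq.symm
    rw [h1]
    refine (lintegral_liminf_le' fun n => (hf n).1.aemeasurable.ennreal_ofReal).trans ?_
    rw [← ((ENNReal.continuous_ofReal.tendsto _).comp hcc).liminf_eq]
    refine liminf_le_liminf (Eventually.of_forall fun n => ?_)
    simp only [Function.comp]
    rw [← ofReal_integral_eq_lintegral_ofReal (hf n) (Eventually.of_forall (hf0 n))]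
    exact ENNReal.ofReal_le_ofReal (hc n)
  refine ⟨⟨hgm, ?_⟩, ?_⟩
  · rw [hasFiniteIntegral_iff_ofReal hg0]
    exact key.trans_lt ENNReal.ofReal_lt_top
  · rw [integral_eq_lintegral_of_nonneg_ae hg0 hgm]
    exact ENNReal.toReal_le_of_le_ofReal hc0 key

theorem norm_sq_eq_fourierL2 (u : EnergySpace α V) :
    ‖u‖ ^ 2 = (∫ η : Space N, (2 * Real.pi * ‖η‖) ^ α * ‖fourierL2 u.toL2 η‖ ^ 2) +
      ∫ x : Space N, V x * |u.toL2 x| ^ 2 := by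
  rw [u.norm_sq_eq, integral_kinetic_eq]

/-- The balls of the energy space are closed in `L²`. -/
theorem exists_toL2_eq_of_tendsto {u : ℕ → EnergySpace α V} {M : ℝ} (hu : ∀ n, ‖u n‖ ≤ M)
    {v : RealL2 N} (hv : Tendsto (fun n => (u n).toL2) atTop (𝓝 v)) :
    ∃ v' : EnergySpace α V, v'.toL2 = v ∧ ‖v'‖ ≤ M := by
  have hM : 0 ≤ M := (norm_nonneg _).trans (hu 0)
  -- a subsequence converging almost everywhere, in the space and in the frequency variables, and
  -- along which the kinetic energies converge
  obtain ⟨φ₁, hφ₁, h₁⟩ := (tendstoInMeasure_of_tendsto_Lp hv).exists_seq_tendsto_ae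
  have hw : Tendsto (fun n => fourierL2 (u n).toL2) atTop (𝓝 (fourierL2 v)) := by
    rw [tendsto_iff_norm_sub_tendsto_zero] at hv ⊢
    simp_rw [← fourierL2_sub, norm_fourierL2]
    exact hv
  obtain ⟨φ₂, hφ₂, h₂⟩ :=
    (tendstoInMeasure_of_tendsto_Lp (hw.comp hφ₁.tendsto_atTop)).exists_seq_tendsto_ae
  set k : ℕ → ℝ := fun n => ∫ η : Space N,
    (2 * Real.pi * ‖η‖) ^ α * ‖fourierL2 (u (φ₁ (φ₂ n))).toL2 η‖ ^ 2 with hk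
  have hk_mem : ∀ n, k n ∈ Set.Icc 0 (M ^ 2) := fun n =>
    ⟨integral_nonneg fun x => by simp only [Pi.zero_apply]; positivity,
      (kinetic_le_norm_sq _).trans (pow_le_pow_left₀ (norm_nonneg _) (hu _) 2)⟩
  obtain ⟨k', -, φ₃, hφ₃, hk'⟩ := isCompact_Icc.tendsto_subseq hk_mem
  set φ := φ₁ ∘ φ₂ ∘ φ₃ with hφ
  obtain ⟨hA, hA'⟩ := integrable_and_integral_le_of_tendsto_ae (μ := volume)
    (f := fun n η => (2 * Real.pi * ‖η‖) ^ α * ‖fourierL2 (u (φ n)).toL2 η‖ ^ 2)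
    (g := fun η : Space N => (2 * Real.pi * ‖η‖) ^ α * ‖fourierL2 v η‖ ^ 2)
    (c := k ∘ φ₃) (c' := k')
    (fun n => integrable_fourierL2_weight _) (fun n x => by positivity) (by
      filter_upwards [h₂] with η hη
      exact ((hη.comp hφ₃.tendsto_atTop).norm.pow 2).const_mul _) (fun n => le_rfl) hk'
  obtain ⟨hB, hB'⟩ := integrable_and_integral_le_of_tendsto_ae (μ := volume)
    (f := fun n x => V x * |(u (φ n)).toL2 x| ^ 2)
    (g := fun x : Space N => V x * |v x| ^ 2)
    (c := fun n => M ^ 2 - k (φ₃ n)) (c' := M ^ 2 - k')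
    (fun n => (u (φ n)).integrable_potential)
    (fun n x => mul_nonneg (V.pos x).le (by positivity)) (by
      filter_upwards [h₁] with x hx
      exact ((hx.comp (hφ₂.comp hφ₃).tendsto_atTop).abs.pow 2).const_mul _)
    (fun n => by
      have h3 := norm_sq_eq_fourierL2 (u (φ n))
      have h4 : ‖u (φ n)‖ ^ 2 ≤ M ^ 2 := pow_le_pow_left₀ (norm_nonneg _) (hu _) 2
      have h5 : k (φ₃ n) = ∫ η : Space N,
        (2 * Real.pi * ‖η‖) ^ α * ‖fourierL2 (u (φ n)).toL2 η‖ ^ 2 := rfl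
      linarith) (tendsto_const_nhds.sub hk')
  let v' : EnergySpace α V := (⟨v, (integrable_kinetic_iff α v).2 hA, hB⟩ : energySubmodule α V)
  refine ⟨v', rfl, ?_⟩
  refine (pow_le_pow_iff_left₀ (norm_nonneg _) hM two_ne_zero).1 ?_
  rw [norm_sq_eq_fourierL2]
  have : v'.toL2 = v := rfl
  rw [this]
  linarith

/-! ### Convergence in `L^p` -/

/-- Powers between `2` and `r` are controlled by a small multiple of the `r`-th power and a large
multiple of the square. -/
theorem exists_rpow_le_add {p r : ℝ} (hp : 2 < p) (hr : p < r) {ε : ℝ} (hε : 0 < ε) :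
    ∃ C > 0, ∀ s : ℝ, 0 ≤ s → s ^ p ≤ ε * s ^ r + C * s ^ 2 := by
  refine ⟨((1 / ε) ^ (1 / (r - p))) ^ (p - 2), by positivity, fun s hs => ?_⟩
  rcases hs.eq_or_lt with rfl | hs
  · rw [Real.zero_rpow (by linarith), Real.zero_rpow (by linarith)]; simp
  have hrp : 0 < r - p := sub_pos.2 hr
  rcases le_total s ((1 / ε) ^ (1 / (r - p))) with h | h
  · have h1 : s ^ p = s ^ (p - 2) * s ^ 2 := by
      rw [← Real.rpow_natCast s 2, ← Real.rpow_add hs]; congr 1; push_cast; ring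
    have h2 : s ^ (p - 2) ≤ ((1 / ε) ^ (1 / (r - p))) ^ (p - 2) :=
      Real.rpow_le_rpow hs.le h (by linarith)
    have h3 : 0 ≤ ε * s ^ r := by positivity
    rw [h1]
    nlinarith [sq_nonneg s]
  · have h1 : s ^ r = s ^ (r - p) * s ^ p := by
      rw [← Real.rpow_add hs]; congr 1; ring
    have h2 : 1 / ε ≤ s ^ (r - p) := by
      have := Real.rpow_le_rpow (by positivity) h hrp.le
      rwa [← Real.rpow_mul (by positivity), one_div_mul_cancel hrp.ne', Real.rpow_one] at this
    have h3 : 1 ≤ ε * s ^ (r - p) := by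
      rw [div_le_iff₀ hε] at h2; linarith
    have h4 : 0 < s ^ p := by positivity
    rw [h1, ← mul_assoc]
    have : 0 ≤ ((1 / ε) ^ (1 / (r - p))) ^ (p - 2) * s ^ 2 := by positivity
    nlinarith

theorem tendsto_integral_abs_sub_rpow (hN : α < N) (hα : 0 < α) {p : ℝ} (hp : 2 < p)
    (hp' : p < 2 * N / (N - α)) {u : ℕ → EnergySpace α V} {v : EnergySpace α V} {M : ℝ}
    (hu : ∀ n, ‖u n‖ ≤ M) (hv : Tendsto (fun n => (u n).toL2) atTop (𝓝 v.toL2)) :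
    Tendsto (fun n => ∫ x, |(u n - v).toL2 x| ^ p) atTop (𝓝 0) := by
  obtain ⟨r, hr, hr'⟩ := exists_between hp'
  obtain ⟨C, hC, hS⟩ := exists_integral_rpow_le hN hα V (hp.trans hr) hr'
  obtain ⟨C', hC', hS'⟩ := exists_integral_rpow_le hN hα V hp hp'
  have hM : 0 ≤ M := (norm_nonneg _).trans (hu 0)
  set B := C * (M + ‖v‖) ^ r + 1 with hB
  have hB0 : 0 < B := by positivity
  rw [Metric.tendsto_nhds]
  intro ε hε
  obtain ⟨D, hD, hD'⟩ := exists_rpow_le_add hp hr (by positivity : 0 < ε / (2 * B))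
  have h2 : Tendsto (fun n => D * ‖(u n).toL2 - v.toL2‖ ^ 2) atTop (𝓝 0) := by
    rw [tendsto_iff_norm_sub_tendsto_zero] at hv
    simpa using (hv.pow 2).const_mul D
  filter_upwards [h2.eventually (gt_mem_nhds (half_pos hε))] with n hn
  rw [Real.dist_eq, sub_zero, abs_of_nonneg (integral_nonneg fun x => by
    simp only [Pi.zero_apply]; positivity)]
  have h3 : ∫ x, |(u n - v).toL2 x| ^ r ≤ B := by
    refine (hS (u n - v)).2.trans ?_
    have h4 : ‖u n - v‖ ≤ M + ‖v‖ := (norm_sub_le _ _).trans (add_le_add_left (hu n) _)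
    have h5 : ‖u n - v‖ ^ r ≤ (M + ‖v‖) ^ r :=
      Real.rpow_le_rpow (norm_nonneg _) h4 (by linarith)
    nlinarith
  have hi2 := integrable_norm_sq (u n - v).toL2
  calc ∫ x, |(u n - v).toL2 x| ^ p
      ≤ ∫ x, (ε / (2 * B) * |(u n - v).toL2 x| ^ r + D * ‖(u n - v).toL2 x‖ ^ 2) :=
        integral_mono (hS' _).1 (((hS _).1.const_mul _).add (hi2.const_mul _))
          fun x => hD' _ (abs_nonneg _)
    _ = ε / (2 * B) * (∫ x, |(u n - v).toL2 x| ^ r) + D * ‖(u n).toL2 - v.toL2‖ ^ 2 := by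
        rw [integral_add ((hS _).1.const_mul _) (hi2.const_mul _), integral_const_mul,
          integral_const_mul, ← norm_sq_eq_integral, toL2_sub]
    _ < ε / 2 + ε / 2 := by
        refine add_lt_add_of_le_of_lt ?_ hn
        calc _ ≤ ε / (2 * B) * B := by gcongr
          _ = ε / 2 := by field_simp
    _ = ε := by ring

/-! ### The nonlinearity -/

/-- A function on `ℝ^N × ℝ` that is Lebesgue measurable, and continuous in `s` for almost every `x`,
is Borel measurable, and continuous in `s` for every `x`, after a modification for `x` in a null
set. -/
theorem exists_measurable_modification {f : Space N → ℝ → ℝ}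
    (hm : AEMeasurable (Function.uncurry f) (volume : Measure (Space N × ℝ)))
    (hc : ∀ᵐ x : Space N, Continuous (f x)) :
    ∃ f' : Space N → ℝ → ℝ, Measurable (Function.uncurry f') ∧ (∀ x, Continuous (f' x)) ∧
      ∀ᵐ x : Space N, ∀ s, f' x s = f x s := by
  obtain ⟨g, hg, hfg⟩ := hm
  have h1 : ∀ᵐ s : ℝ, ∀ᵐ x : Space N, f x s = g (x, s) :=
    Measure.ae_ae_of_ae_prod ((Measure.measurePreserving_swap (μ := (volume : Measure ℝ))
      (ν := (volume : Measure (Space N)))).quasiMeasurePreserving.ae hfg)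
  obtain ⟨D, hDs, hDc, hDd⟩ := (Measure.dense_of_ae h1).exists_countable_dense_subset
  have h2 : ∀ᵐ x : Space N, ∀ s ∈ D, f x s = g (x, s) :=
    (ae_ball_iff hDc).2 fun s hs => hDs hs
  obtain ⟨Z, hZ, hZm, hZ0⟩ := exists_measurable_superset_of_null (ae_iff.1 (h2.and hc))
  have hZ' : ∀ x, x ∉ Z → (∀ s ∈ D, f x s = g (x, s)) ∧ Continuous (f x) := fun x hx => by
    by_contra h
    exact hx (hZ h)
  classical
  set f' : Space N → ℝ → ℝ := fun x s => Zᶜ.indicator (fun x => f x s) x with hf'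
  have hcont : ∀ x, Continuous (f' x) := fun x => by
    by_cases hx : x ∈ Z
    · have : f' x = fun _ => 0 := by ext s; simp [hf', hx]
      rw [this]; exact continuous_const
    · have : f' x = f x := by ext s; simp [hf', hx]
      rw [this]; exact (hZ' x hx).2
  have hD : ∀ s ∈ D, Measurable fun x => f' x s := fun s hs => by
    have : (fun x => f' x s) = Zᶜ.indicator fun x => g (x, s) := by
      ext x
      by_cases hx : x ∈ Z
      · simp [hf', hx]
      · simp [hf', hx, (hZ' x hx).1 s hs]
    rw [this]
    exact (hg.comp (measurable_id.prodMk measurable_const)).indicator hZm.compl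
  have hall : ∀ s, Measurable fun x => f' x s := fun s => by
    obtain ⟨d, hd, hds⟩ := mem_closure_iff_seq_limit.1 (hDd s)
    exact measurable_of_tendsto_metrizable (fun n => hD _ (hd n))
      (tendsto_pi_nhds.2 fun x => ((hcont x).tendsto s).comp hds)
  refine ⟨f', ?_, hcont, ?_⟩
  · exact (measurable_uncurry_of_continuous_of_measurable (u := fun s x => f' x s) hcont
      hall).comp measurable_swap
  · filter_upwards [compl_mem_ae_iff.2 hZ0] with x hx s
    exact Set.indicator_of_mem hx _

/-- The properties of the full nonlinearity `g(x, s) = f(x, s) - Γ(x)|s|^(q-2) s` on which the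
variational argument rests, after a modification of `g` for `x` in a null set. -/
structure IsAdmissible (p q : ℝ) (g : Space N → ℝ → ℝ) : Prop where
  measurable : Measurable (Function.uncurry g)
  continuous : ∀ x, Continuous (g x)
  growth : ∃ C > 0, ∀ᵐ x : Space N, ∀ s, |g x s| ≤ C * (|s| + |s| ^ (p - 1))
  mul_self_le : ∀ ε > 0, ∃ C > 0, ∀ᵐ x : Space N, ∀ s, g x s * s ≤ ε * |s| ^ 2 + C * |s| ^ p
  le_primitive : ∃ C > 0, ∀ᵐ x : Space N, ∀ s, |s| ^ q - C * |s| ^ 2 ≤ primitive g x s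
  mono : ∀ᵐ x : Space N, ∀ s t t' : ℝ, 0 < t → t ≤ t' →
    g x (t * s) * s / t ^ (q - 1) ≤ g x (t' * s) * s / t' ^ (q - 1)

theorem abs_rpow_sub_one_mul_abs {p : ℝ} (hp : 1 < p) (s : ℝ) :
    |s| ^ (p - 1) * |s| = |s| ^ p := by
  rcases eq_or_ne s 0 with rfl | hs
  · rw [abs_zero, mul_zero, Real.zero_rpow (by linarith)]
  · rw [← Real.rpow_add_one (abs_ne_zero.2 hs)]; congr 1; ring

theorem abs_primitive_le {g : Space N → ℝ → ℝ} {C p : ℝ} (hp : 2 < p) (hC : 0 < C) {x : Space N}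
    (h : ∀ s, |g x s| ≤ C * (|s| + |s| ^ (p - 1))) (s : ℝ) :
    |primitive g x s| ≤ C * (|s| ^ 2 + |s| ^ p) := by
  have h1 : ∀ τ ∈ Set.uIoc 0 s, ‖g x τ‖ ≤ C * (|s| + |s| ^ (p - 1)) := fun τ hτ => by
    have h2 : |τ| ≤ |s| := by
      rcases Set.mem_uIoc.1 hτ with ⟨h3, h4⟩ | ⟨h3, h4⟩
      · rw [abs_of_pos h3, abs_of_pos (h3.trans_le h4)]; exact h4
      · rw [abs_of_nonpos h4, abs_of_neg (h3.trans_le h4)]; linarith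
    refine (h τ).trans ?_
    have := Real.rpow_le_rpow (abs_nonneg τ) h2 (by linarith : 0 ≤ p - 1)
    gcongr
  have h3 := intervalIntegral.norm_integral_le_of_norm_le_const h1
  rw [sub_zero] at h3
  refine h3.trans (le_of_eq ?_)
  have h4 : |s| ^ (p - 1) * |s| = |s| ^ p := abs_rpow_sub_one_mul_abs (by linarith) s
  rw [mul_assoc, add_mul, h4]
  ring

theorem hasDerivAt_primitive {g : Space N → ℝ → ℝ} {x : Space N} (h : Continuous (g x)) (s : ℝ) :
    HasDerivAt (primitive g x) (g x s) s :=
  intervalIntegral.integral_hasDerivAt_right (h.intervalIntegrable _ _)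
    (h.stronglyMeasurableAtFilter _ _) h.continuousAt

theorem measurable_primitive {g : Space N → ℝ → ℝ} (hm : Measurable (Function.uncurry g))
    (hc : ∀ x, Continuous (g x)) : Measurable (Function.uncurry (primitive g)) := by
  refine (measurable_uncurry_of_continuous_of_measurable (u := fun s x => primitive g x s)
    (fun x => ?_) fun s => ?_).comp measurable_swap
  · exact continuous_iff_continuousAt.2 fun s => (hasDerivAt_primitive (hc x) s).continuousAt
  · simp only [primitive, intervalIntegral]
    exact (hm.stronglyMeasurable.integral_prod_right.sub
      hm.stronglyMeasurable.integral_prod_right).measurable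

theorem integral_abs_rpow_mul_self {q : ℝ} (hq : 2 < q) (s : ℝ) :
    ∫ τ in (0 : ℝ)..s, |τ| ^ (q - 2) * τ = 1 / q * |s| ^ q := by
  have hcont : Continuous fun τ : ℝ => |τ| ^ (q - 2) * τ :=
    (continuous_abs.rpow_const fun _ => Or.inr (by linarith)).mul continuous_id
  rw [intervalIntegral.integral_eq_sub_of_hasDerivAt (f := fun τ => 1 / q * |τ| ^ q)
    (fun τ _ => ?_) (hcont.intervalIntegrable _ _)]
  · simp only [abs_zero]
    rw [Real.zero_rpow (by linarith)]; ring
  · have h := (hasDerivAt_abs_rpow τ (by linarith : 1 < q)).const_mul (1 / q)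
    refine h.congr_deriv ?_
    field_simp

theorem abs_rpow_le_add {p r : ℝ} (hr : 1 ≤ r) (hrp : r ≤ p) (s : ℝ) :
    |s| ^ r ≤ |s| + |s| ^ p := by
  rcases le_total |s| 1 with h | h
  · have := Real.rpow_le_rpow_of_exponent_ge' (abs_nonneg s) h zero_le_one hr
    rw [Real.rpow_one] at this
    have h2 : 0 ≤ |s| ^ p := by positivity
    linarith
  · have := Real.rpow_le_rpow_of_exponent_le h hrp
    linarith [abs_nonneg s]

theorem abs_rpow_sub_mul {q t s : ℝ} (ht : 0 < t) :
    |t * s| ^ (q - 2) * (t * s) * s / t ^ (q - 1) = |s| ^ (q - 2) * s ^ 2 := by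
  rw [abs_mul, abs_of_pos ht, Real.mul_rpow ht.le (abs_nonneg _)]
  have h1 : t ^ (q - 1) = t ^ (q - 2) * t := by
    rw [← Real.rpow_add_one ht.ne']; congr 1; ring
  rw [h1]
  field_simp

/-- The pointwise bound `|f(x, s)| ≤ ε|s| + C|s|^(p-1)`, which follows from the behaviour of `f` at
zero and from its growth. -/
theorem exists_abs_le_of_small {f : Space N → ℝ → ℝ} {c p : ℝ} (hp : 2 < p) (hc : 0 < c)
    (hcont : ∀ᵐ x : Space N, Continuous (f x))
    (hgrowth : ∀ᵐ x : Space N, ∀ u, |f x u| ≤ c * (1 + |u| ^ (p - 1)))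
    (hsmall : ∀ ε > 0, ∃ δ > 0, ∀ᵐ x : Space N, ∀ u, 0 < |u| → |u| < δ → |f x u| ≤ ε * |u|)
    {ε : ℝ} (hε : 0 < ε) :
    ∃ C > 0, ∀ᵐ x : Space N, ∀ s, |f x s| ≤ ε * |s| + C * |s| ^ (p - 1) := by
  obtain ⟨δ, hδ, hs⟩ := hsmall ε hε
  refine ⟨c * ((δ ^ (p - 1))⁻¹ + 1), by positivity, ?_⟩
  filter_upwards [hcont, hgrowth, hs] with x h1 h2 h3 s
  have hmid : ∀ s, 0 < |s| → |f x s| ≤ ε * |s| + c * ((δ ^ (p - 1))⁻¹ + 1) * |s| ^ (p - 1) := by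
    intro s hs0
    rcases lt_or_ge |s| δ with h | h
    · have h4 : 0 ≤ c * ((δ ^ (p - 1))⁻¹ + 1) * |s| ^ (p - 1) := by positivity
      linarith [h3 s hs0 h]
    · have h4 : δ ^ (p - 1) ≤ |s| ^ (p - 1) := Real.rpow_le_rpow hδ.le h (by linarith)
      have h5 : 1 ≤ (δ ^ (p - 1))⁻¹ * |s| ^ (p - 1) := by
        rw [← div_eq_inv_mul, one_le_div (by positivity)]; exact h4
      have h6 := mul_le_mul_of_nonneg_left h5 hc.le
      have h7 : 0 ≤ ε * |s| := by positivity
      linarith [h2 s]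
  rcases (abs_nonneg s).eq_or_lt with h0 | h0
  · -- the value at zero is a limit of values to which the bound applies
    have hs0 : s = 0 := abs_eq_zero.1 h0.symm
    subst hs0
    have hL : Tendsto (fun s => |f x s|) (𝓝[≠] 0) (𝓝 |f x 0|) :=
      (h1.abs.tendsto 0).mono_left nhdsWithin_le_nhds
    have hRc : Continuous fun s : ℝ => ε * |s| + c * ((δ ^ (p - 1))⁻¹ + 1) * |s| ^ (p - 1) :=
      (continuous_const.mul continuous_abs).add (continuous_const.mul
        (continuous_abs.rpow_const fun _ => Or.inr (by linarith)))
    have hR := (hRc.tendsto 0).mono_left (nhdsWithin_le_nhds (s := {0}ᶜ))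
    refine le_of_tendsto_of_tendsto hL hR ?_
    filter_upwards [self_mem_nhdsWithin] with s hs
    exact hmid s (abs_pos.2 hs)
  · exact hmid s h0

theorem exists_isAdmissible {q : ℝ} {f : Space N → ℝ → ℝ} {Γ : Space N → ℝ}
    (hf : NonlinearityAssumptions α q f) (hΓ : CoefficientAssumptions Γ) :
    ∃ (g : Space N → ℝ → ℝ) (p : ℝ), 2 < q ∧ q < p ∧ p < 2 * N / (N - α) ∧ IsAdmissible p q g ∧
      ∀ᵐ x : Space N, ∀ s, primitive f x s - 1 / q * Γ x * |s| ^ q = primitive g x s := by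
  obtain ⟨c, p, hc, hq, hqp, hp, hgrowth⟩ := hf.growth
  obtain ⟨f', hf'm, hf'c, hf'⟩ := exists_measurable_modification hf.aemeasurable hf.continuous
  set Γ' := hΓ.memLp_top.1.mk Γ with hΓ'
  have hΓm : Measurable Γ' := hΓ.memLp_top.1.stronglyMeasurable_mk.measurable
  have hΓae : Γ =ᵐ[volume] Γ' := hΓ.memLp_top.1.ae_eq_mk
  obtain ⟨L, hL0, hL⟩ : ∃ L > 0, ∀ᵐ x : Space N, 0 ≤ Γ' x ∧ Γ' x ≤ L := by
    refine ⟨(eLpNorm Γ ∞ volume).toReal + 1, by positivity, ?_⟩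
    filter_upwards [hΓae, hΓ.nonneg, ae_le_eLpNormEssSup (f := Γ) (μ := volume)] with x h1 h2 h3
    rw [← h1]
    refine ⟨h2, ?_⟩
    have h4 := ENNReal.toReal_mono (by simpa using hΓ.memLp_top.2.ne) h3
    rw [toReal_enorm, Real.norm_of_nonneg h2] at h4
    rw [eLpNorm_exponent_top]
    linarith
  set g : Space N → ℝ → ℝ := fun x s => f' x s - Γ' x * (|s| ^ (q - 2) * s) with hg
  have hpow : Continuous fun s : ℝ => |s| ^ (q - 2) * s :=
    (continuous_abs.rpow_const fun _ => Or.inr (by linarith)).mul continuous_id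
  have habs : ∀ s : ℝ, |(|s| ^ (q - 2) * s)| = |s| ^ (q - 1) := fun s => by
    rw [abs_mul, abs_of_nonneg (by positivity)]
    rcases eq_or_ne s 0 with rfl | hs
    · rw [abs_zero, Real.zero_rpow (by linarith), mul_zero, Real.zero_rpow (by linarith)]
    · rw [← Real.rpow_add_one (abs_ne_zero.2 hs)]; congr 1; ring
  have hprim : ∀ᵐ x : Space N, ∀ s, primitive g x s
      = primitive f x s - 1 / q * Γ' x * |s| ^ q := by
    filter_upwards [hf'] with x hx s
    simp only [primitive, hg]
    rw [intervalIntegral.integral_sub ((hf'c x).intervalIntegrable _ _)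
      ((hpow.const_mul _).intervalIntegrable _ _), intervalIntegral.integral_const_mul,
      integral_abs_rpow_mul_self hq]
    simp_rw [hx]
    ring
  have hgrow : ∃ C > 0, ∀ᵐ x : Space N, ∀ s, |g x s| ≤ C * (|s| + |s| ^ (p - 1)) := by
    obtain ⟨C, hC, h⟩ := exists_abs_le_of_small (hq.trans hqp) hc hf.continuous hgrowth
      hf.small_at_zero one_pos
    refine ⟨1 + C + L, by positivity, ?_⟩
    filter_upwards [hf', h, hL] with x h1 h2 h3 s
    have h4 := h2 s
    have h5 : |Γ' x * (|s| ^ (q - 2) * s)| ≤ L * (|s| + |s| ^ (p - 1)) := by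
      rw [abs_mul, habs, abs_of_nonneg h3.1]
      exact mul_le_mul h3.2 (abs_rpow_le_add (by linarith) (by linarith) s) (by positivity) hL0.le
    have h6 : |g x s| ≤ |f x s| + |Γ' x * (|s| ^ (q - 2) * s)| := by
      simp only [hg, h1]; exact abs_sub _ _
    have h7 : 0 ≤ |s| ^ (p - 1) := by positivity
    nlinarith [abs_nonneg s, mul_nonneg hC.le (abs_nonneg s)]
  refine ⟨g, p, hq, hqp, hp, ⟨?_, ?_, hgrow, ?_, ?_, ?_⟩, ?_⟩
  · refine hf'm.sub ((hΓm.comp measurable_fst).mul ?_)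
    exact hpow.measurable.comp measurable_snd
  · exact fun x => (hf'c x).sub (hpow.const_mul _)
  · intro ε hε
    obtain ⟨C, hC, h⟩ := exists_abs_le_of_small (hq.trans hqp) hc hf.continuous hgrowth
      hf.small_at_zero hε
    refine ⟨C, hC, ?_⟩
    filter_upwards [hf', h, hL] with x h1 h2 h3 s
    have h4 : f x s * s ≤ |f x s| * |s| := by rw [← abs_mul]; exact le_abs_self _
    have h5 := mul_le_mul_of_nonneg_right (h2 s) (abs_nonneg s)
    have h6 : |s| ^ (p - 1) * |s| = |s| ^ p :=
      abs_rpow_sub_one_mul_abs (by linarith) s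
    have h7 : 0 ≤ Γ' x * (|s| ^ (q - 2) * s) * s := by
      have : 0 ≤ Γ' x * |s| ^ (q - 2) * (s * s) :=
        mul_nonneg (mul_nonneg h3.1 (by positivity)) (mul_self_nonneg s)
      linarith
    simp only [hg, h1]
    calc (f x s - Γ' x * (|s| ^ (q - 2) * s)) * s ≤ |f x s| * |s| := by linarith
      _ ≤ _ := h5
      _ = ε * |s| ^ 2 + C * (|s| ^ (p - 1) * |s|) := by ring
      _ = _ := by rw [h6]
  · obtain ⟨C, hC, h⟩ := hgrow
    obtain ⟨R, hR, hsup⟩ := hf.superlinear (L / q + 1)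
    refine ⟨R ^ (q - 2) + C * (1 + R ^ (p - 2)), by positivity, ?_⟩
    filter_upwards [h, hsup, hprim, hL] with x h1 h2 h3 h4 s
    rcases le_total R |s| with h5 | h5
    · have hs : 0 < |s| := hR.trans_le h5
      have h6 := h2 s h5
      rw [le_div_iff₀ (by positivity)] at h6
      have h7 : 1 / q * Γ' x * |s| ^ q ≤ L / q * |s| ^ q := by
        rw [one_div, ← div_eq_inv_mul]
        have := h4.2
        gcongr
      have h8 : 0 ≤ (R ^ (q - 2) + C * (1 + R ^ (p - 2))) * |s| ^ 2 := by positivity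
      rw [h3]
      linarith
    · have h6 := abs_primitive_le (hq.trans hqp) hC h1 s
      have hsplit : ∀ r : ℝ, 2 < r → |s| ^ r ≤ R ^ (r - 2) * |s| ^ 2 := fun r hr => by
        rcases eq_or_ne s 0 with rfl | hs
        · rw [abs_zero, Real.zero_rpow (by linarith)]; simp
        · have h7 : |s| ^ r = |s| ^ (r - 2) * |s| ^ 2 := by
            rw [← Real.rpow_natCast |s| 2, ← Real.rpow_add (abs_pos.2 hs)]
            congr 1; push_cast; ring
          rw [h7]
          exact mul_le_mul_of_nonneg_right
            (Real.rpow_le_rpow (abs_nonneg _) h5 (by linarith)) (by positivity)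
      have h7 := mul_le_mul_of_nonneg_left (hsplit p (hq.trans hqp)) hC.le
      linarith [neg_abs_le (primitive g x s), hsplit q hq]
  · filter_upwards [hf', hf.strictMono] with x h1 h2 s t t' ht htt
    have ht' : 0 < t' := ht.trans_le htt
    have hsplit : ∀ t : ℝ, 0 < t → g x (t * s) * s / t ^ (q - 1) =
        f x (t * s) * s / t ^ (q - 1) - Γ' x * (|s| ^ (q - 2) * s ^ 2) := fun t ht => by
      rw [← abs_rpow_sub_mul ht]
      simp only [hg, h1]
      ring
    rw [hsplit t ht, hsplit t' ht']
    refine sub_le_sub_right ?_ _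
    rcases eq_or_ne s 0 with rfl | hs
    · simp
    have hquot : ∀ t : ℝ, 0 < t → f x (t * s) * s / t ^ (q - 1) =
        f x (t * s) / |t * s| ^ (q - 1) * (s * |s| ^ (q - 1)) := fun t ht => by
      have : 0 < |s| := abs_pos.2 hs
      rw [abs_mul, abs_of_pos ht, Real.mul_rpow ht.le (abs_nonneg _)]
      field_simp
    rw [hquot t ht, hquot t' ht']
    rcases lt_or_gt_of_ne hs with hs | hs
    · have h3 := h2.1.monotoneOn (a := t' * s) (b := t * s) (mul_neg_of_pos_of_neg ht' hs)
        (mul_neg_of_pos_of_neg ht hs) (by nlinarith)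
      exact mul_le_mul_of_nonpos_right h3 (mul_nonpos_of_nonpos_of_nonneg hs.le (by positivity))
    · have h3 := h2.2.monotoneOn (a := t * s) (b := t' * s) (mul_pos ht hs)
        (mul_pos ht' hs) (by nlinarith)
      exact mul_le_mul_of_nonneg_right h3 (by positivity)
  · filter_upwards [hprim, hΓae] with x h1 h2 s
    rw [h1, h2]

/-! ### Convergence of integrals of superposition operators -/

/-- Dominated convergence with bounds `d n + B`, where the `d n` tend to zero in `L¹`. -/
theorem tendsto_integral_of_bound_add {X : Type*} [MeasurableSpace X] {μ : Measure X}
    {F : ℕ → X → ℝ} {G B : X → ℝ} {d : ℕ → X → ℝ} (hFm : ∀ n, AEStronglyMeasurable (F n) μ)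
    (hFG : ∀ᵐ x ∂μ, Tendsto (fun n => F n x) atTop (𝓝 (G x)))
    (hF : ∀ n, ∀ᵐ x ∂μ, |F n x| ≤ d n x + B x) (hd0 : ∀ n x, 0 ≤ d n x)
    (hd : ∀ n, Integrable (d n) μ) (hdt : Tendsto (fun n => ∫ x, d n x ∂μ) atTop (𝓝 0))
    (hB : Integrable B μ) (hG : Integrable G μ) :
    Tendsto (fun n => ∫ x, F n x ∂μ) atTop (𝓝 (∫ x, G x ∂μ)) := by
  have hFi : ∀ n, Integrable (F n) μ := fun n => ((hd n).add hB).mono' (hFm n) (hF n)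
  -- the part of `|F n - G|` that is not absorbed by `d n` has a fixed integrable bound
  have hh : Tendsto (fun n => ∫ x, max (|F n x - G x| - d n x) 0 ∂μ) atTop (𝓝 (∫ _, 0 ∂μ)) := by
    refine tendsto_integral_of_dominated_convergence (fun x => |B x| + |G x|) (fun n => ?_)
      (hB.abs.add hG.abs) (fun n => ?_) ?_
    · have h := (((hFi n).sub hG).abs.sub (hd n)).pos_part
      exact h.1
    · filter_upwards [hF n] with x hx
      rw [Real.norm_of_nonneg (le_max_right _ _)]
      refine max_le ?_ (by positivity)
      have := abs_sub (F n x) (G x)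
      linarith [le_abs_self (B x)]
    · filter_upwards [hFG] with x hx
      have h1 : Tendsto (fun n => |F n x - G x|) atTop (𝓝 0) := by
        simpa using (hx.sub_const (G x)).abs
      refine squeeze_zero (fun n => le_max_right _ _) (fun n => ?_) h1
      exact max_le (by linarith [hd0 n x]) (abs_nonneg _)
  rw [integral_zero] at hh
  have hsum := hh.add hdt
  rw [add_zero] at hsum
  rw [tendsto_iff_norm_sub_tendsto_zero]
  refine squeeze_zero (fun n => norm_nonneg _) (fun n => ?_) hsum
  have hp : Integrable (fun x => max (|F n x - G x| - d n x) 0) μ :=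
    (((hFi n).sub hG).abs.sub (hd n)).pos_part
  rw [← integral_sub (hFi n) hG, ← integral_add hp (hd n)]
  refine (norm_integral_le_integral_norm _).trans
    (integral_mono ((hFi n).sub hG).norm (hp.add (hd n)) fun x => ?_)
  simp only [Real.norm_eq_abs]
  linarith [le_max_left (|F n x - G x| - d n x) 0]

theorem tendsto_integral_comp {X : Type*} [MeasurableSpace X] {μ : Measure X}
    {v : ℕ → X → ℝ} {u : X → ℝ} {Θ : X → ℝ → ℝ} {D : ℝ → ℝ} {B : X → ℝ}
    (hv : TendstoInMeasure μ v atTop u)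
    (hm : ∀ n, AEStronglyMeasurable (fun x => Θ x (v n x)) μ)
    (hc : ∀ᵐ x ∂μ, ContinuousAt (Θ x) (u x)) (hD : ∀ s, 0 ≤ D s) (hD0 : D 0 = 0)
    (hΘ : ∀ᵐ x ∂μ, ∀ s, |Θ x s| ≤ D (s - u x) + B x) (hB : Integrable B μ)
    (hDi : ∀ n, Integrable (fun x => D (v n x - u x)) μ)
    (hDt : Tendsto (fun n => ∫ x, D (v n x - u x) ∂μ) atTop (𝓝 0)) :
    Tendsto (fun n => ∫ x, Θ x (v n x) ∂μ) atTop (𝓝 (∫ x, Θ x (u x) ∂μ)) := by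
  refine tendsto_of_subseq_tendsto fun ns hns => ?_
  obtain ⟨ms, hms, hae⟩ := (hv.comp hns).exists_seq_tendsto_ae
  have hlim : ∀ᵐ x ∂μ, Tendsto (fun n => Θ x (v (ns (ms n)) x)) atTop (𝓝 (Θ x (u x))) := by
    filter_upwards [hae, hc] with x h1 h2
    exact h2.tendsto.comp h1
  refine ⟨ms, tendsto_integral_of_bound_add (fun n => hm _) hlim
    (d := fun n x => D (v (ns (ms n)) x - u x)) (B := B) (fun n => ?_) (fun n x => hD _)
    (fun n => hDi _) ((hDt.comp hns).comp hms.tendsto_atTop) hB ?_⟩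
  · filter_upwards [hΘ] with x hx
    exact hx _
  · refine hB.mono' (aestronglyMeasurable_of_tendsto_ae atTop (fun n => hm _) hlim) ?_
    filter_upwards [hΘ] with x hx
    have := hx (u x)
    rwa [sub_self, hD0, zero_add] at this

theorem add_rpow_le_two_rpow_mul {a b r : ℝ} (ha : 0 ≤ a) (hb : 0 ≤ b) (hr : 0 ≤ r) :
    (a + b) ^ r ≤ 2 ^ r * (a ^ r + b ^ r) := by
  have h1 : a + b ≤ 2 * max a b := by linarith [le_max_left a b, le_max_right a b]
  have h2 : (max a b) ^ r ≤ a ^ r + b ^ r := by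
    have h3 : 0 ≤ a ^ r := by positivity
    have h4 : 0 ≤ b ^ r := by positivity
    rcases max_choice a b with h | h <;> rw [h] <;> linarith
  have h0 : 0 ≤ max a b := le_max_of_le_left ha
  calc (a + b) ^ r ≤ (2 * max a b) ^ r := Real.rpow_le_rpow (by positivity) h1 hr
    _ = 2 ^ r * (max a b) ^ r := Real.mul_rpow (by norm_num) h0
    _ ≤ _ := by gcongr

/-! ### Superposition operators with values in the dual space -/

/-- The energy space embeds continuously into `L^r`. -/
def EmbedsInLp (α : ℝ) (V : CoercivePotential N) (r : ℝ) : Prop :=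
  ∃ C > 0, ∀ u : EnergySpace α V, Integrable (fun x => |u.toL2 x| ^ r) ∧
    ∫ x, |u.toL2 x| ^ r ≤ C * ‖u‖ ^ r

theorem embedsInLp_two (α : ℝ) (V : CoercivePotential N) : EmbedsInLp α V 2 := by
  obtain ⟨C, hC, h⟩ := exists_norm_toL2_sq_le V
  refine ⟨C, hC, fun u => ?_⟩
  have hi := integrable_norm_sq u.toL2
  simp_rw [Real.rpow_two, ← Real.norm_eq_abs]
  refine ⟨hi, ?_⟩
  rw [← norm_sq_eq_integral]
  exact h α u

theorem tendsto_toL2 {u : ℕ → EnergySpace α V} {v : EnergySpace α V}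
    (h : Tendsto u atTop (𝓝 v)) : Tendsto (fun n => (u n).toL2) atTop (𝓝 v.toL2) := by
  obtain ⟨C, hC, hb⟩ := exists_norm_toL2_sq_le V
  rw [tendsto_iff_norm_sub_tendsto_zero] at h ⊢
  have h2 : Tendsto (fun n => √(C * ‖u n - v‖ ^ 2)) atTop (𝓝 0) := by
    have h0 : Tendsto (fun n => C * ‖u n - v‖ ^ 2) atTop (𝓝 0) := by
      simpa using (h.pow 2).const_mul C
    have h1 := (Real.continuous_sqrt.tendsto 0).comp h0
    rwa [Real.sqrt_zero] at h1
  refine squeeze_zero (fun n => norm_nonneg _) (fun n => ?_) h2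
  exact Real.le_sqrt_of_sq_le (hb α (u n - v))

theorem holder_integral {X : Type*} [MeasurableSpace X] {μ : Measure X} {r : ℝ} (hr : 1 < r)
    {m h : X → ℝ} (hm : AEStronglyMeasurable m μ) (hh : AEStronglyMeasurable h μ)
    (hmi : Integrable (fun x => |m x| ^ (r / (r - 1))) μ)
    (hhi : Integrable (fun x => |h x| ^ r) μ) :
    Integrable (fun x => m x * h x) μ ∧ |∫ x, m x * h x ∂μ| ≤
      (∫ x, |m x| ^ (r / (r - 1)) ∂μ) ^ ((r - 1) / r) * (∫ x, |h x| ^ r ∂μ) ^ (1 / r) := by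
  have hconj : (r / (r - 1)).HolderConjugate r :=
    (Real.HolderConjugate.conjExponent hr).symm
  have := hconj.ennrealOfReal
  have hmL : MemLp m (ENNReal.ofReal (r / (r - 1))) μ := by
    rw [← integrable_norm_rpow_iff hm (by simpa using hconj.pos) ENNReal.ofReal_ne_top,
      ENNReal.toReal_ofReal hconj.pos.le]
    exact hmi
  have hhL : MemLp h (ENNReal.ofReal r) μ := by
    rw [← integrable_norm_rpow_iff hh (by simpa using hconj.symm.pos) ENNReal.ofReal_ne_top,
      ENNReal.toReal_ofReal hconj.symm.pos.le]
    exact hhi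
  refine ⟨hmL.integrable_mul hhL, ?_⟩
  have h1 := integral_mul_norm_le_Lp_mul_Lq (E := ℝ) hconj hmL hhL
  rw [one_div_div] at h1
  have h2 := norm_integral_le_integral_norm (μ := μ) (fun x => m x * h x)
  simp_rw [norm_mul] at h2
  exact h2.trans h1

theorem toL2_add_ae (u v : EnergySpace α V) :
    ∀ᵐ x, (u + v).toL2 x = u.toL2 x + v.toL2 x := Lp.coeFn_add u.toL2 v.toL2

theorem toL2_sub_ae (u v : EnergySpace α V) :
    ∀ᵐ x, (u - v).toL2 x = u.toL2 x - v.toL2 x := Lp.coeFn_sub u.toL2 v.toL2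

theorem toL2_smul_ae (c : ℝ) (u : EnergySpace α V) :
    ∀ᵐ x, (c • u).toL2 x = c * u.toL2 x := Lp.coeFn_smul c u.toL2

theorem measurable_toL2 (u : EnergySpace α V) : Measurable u.toL2 :=
  (Lp.stronglyMeasurable u.toL2).measurable

theorem measurable_superposition {k : Space N → ℝ → ℝ} (hm : Measurable (Function.uncurry k))
    {u : Space N → ℝ} (hu : Measurable u) : Measurable fun x => k x (u x) :=
  hm.comp (measurable_id.prodMk hu)

/-- A superposition operator of growth `r - 1` maps the energy space continuously into its dual. -/
theorem exists_continuous_superposition {r : ℝ} (hr : 1 < r) (hemb : EmbedsInLp α V r)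
    {k : Space N → ℝ → ℝ} (hm : Measurable (Function.uncurry k)) (hc : ∀ x, Continuous (k x))
    {C : ℝ} (hC : 0 < C) (hk : ∀ᵐ x : Space N, ∀ s, |k x s| ≤ C * |s| ^ (r - 1)) :
    ∃ A : EnergySpace α V → (EnergySpace α V →L[ℝ] ℝ), Continuous A ∧
      ∀ u h : EnergySpace α V, Integrable (fun x => k x (u.toL2 x) * h.toL2 x) ∧
        A u h = ∫ x, k x (u.toL2 x) * h.toL2 x := by
  obtain ⟨S, hS, hSb⟩ := hemb
  have hr0 : 0 < r := by linarith
  have hr1 : 0 < r - 1 := by linarith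
  set r' := r / (r - 1) with hr'
  have hr'0 : 0 < r' := by positivity
  have hpow : ∀ s : ℝ, (C * |s| ^ (r - 1)) ^ r' = C ^ r' * |s| ^ r := fun s => by
    rw [Real.mul_rpow hC.le (by positivity), ← Real.rpow_mul (abs_nonneg s), hr',
      mul_div_cancel₀ _ hr1.ne']
  have hkm : ∀ u : EnergySpace α V, Measurable fun x => k x (u.toL2 x) := fun u =>
    measurable_superposition hm (measurable_toL2 u)
  have hki : ∀ u : EnergySpace α V, Integrable (fun x => |k x (u.toL2 x)| ^ r') := fun u => by
    refine ((hSb u).1.const_mul (C ^ r')).mono'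
      (((hkm u).norm.pow_const r').aestronglyMeasurable) ?_
    filter_upwards [hk] with x hx
    rw [Real.norm_of_nonneg (by positivity), ← hpow]
    exact Real.rpow_le_rpow (abs_nonneg _) (hx _) hr'0.le
  have hdual : ∀ (m : Space N → ℝ) (h : EnergySpace α V), Measurable m →
      Integrable (fun x => |m x| ^ r') → Integrable (fun x => m x * h.toL2 x) ∧
        |∫ x, m x * h.toL2 x| ≤ (∫ x, |m x| ^ r') ^ ((r - 1) / r) * S ^ (1 / r) * ‖h‖ :=
    fun m h hmm hmi => by
    obtain ⟨h1, h2⟩ := holder_integral hr hmm.aestronglyMeasurable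
      (measurable_toL2 h).aestronglyMeasurable hmi (hSb h).1
    refine ⟨h1, h2.trans ?_⟩
    rw [mul_assoc]
    refine mul_le_mul_of_nonneg_left ?_
      (Real.rpow_nonneg (integral_nonneg fun x => by simp only [Pi.zero_apply]; positivity) _)
    calc (∫ x, |h.toL2 x| ^ r) ^ (1 / r) ≤ (S * ‖h‖ ^ r) ^ (1 / r) :=
          Real.rpow_le_rpow (integral_nonneg fun x => by simp only [Pi.zero_apply]; positivity)
            (hSb h).2 (by positivity)
      _ = S ^ (1 / r) * ‖h‖ := by
          rw [Real.mul_rpow hS.le (by positivity), ← Real.rpow_mul (norm_nonneg _),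
            mul_one_div_cancel hr0.ne', Real.rpow_one]
  let A : EnergySpace α V → (EnergySpace α V →L[ℝ] ℝ) := fun u =>
    LinearMap.mkContinuous
      { toFun := fun h => ∫ x, k x (u.toL2 x) * h.toL2 x
        map_add' := fun h₁ h₂ => by
          rw [← integral_add (hdual _ h₁ (hkm u) (hki u)).1 (hdual _ h₂ (hkm u) (hki u)).1]
          refine integral_congr_ae ?_
          filter_upwards [toL2_add_ae h₁ h₂] with x hx
          rw [hx]; ring
        map_smul' := fun c h => by
          rw [RingHom.id_apply, smul_eq_mul, ← integral_const_mul]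
          refine integral_congr_ae ?_
          filter_upwards [toL2_smul_ae c h] with x hx
          rw [hx]; ring }
      ((∫ x, |k x (u.toL2 x)| ^ r') ^ ((r - 1) / r) * S ^ (1 / r))
      (fun h => (hdual _ h (hkm u) (hki u)).2)
  have hA : ∀ u h, A u h = ∫ x, k x (u.toL2 x) * h.toL2 x := fun u h => rfl
  refine ⟨A, ?_, fun u h => ⟨(hdual _ h (hkm u) (hki u)).1, hA u h⟩⟩
  rw [continuous_iff_seqContinuous]
  intro u v huv
  have hsub : ∀ n, Integrable (fun x => |k x ((u n).toL2 x) - k x (v.toL2 x)| ^ r') := fun n => by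
    refine (((hki (u n)).add (hki v)).const_mul (2 ^ r')).mono'
      (((hkm (u n)).sub (hkm v)).norm.pow_const r').aestronglyMeasurable
      (Eventually.of_forall fun x => ?_)
    rw [Real.norm_of_nonneg (by positivity)]
    exact (Real.rpow_le_rpow (abs_nonneg _) (abs_sub _ _) hr'0.le).trans
      (add_rpow_le_two_rpow_mul (abs_nonneg _) (abs_nonneg _) hr'0.le)
  have hnorm : ∀ n, ‖A (u n) - A v‖ ≤
      (∫ x, |k x ((u n).toL2 x) - k x (v.toL2 x)| ^ r') ^ ((r - 1) / r) * S ^ (1 / r) := fun n => by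
    refine ContinuousLinearMap.opNorm_le_bound _ (mul_nonneg (Real.rpow_nonneg (integral_nonneg
      fun x => by simp only [Pi.zero_apply]; positivity) _) (by positivity)) fun h => ?_
    rw [sub_apply, hA, hA,
      ← integral_sub (hdual _ h (hkm _) (hki _)).1 (hdual _ h (hkm _) (hki _)).1]
    simp_rw [← sub_mul]
    exact (hdual _ h ((hkm (u n)).sub (hkm v)) (hsub n)).2
  have hlim : Tendsto (fun n => ∫ x, |k x ((u n).toL2 x) - k x (v.toL2 x)| ^ r') atTop
      (𝓝 (∫ x, |k x (v.toL2 x) - k x (v.toL2 x)| ^ r')) := by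
    set c := 2 ^ r' * (C ^ r' * 2 ^ r) with hcdef
    have hc0 : 0 < c := by positivity
    refine tendsto_integral_comp (Θ := fun x s => |k x s - k x (v.toL2 x)| ^ r')
      (D := fun s => c * |s| ^ r) (B := fun x => 2 * c * |v.toL2 x| ^ r)
      (tendstoInMeasure_of_tendsto_Lp (tendsto_toL2 huv)) (fun n => (hsub n).1)
      (Eventually.of_forall fun x => ?_) (fun s => by positivity) ?_ ?_
      ((hSb v).1.const_mul _) (fun n => ?_) ?_
    · exact (((hc x).sub continuous_const).abs.rpow_const fun _ => Or.inr hr'0.le).continuousAt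
    · rw [abs_zero, Real.zero_rpow hr0.ne', mul_zero]
    · filter_upwards [hk] with x hx s
      rw [abs_of_nonneg (by positivity)]
      have hkr : ∀ s, |k x s| ^ r' ≤ C ^ r' * |s| ^ r := fun s => by
        rw [← hpow]; exact Real.rpow_le_rpow (abs_nonneg _) (hx _) hr'0.le
      have h1 : |s| ^ r ≤ 2 ^ r * (|s - v.toL2 x| ^ r + |v.toL2 x| ^ r) := by
        have h2 : |s| ≤ |s - v.toL2 x| + |v.toL2 x| := by
          have := abs_add_le (s - v.toL2 x) (v.toL2 x)
          rwa [sub_add_cancel] at this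
        exact (Real.rpow_le_rpow (abs_nonneg _) h2 hr0.le).trans
          (add_rpow_le_two_rpow_mul (abs_nonneg _) (abs_nonneg _) hr0.le)
      have h3 : (1 : ℝ) ≤ 2 ^ r := Real.one_le_rpow one_le_two hr0.le
      have h4 : 0 ≤ |v.toL2 x| ^ r := by positivity
      calc |k x s - k x (v.toL2 x)| ^ r' ≤ (|k x s| + |k x (v.toL2 x)|) ^ r' :=
            Real.rpow_le_rpow (abs_nonneg _) (abs_sub _ _) hr'0.le
        _ ≤ 2 ^ r' * (|k x s| ^ r' + |k x (v.toL2 x)| ^ r') :=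
            add_rpow_le_two_rpow_mul (abs_nonneg _) (abs_nonneg _) hr'0.le
        _ ≤ 2 ^ r' * (C ^ r' * |s| ^ r + C ^ r' * |v.toL2 x| ^ r) := by
            gcongr
            · exact hkr _
            · exact hkr _
        _ = 2 ^ r' * (C ^ r' * (|s| ^ r + |v.toL2 x| ^ r)) := by ring
        _ ≤ 2 ^ r' * (C ^ r' * (2 ^ r * (|s - v.toL2 x| ^ r + |v.toL2 x| ^ r) +
              2 ^ r * |v.toL2 x| ^ r)) := by
            gcongr
            nlinarith
        _ = c * |s - v.toL2 x| ^ r + 2 * c * |v.toL2 x| ^ r := by rw [hcdef]; ring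
    · refine ((hSb (u n - v)).1.const_mul c).congr ?_
      filter_upwards [toL2_sub_ae (u n) v] with x hx
      rw [hx]
    · have h1 : ∀ n, ∫ x, c * |(u n).toL2 x - v.toL2 x| ^ r ≤ c * (S * ‖u n - v‖ ^ r) := fun n => by
        rw [integral_const_mul]
        refine mul_le_mul_of_nonneg_left (le_of_eq_of_le (integral_congr_ae ?_)
          (hSb (u n - v)).2) hc0.le
        filter_upwards [toL2_sub_ae (u n) v] with x hx
        rw [hx]
      refine squeeze_zero (fun n => integral_nonneg fun x => ?_) h1 ?_
      · simp only [Pi.zero_apply]; positivity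
      · have h2 := ((tendsto_iff_norm_sub_tendsto_zero.1 huv).rpow_const
          (Or.inr hr0.le : (0 : ℝ) ≠ 0 ∨ 0 ≤ r))
        rw [Real.zero_rpow hr0.ne'] at h2
        simpa using (h2.const_mul S).const_mul c
  simp only [sub_self, abs_zero, Real.zero_rpow hr'0.ne', integral_zero] at hlim
  have h := (hlim.rpow_const (Or.inr (by positivity) : (0 : ℝ) ≠ 0 ∨ 0 ≤ (r - 1) / r)).mul_const
    (S ^ (1 / r))
  rw [Real.zero_rpow (by positivity), zero_mul] at h
  have h' : Tendsto (fun n => ‖A (u n) - A v‖) atTop (𝓝 0) :=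
    squeeze_zero (fun n => norm_nonneg (A (u n) - A v)) hnorm h
  exact (tendsto_iff_norm_sub_tendsto_zero (E := EnergySpace α V →L[ℝ] ℝ)).2 h'

/-! ### Differentiability of the nonlinear part of the functional -/

/-- A functional with directional derivatives that depend continuously on the point is Fréchet
differentiable. -/
theorem hasFDerivAt_of_continuous_lineDeriv {E : Type*} [NormedAddCommGroup E] [NormedSpace ℝ E]
    {Ψ : E → ℝ} {A : E → (E →L[ℝ] ℝ)} (hA : Continuous A)
    (h : ∀ u v : E, ∀ t : ℝ, HasDerivAt (fun t : ℝ => Ψ (u + t • v)) (A (u + t • v) v) t) (u : E) :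
    HasFDerivAt Ψ (A u) u := by
  rw [hasFDerivAt_iff_isLittleO_nhds_zero, Asymptotics.isLittleO_iff]
  intro ε hε
  obtain ⟨δ, hδ, hδA⟩ := Metric.continuousAt_iff.1 hA.continuousAt ε hε
  filter_upwards [Metric.ball_mem_nhds (0 : E) hδ] with v hv
  have hv' : ‖v‖ < δ := by simpa using hv
  have h1 : ∀ t ∈ Set.Icc (0 : ℝ) 1, HasDerivWithinAt (fun t : ℝ => Ψ (u + t • v) - t * A u v)
      (A (u + t • v) v - 1 * A u v) (Set.Icc 0 1) t := fun t _ =>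
    ((h u v t).sub ((hasDerivAt_id t).mul_const _)).hasDerivWithinAt
  have h2 := norm_image_sub_le_of_norm_deriv_le_segment_01' h1 (C := ε * ‖v‖) fun t ht => by
    rw [one_mul, ← sub_apply]
    refine (ContinuousLinearMap.le_opNorm _ _).trans ?_
    gcongr
    rw [← dist_eq_norm]
    refine (hδA ?_).le
    rw [dist_eq_norm, add_sub_cancel_left, norm_smul, Real.norm_of_nonneg ht.1]
    nlinarith [norm_nonneg v, ht.2]
  simp only [one_smul, one_mul, zero_smul, add_zero, zero_mul, sub_zero] at h2
  rwa [sub_right_comm] at h2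

theorem abs_le_of_growth {g : Space N → ℝ → ℝ} {C p : ℝ} {x : Space N} (hp : 2 < p) (hC : 0 < C)
    (h : ∀ s, |g x s| ≤ C * (|s| + |s| ^ (p - 1))) {s m : ℝ} (hs : |s| ≤ m) :
    |g x s| * m ≤ C * (m ^ 2 + m ^ p) := by
  have hm : 0 ≤ m := (abs_nonneg s).trans hs
  have h1 : |s| ^ (p - 1) ≤ m ^ (p - 1) := Real.rpow_le_rpow (abs_nonneg _) hs (by linarith)
  have h2 : m ^ (p - 1) * m = m ^ p := by
    have := abs_rpow_sub_one_mul_abs (by linarith : 1 < p) m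
    rwa [abs_of_nonneg hm] at this
  calc |g x s| * m ≤ C * (m + m ^ (p - 1)) * m := by
        gcongr
        exact (h s).trans (by gcongr)
    _ = C * (m ^ 2 + m ^ (p - 1) * m) := by ring
    _ = _ := by rw [h2]

theorem integrable_primitive {p q : ℝ} {g : Space N → ℝ → ℝ} (hg : IsAdmissible p q g)
    (hp : 2 < p) (hemb : EmbedsInLp α V p) (u : EnergySpace α V) :
    Integrable (fun x => primitive g x (u.toL2 x)) := by
  obtain ⟨C, hC, hgr⟩ := hg.growth
  obtain ⟨S, hS, hSb⟩ := hemb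
  have h2 : Integrable (fun x => |u.toL2 x| ^ 2) := integrable_norm_sq u.toL2
  refine ((h2.add (hSb u).1).const_mul C).mono' (measurable_superposition
    (measurable_primitive hg.measurable hg.continuous)
    (measurable_toL2 u)).aestronglyMeasurable ?_
  filter_upwards [hgr] with x hx
  exact abs_primitive_le hp hC hx _

/-- The nonlinear part `Ψ(u) = ∫ G(x, u) dx` of the functional is of class `C¹`. -/
theorem exists_hasFDerivAt_primitive {p q : ℝ} {g : Space N → ℝ → ℝ} (hg : IsAdmissible p q g)
    (hp : 2 < p) (hemb : EmbedsInLp α V p) :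
    ∃ A : EnergySpace α V → (EnergySpace α V →L[ℝ] ℝ), Continuous A ∧
      (∀ u h : EnergySpace α V, A u h = ∫ x, g x (u.toL2 x) * h.toL2 x) ∧
      ∀ u, HasFDerivAt (fun u : EnergySpace α V => ∫ x, primitive g x (u.toL2 x)) (A u) u := by
  obtain ⟨C, hC, hgr⟩ := hg.growth
  -- `g = a + a |s|^(p-2)`, where `a` grows linearly and the second summand like `|s|^(p-1)`
  have hden : ∀ s : ℝ, 0 < 1 + |s| ^ (p - 2) := fun s => by positivity
  have hpc : Continuous fun s : ℝ => |s| ^ (p - 2) :=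
    continuous_abs.rpow_const fun _ => Or.inr (by linarith)
  set a : Space N → ℝ → ℝ := fun x s => g x s / (1 + |s| ^ (p - 2)) with ha
  have ham : Measurable (Function.uncurry a) := by
    refine hg.measurable.div (measurable_const.add ?_)
    exact hpc.measurable.comp measurable_snd
  have hac : ∀ x, Continuous (a x) := fun x =>
    (hg.continuous x).div (continuous_const.add hpc) fun s => (hden s).ne'
  have hpow : ∀ s : ℝ, |s| ^ (p - 2) * |s| = |s| ^ (p - 1) := fun s => by
    have := abs_rpow_sub_one_mul_abs (by linarith : 1 < p - 1) s
    rwa [show p - 1 - 1 = p - 2 by ring] at this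
  have hagr : ∀ᵐ x : Space N, ∀ s, |a x s| ≤ C * |s| := by
    filter_upwards [hgr] with x hx s
    rw [ha, abs_div, abs_of_pos (hden s), div_le_iff₀ (hden s)]
    refine (hx s).trans (le_of_eq ?_)
    rw [← hpow]; ring
  obtain ⟨A₁, hA₁, hA₁'⟩ := exists_continuous_superposition one_lt_two (embedsInLp_two α V) ham hac
    hC (by
      filter_upwards [hagr] with x hx s
      rw [show (2 : ℝ) - 1 = 1 by norm_num, Real.rpow_one]
      exact hx s)
  obtain ⟨A₂, hA₂, hA₂'⟩ := exists_continuous_superposition (by linarith) hemb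
    (k := fun x s => a x s * |s| ^ (p - 2))
    (ham.mul (hpc.measurable.comp measurable_snd)) (fun x => (hac x).mul hpc) hC (by
      filter_upwards [hagr] with x hx s
      rw [abs_mul, abs_of_nonneg (by positivity : 0 ≤ |s| ^ (p - 2)), ← hpow]
      have := hx s
      calc |a x s| * |s| ^ (p - 2) ≤ C * |s| * |s| ^ (p - 2) := by gcongr
        _ = _ := by ring)
  have hsum : ∀ x s, a x s + a x s * |s| ^ (p - 2) = g x s := fun x s => by
    have := (hden s).ne'
    simp only [ha]
    field_simp
  have hA : ∀ u h : EnergySpace α V, (A₁ u + A₂ u) h = ∫ x, g x (u.toL2 x) * h.toL2 x :=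
    fun u h => by
    rw [add_apply, (hA₁' u h).2, (hA₂' u h).2,
      ← integral_add (hA₁' u h).1 (hA₂' u h).1]
    simp_rw [← add_mul, hsum]
  refine ⟨fun u => A₁ u + A₂ u, hA₁.add hA₂, hA,
    hasFDerivAt_of_continuous_lineDeriv (hA₁.add hA₂) fun u h t₀ => ?_⟩
  obtain ⟨S, hS, hSb⟩ := id hemb
  have hae : ∀ t : ℝ, ∀ᵐ x, (u + t • h).toL2 x = u.toL2 x + t * h.toL2 x := fun t => by
    filter_upwards [toL2_add_ae u (t • h), toL2_smul_ae t h] with x h1 h2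
    rw [h1, h2]
  have hΨ : ∀ t : ℝ, ∫ x, primitive g x ((u + t • h).toL2 x)
      = ∫ x, primitive g x (u.toL2 x + t * h.toL2 x) := fun t => by
    refine integral_congr_ae ?_
    filter_upwards [hae t] with x hx
    rw [hx]
  have hd : ((A₁ (u + t₀ • h) + A₂ (u + t₀ • h)) h)
      = ∫ x, g x (u.toL2 x + t₀ * h.toL2 x) * h.toL2 x := by
    rw [hA]
    refine integral_congr_ae ?_
    filter_upwards [hae t₀] with x hx
    rw [hx]
  simp_rw [hΨ]
  rw [hd]
  have hmeas : ∀ t : ℝ, Measurable fun x => u.toL2 x + t * h.toL2 x := fun t =>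
    (measurable_toL2 u).add ((measurable_toL2 h).const_mul t)
  set T := |t₀| + 1 with hT
  have hT1 : 1 ≤ T := by rw [hT]; linarith [abs_nonneg t₀]
  have hu2 : Integrable (fun x => |u.toL2 x| ^ 2) := integrable_norm_sq u.toL2
  have hh2 : Integrable (fun x => |h.toL2 x| ^ 2) := integrable_norm_sq h.toL2
  refine (hasDerivAt_integral_of_dominated_loc_of_deriv_le
    (F := fun t x => primitive g x (u.toL2 x + t * h.toL2 x))
    (F' := fun t x => g x (u.toL2 x + t * h.toL2 x) * h.toL2 x)
    (s := Metric.ball t₀ 1)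
    (bound := fun x => C * (2 * (|u.toL2 x| ^ 2 + T ^ 2 * |h.toL2 x| ^ 2) +
      2 ^ p * (|u.toL2 x| ^ p + T ^ p * |h.toL2 x| ^ p)))
    (Metric.ball_mem_nhds _ one_pos) (Eventually.of_forall fun t => ?_) ?_ ?_ ?_ ?_ ?_).2
  · exact (measurable_superposition (measurable_primitive hg.measurable hg.continuous)
      (hmeas t)).aestronglyMeasurable
  · refine (integrable_primitive hg hp hemb (u + t₀ • h)).congr ?_
    filter_upwards [hae t₀] with x hx
    rw [hx]
  · exact ((measurable_superposition hg.measurable (hmeas t₀)).mul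
      (measurable_toL2 h)).aestronglyMeasurable
  · filter_upwards [hgr] with x hx t ht
    have ht' : |t| ≤ T := by
      have h1 : |t - t₀| < 1 := ht
      have h2 := abs_add_le (t - t₀) t₀
      rw [sub_add_cancel] at h2
      linarith
    set m := |u.toL2 x| + T * |h.toL2 x| with hm
    have hsm : |u.toL2 x + t * h.toL2 x| ≤ m := by
      refine (abs_add_le _ _).trans ?_
      rw [abs_mul]
      exact add_le_add_right (mul_le_mul_of_nonneg_right ht' (abs_nonneg _)) _
    have hhm : |h.toL2 x| ≤ m := by
      nlinarith [abs_nonneg (u.toL2 x), abs_nonneg (h.toL2 x)]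
    have hmp : m ^ p ≤ 2 ^ p * (|u.toL2 x| ^ p + T ^ p * |h.toL2 x| ^ p) := by
      have := add_rpow_le_two_rpow_mul (abs_nonneg (u.toL2 x))
        (by positivity : 0 ≤ T * |h.toL2 x|) (by linarith : 0 ≤ p)
      rwa [Real.mul_rpow (by positivity) (abs_nonneg _)] at this
    have hm2 : m ^ 2 ≤ 2 * (|u.toL2 x| ^ 2 + T ^ 2 * |h.toL2 x| ^ 2) := by
      nlinarith [sq_nonneg (|u.toL2 x| - T * |h.toL2 x|)]
    rw [norm_mul, Real.norm_eq_abs, Real.norm_eq_abs]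
    calc _ ≤ |g x (u.toL2 x + t * h.toL2 x)| * m := by gcongr
      _ ≤ C * (m ^ 2 + m ^ p) := abs_le_of_growth hp hC hx hsm
      _ ≤ _ := by gcongr
  · exact (((hu2.add (hh2.const_mul _)).const_mul 2).add
      (((hSb u).1.add ((hSb h).1.const_mul _)).const_mul _)).const_mul C
  · refine Eventually.of_forall fun x t _ => ?_
    have h1 := (hasDerivAt_primitive (hg.continuous x) (u.toL2 x + t * h.toL2 x))
    have h2 : HasDerivAt (fun t : ℝ => u.toL2 x + t * h.toL2 x) (h.toL2 x) t := by
      simpa using ((hasDerivAt_id t).mul_const (h.toL2 x)).const_add (u.toL2 x)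
    exact h1.comp t h2

/-- Functionals of subcritical growth are continuous with respect to the convergence provided by
the compact embedding. -/
theorem tendsto_integral_superposition {p : ℝ} (hp : 2 < p) (hemb : EmbedsInLp α V p)
    {H : Space N → ℝ → ℝ} (hm : Measurable (Function.uncurry H)) (hc : ∀ x, Continuous (H x))
    {C : ℝ} (hC : 0 < C) (hH : ∀ᵐ x : Space N, ∀ s, |H x s| ≤ C * (|s| ^ 2 + |s| ^ p))
    {u : ℕ → EnergySpace α V} {v : EnergySpace α V}
    (h2 : Tendsto (fun n => (u n).toL2) atTop (𝓝 v.toL2))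
    (hpt : Tendsto (fun n => ∫ x, |(u n - v).toL2 x| ^ p) atTop (𝓝 0)) :
    Tendsto (fun n => ∫ x, H x ((u n).toL2 x)) atTop (𝓝 (∫ x, H x (v.toL2 x))) := by
  obtain ⟨S, hS, hSb⟩ := hemb
  have hp0 : 0 < p := by linarith
  have hi2 : ∀ w : EnergySpace α V, Integrable (fun x => |w.toL2 x| ^ 2) := fun w =>
    integrable_norm_sq w.toL2
  have hi : ∀ w : EnergySpace α V, Integrable
      (fun x => C * (2 * |w.toL2 x| ^ 2 + 2 ^ p * |w.toL2 x| ^ p)) := fun w =>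
    (((hi2 w).const_mul 2).add ((hSb w).1.const_mul _)).const_mul C
  have hD : ∀ n, (fun x => C * (2 * |(u n - v).toL2 x| ^ 2 + 2 ^ p * |(u n - v).toL2 x| ^ p))
      =ᵐ[volume] fun x => C * (2 * |(u n).toL2 x - v.toL2 x| ^ 2 +
        2 ^ p * |(u n).toL2 x - v.toL2 x| ^ p) := fun n => by
    filter_upwards [toL2_sub_ae (u n) v] with x hx
    rw [hx]
  refine tendsto_integral_comp (D := fun s => C * (2 * |s| ^ 2 + 2 ^ p * |s| ^ p))
    (B := fun x => C * (2 * |v.toL2 x| ^ 2 + 2 ^ p * |v.toL2 x| ^ p))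
    (tendstoInMeasure_of_tendsto_Lp h2)
    (fun n => (measurable_superposition hm (measurable_toL2 _)).aestronglyMeasurable)
    (Eventually.of_forall fun x => (hc x).continuousAt) (fun s => by positivity)
    (by rw [abs_zero, Real.zero_rpow hp0.ne']; simp) ?_ (hi v) (fun n => (hi (u n - v)).congr (hD n))
    ?_
  · filter_upwards [hH] with x hx s
    refine (hx s).trans ?_
    have h3 : |s| ≤ |s - v.toL2 x| + |v.toL2 x| := by
      have := abs_add_le (s - v.toL2 x) (v.toL2 x)
      rwa [sub_add_cancel] at this
    have h4 : |s| ^ p ≤ 2 ^ p * (|s - v.toL2 x| ^ p + |v.toL2 x| ^ p) :=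
      (Real.rpow_le_rpow (abs_nonneg _) h3 hp0.le).trans
        (add_rpow_le_two_rpow_mul (abs_nonneg _) (abs_nonneg _) hp0.le)
    have h5 : |s| ^ 2 ≤ 2 * |s - v.toL2 x| ^ 2 + 2 * |v.toL2 x| ^ 2 := by
      nlinarith [sq_nonneg (|s - v.toL2 x| - |v.toL2 x|), abs_nonneg s]
    rw [← mul_add]
    refine mul_le_mul_of_nonneg_left ?_ hC.le
    linarith
  · have h6 : Tendsto (fun n => C * (2 * ‖(u n).toL2 - v.toL2‖ ^ 2 +
        2 ^ p * ∫ x, |(u n - v).toL2 x| ^ p)) atTop (𝓝 0) := by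
      rw [tendsto_iff_norm_sub_tendsto_zero] at h2
      simpa using (((h2.pow 2).const_mul 2).add (hpt.const_mul (2 ^ p))).const_mul C
    refine h6.congr fun n => ?_
    rw [← integral_congr_ae (hD n), integral_const_mul, integral_add ((hi2 _).const_mul 2)
      ((hSb _).1.const_mul _), integral_const_mul, integral_const_mul, norm_sq_eq_integral,
      ← toL2_sub]
    rfl

/-! ### Minimization on the Nehari manifold -/

section Nehari

variable {E : Type*} [NormedAddCommGroup E] [InnerProductSpace ℝ E] {Ψ : E → ℝ}
  {A : E → (E →L[ℝ] ℝ)} {p q C : ℝ}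

/-- The functional `J(u) = ½‖u‖² - Ψ(u)`. -/
noncomputable def quadraticSub (Ψ : E → ℝ) (u : E) : ℝ := 1 / 2 * ‖u‖ ^ 2 - Ψ u

theorem hasFDerivAt_quadraticSub (hΨ : ∀ u, HasFDerivAt Ψ (A u) u) (u : E) :
    HasFDerivAt (quadraticSub Ψ) (innerSL ℝ u - A u) u := by
  have h := ((hasStrictFDerivAt_norm_sq u).hasFDerivAt.const_mul (1 / 2 : ℝ)).sub (hΨ u)
  refine h.congr_fderiv ?_
  ext v
  simp

theorem mem_nehariManifold_iff (hΨ : ∀ u, HasFDerivAt Ψ (A u) u) (u : E) :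
    u ∈ nehariManifold (quadraticSub Ψ) ↔ u ≠ 0 ∧ A u u = ‖u‖ ^ 2 := by
  have h := hasFDerivAt_quadraticSub hΨ u
  have h1 : fderiv ℝ (quadraticSub Ψ) u u = ‖u‖ ^ 2 - A u u := by
    rw [h.fderiv, sub_apply, innerSL_apply_apply, real_inner_self_eq_norm_sq]
  constructor
  · rintro ⟨h0, -, h2⟩
    exact ⟨h0, by linarith⟩
  · rintro ⟨h0, h2⟩
    exact ⟨h0, h.differentiableAt, by linarith⟩

theorem hasDerivAt_line {J : E → ℝ} {D : E → (E →L[ℝ] ℝ)} (hJ : ∀ u, HasFDerivAt J (D u) u)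
    (u v : E) (t : ℝ) : HasDerivAt (fun t : ℝ => J (u + t • v)) (D (u + t • v) v) t := by
  have h2 : HasDerivAt (fun t : ℝ => u + t • v) v t := by
    simpa using ((hasDerivAt_id t).smul_const v).const_add u
  exact (hJ (u + t • v)).comp_hasDerivAt t h2

theorem hasDerivAt_ray {J : E → ℝ} {D : E → (E →L[ℝ] ℝ)} (hJ : ∀ u, HasFDerivAt J (D u) u)
    (u : E) (t : ℝ) : HasDerivAt (fun t : ℝ => J (t • u)) (D (t • u) u) t := by
  simpa using hasDerivAt_line hJ 0 u t

/-- `qΨ(u) ≤ Ψ'(u)u`: the monotonicity of `t ↦ Ψ'(tu)u / t^(q-1)`, integrated over `[0, 1]`. -/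
theorem mul_le_deriv_apply (hΨ : ∀ u, HasFDerivAt Ψ (A u) u) (hΨ0 : Ψ 0 = 0) (hq : 2 < q)
    (hmono : ∀ u t t', 0 < t → t ≤ t' → A (t • u) u / t ^ (q - 1) ≤ A (t' • u) u / t' ^ (q - 1))
    (u : E) : q * Ψ u ≤ A u u := by
  have hd : ∀ t : ℝ, HasDerivAt (fun t : ℝ => A u u * (t ^ q / q) - Ψ (t • u))
      (A u u * t ^ (q - 1) - A (t • u) u) t := fun t => by
    have h1 := ((Real.hasDerivAt_rpow_const (x := t) (p := q) (Or.inr (by linarith))).div_const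
      q).const_mul (A u u)
    refine (h1.sub (hasDerivAt_ray hΨ u t)).congr_deriv ?_
    field_simp
  have hm : MonotoneOn (fun t : ℝ => A u u * (t ^ q / q) - Ψ (t • u)) (Set.Icc 0 1) := by
    refine monotoneOn_of_deriv_nonneg (convex_Icc 0 1)
      (fun t _ => (hd t).continuousAt.continuousWithinAt)
      (fun t _ => (hd t).differentiableAt.differentiableWithinAt) fun t ht => ?_
    rw [interior_Icc] at ht
    rw [(hd t).deriv]
    have h2 := hmono u t 1 ht.1 ht.2.le
    rw [Real.one_rpow, div_one, one_smul, div_le_iff₀ (Real.rpow_pos_of_pos ht.1 _)] at h2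
    linarith
  have h3 := hm (Set.left_mem_Icc.2 zero_le_one) (Set.right_mem_Icc.2 zero_le_one) zero_le_one
  simp only [zero_smul, one_smul, hΨ0, Real.one_rpow, Real.zero_rpow (by linarith : q ≠ 0)] at h3
  have h4 : Ψ u ≤ A u u / q := by
    rw [zero_div, mul_zero, mul_one_div] at h3
    linarith
  rw [le_div_iff₀ (by linarith)] at h4
  linarith

/-- On the ray through a point of the Nehari manifold, the derivative of the functional is positive
before that point and negative after it. -/
theorem deriv_ray_sign (hq : 2 < q)
    (hmono : ∀ u t t', 0 < t → t ≤ t' → A (t • u) u / t ^ (q - 1) ≤ A (t' • u) u / t' ^ (q - 1))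
    {w : E} (hw : w ≠ 0) (hAw : A w w = ‖w‖ ^ 2) {t : ℝ} (ht : 0 < t) :
    (t < 1 → A (t • w) w < t * ‖w‖ ^ 2) ∧ (1 < t → t * ‖w‖ ^ 2 < A (t • w) w) := by
  have hw2 : 0 < ‖w‖ ^ 2 := by positivity
  constructor
  · intro h
    have h2 := hmono w t 1 ht h.le
    rw [Real.one_rpow, div_one, one_smul, div_le_iff₀ (Real.rpow_pos_of_pos ht _), hAw] at h2
    have h3 : t ^ (q - 1) < t ^ (1 : ℝ) := Real.rpow_lt_rpow_of_exponent_gt ht h (by linarith)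
    rw [Real.rpow_one] at h3
    nlinarith
  · intro h
    have h2 := hmono w 1 t one_pos h.le
    rw [Real.one_rpow, div_one, one_smul, le_div_iff₀ (Real.rpow_pos_of_pos ht _), hAw] at h2
    have h3 : t ^ (1 : ℝ) < t ^ (q - 1) := Real.rpow_lt_rpow_of_exponent_lt h (by linarith)
    rw [Real.rpow_one] at h3
    nlinarith

theorem inner_smul_self_sub (A : E → (E →L[ℝ] ℝ)) (w : E) (t : ℝ) :
    (innerSL ℝ (t • w) - A (t • w)) w = t * ‖w‖ ^ 2 - A (t • w) w := by
  rw [sub_apply, innerSL_apply_apply, real_inner_smul_left,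
    real_inner_self_eq_norm_sq]

/-- The functional attains its maximum along a ray at the point of the Nehari manifold. -/
theorem quadraticSub_smul_le (hΨ : ∀ u, HasFDerivAt Ψ (A u) u) (hq : 2 < q)
    (hmono : ∀ u t t', 0 < t → t ≤ t' → A (t • u) u / t ^ (q - 1) ≤ A (t' • u) u / t' ^ (q - 1))
    {w : E} (hw : w ≠ 0) (hAw : A w w = ‖w‖ ^ 2) {t : ℝ} (ht : 0 < t) :
    quadraticSub Ψ (t • w) ≤ quadraticSub Ψ w := by
  have hd := hasDerivAt_ray (hasFDerivAt_quadraticSub hΨ) w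
  rcases le_total t 1 with h | h
  · have hm : MonotoneOn (fun t : ℝ => quadraticSub Ψ (t • w)) (Set.Icc 0 1) := by
      refine monotoneOn_of_deriv_nonneg (convex_Icc 0 1)
        (fun t _ => (hd t).continuousAt.continuousWithinAt)
        (fun t _ => (hd t).differentiableAt.differentiableWithinAt) fun t ht => ?_
      rw [interior_Icc] at ht
      rw [(hd t).deriv, inner_smul_self_sub]
      linarith [(deriv_ray_sign hq hmono hw hAw ht.1).1 ht.2]
    simpa using hm ⟨ht.le, h⟩ (Set.right_mem_Icc.2 zero_le_one) h
  · have hm : AntitoneOn (fun t : ℝ => quadraticSub Ψ (t • w)) (Set.Ici 1) := by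
      refine antitoneOn_of_deriv_nonpos (convex_Ici 1)
        (fun t _ => (hd t).continuousAt.continuousWithinAt)
        (fun t _ => (hd t).differentiableAt.differentiableWithinAt) fun t ht => ?_
      rw [interior_Ici] at ht
      rw [(hd t).deriv, inner_smul_self_sub]
      linarith [(deriv_ray_sign hq hmono hw hAw (one_pos.trans ht)).2 ht]
    simpa using hm Set.self_mem_Ici h h

/-- The Nehari manifold stays away from the origin. -/
theorem exists_pos_deriv_lt (hp : 2 < p) (hC : 0 < C)
    (hsmall : ∀ u, A u u ≤ 1 / 2 * ‖u‖ ^ 2 + C * ‖u‖ ^ p) :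
    ∃ ρ > 0, ∀ u, u ≠ 0 → ‖u‖ ≤ ρ → A u u < ‖u‖ ^ 2 := by
  refine ⟨(1 / (4 * C)) ^ (1 / (p - 2)), by positivity, fun u hu hρ => ?_⟩
  have hu0 : 0 < ‖u‖ := norm_pos_iff.2 hu
  have h1 : ‖u‖ ^ (p - 2) ≤ 1 / (4 * C) := by
    have := Real.rpow_le_rpow hu0.le hρ (by linarith : 0 ≤ p - 2)
    rwa [← Real.rpow_mul (by positivity), one_div_mul_cancel (by linarith), Real.rpow_one] at this
  have h2 : ‖u‖ ^ p = ‖u‖ ^ (p - 2) * ‖u‖ ^ 2 := by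
    rw [← Real.rpow_natCast ‖u‖ 2, ← Real.rpow_add hu0]
    congr 1; push_cast; ring
  have h3 : C * ‖u‖ ^ p ≤ 1 / 4 * ‖u‖ ^ 2 := by
    rw [h2, ← mul_assoc]
    refine mul_le_mul_of_nonneg_right ?_ (by positivity)
    calc C * ‖u‖ ^ (p - 2) ≤ C * (1 / (4 * C)) := by gcongr
      _ = 1 / 4 := by field_simp
  have h4 : 0 < ‖u‖ ^ 2 := by positivity
  linarith [hsmall u]

/-- Every ray from the origin meets the Nehari manifold. -/
theorem exists_smul_mem_nehariManifold (hA : Continuous A) (hΨ : ∀ u, HasFDerivAt Ψ (A u) u)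
    (hΨ0 : Ψ 0 = 0) {ρ : ℝ} (hρ : 0 < ρ) (hρA : ∀ u, u ≠ 0 → ‖u‖ ≤ ρ → A u u < ‖u‖ ^ 2)
    {u : E} (hu : u ≠ 0) (hsuper : ∃ T > (0 : ℝ), quadraticSub Ψ (T • u) < 0) :
    ∃ t > (0 : ℝ), t • u ∈ nehariManifold (quadraticSub Ψ) := by
  have hu0 : 0 < ‖u‖ := norm_pos_iff.2 hu
  have hd := hasDerivAt_ray (hasFDerivAt_quadraticSub hΨ) u
  obtain ⟨T, hT, hJT⟩ := hsuper
  obtain ⟨c, hc, hc'⟩ := exists_hasDerivAt_eq_slope (fun t : ℝ => quadraticSub Ψ (t • u)) _ hT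
    (fun t _ => (hd t).continuousAt.continuousWithinAt) (fun t _ => hd t)
  have hJ0 : quadraticSub Ψ ((0 : ℝ) • u) = 0 := by simp [quadraticSub, hΨ0]
  have hcneg : c * ‖u‖ ^ 2 - A (c • u) u < 0 := by
    rw [← inner_smul_self_sub, hc', hJ0, sub_zero, sub_zero]
    exact div_neg_of_neg_of_pos hJT hT
  set t₁ := min (ρ / ‖u‖) c with ht₁
  have ht₁0 : 0 < t₁ := lt_min (by positivity) hc.1
  have hpos : 0 < t₁ * ‖u‖ ^ 2 - A (t₁ • u) u := by
    have h1 : ‖t₁ • u‖ ≤ ρ := by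
      rw [norm_smul, Real.norm_of_nonneg ht₁0.le, ← le_div_iff₀ hu0]
      exact min_le_left _ _
    have h2 := hρA (t₁ • u) (smul_ne_zero ht₁0.ne' hu) h1
    rw [map_smul, smul_eq_mul, norm_smul, Real.norm_of_nonneg ht₁0.le, mul_pow] at h2
    have h3 : t₁ * A (t₁ • u) u < t₁ * (t₁ * ‖u‖ ^ 2) := by linarith
    linarith [lt_of_mul_lt_mul_left h3 ht₁0.le]
  have hcont : Continuous fun t : ℝ => t * ‖u‖ ^ 2 - A (t • u) u :=
    (continuous_id.mul continuous_const).sub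
      ((hA.comp (continuous_id.smul continuous_const)).clm_apply continuous_const)
  obtain ⟨s, hs, hs0⟩ := intermediate_value_Icc' (min_le_right (ρ / ‖u‖) c) hcont.continuousOn
    ⟨hcneg.le, hpos.le⟩
  have hs1 : 0 < s := ht₁0.trans_le hs.1
  refine ⟨s, hs1, (mem_nehariManifold_iff hΨ _).2 ⟨smul_ne_zero hs1.ne' hu, ?_⟩⟩
  have hs0' : s * ‖u‖ ^ 2 - A (s • u) u = 0 := hs0
  rw [map_smul, smul_eq_mul, norm_smul, Real.norm_of_nonneg hs1.le, mul_pow]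
  have : A (s • u) u = s * ‖u‖ ^ 2 := by linarith
  rw [this]; ring

/-- A minimizer on the Nehari manifold is a critical point. If the derivative in the direction `v`
were negative, then a point of the Nehari manifold with smaller energy would be found on one of the
segments `s ↦ s w + ε v`, by the intermediate value theorem. -/
theorem deriv_eq_zero_of_minimizer (hA : Continuous A) (hΨ : ∀ u, HasFDerivAt Ψ (A u) u)
    (hq : 2 < q)
    (hmono : ∀ u t t', 0 < t → t ≤ t' → A (t • u) u / t ^ (q - 1) ≤ A (t' • u) u / t' ^ (q - 1))
    {w : E} (hw : w ∈ nehariManifold (quadraticSub Ψ))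
    (hmin : ∀ v ∈ nehariManifold (quadraticSub Ψ), quadraticSub Ψ w ≤ quadraticSub Ψ v) :
    innerSL ℝ w - A w = 0 := by
  by_contra hne
  obtain ⟨hw0, hAw⟩ := (mem_nehariManifold_iff hΨ w).1 hw
  set D : E → (E →L[ℝ] ℝ) := fun u => innerSL ℝ u - A u with hD
  have hDc : Continuous D := (innerSL ℝ).continuous.sub hA
  have hJ : ∀ u, HasFDerivAt (quadraticSub Ψ) (D u) u := hasFDerivAt_quadraticSub hΨ
  obtain ⟨v, hv⟩ : ∃ v, D w v = -1 := by
    obtain ⟨v₀, hv₀⟩ := DFunLike.ne_iff.1 hne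
    have hv₀' : D w v₀ ≠ 0 := hv₀
    refine ⟨-(D w v₀)⁻¹ • v₀, ?_⟩
    rw [map_smul, smul_eq_mul, neg_mul, inv_mul_cancel₀ hv₀']
  have hDww : D w w = 0 := by
    simp only [hD, sub_apply, innerSL_apply_apply, real_inner_self_eq_norm_sq, hAw, sub_self]
  -- the derivative in the direction `v` stays negative near `w`
  obtain ⟨δ, hδ, hδD⟩ : ∃ δ > 0, ∀ s ε : ℝ, |s - 1| < δ → |ε| < δ →
      D (s • w + ε • v) v < -(1 / 2) := by
    have hc : Continuous fun z : ℝ × ℝ => D (z.1 • w + z.2 • v) v :=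
      (hDc.comp ((continuous_fst.smul continuous_const).add
        (continuous_snd.smul continuous_const))).clm_apply continuous_const
    have h1 : ∀ᶠ z : ℝ × ℝ in 𝓝 (1, 0), D (z.1 • w + z.2 • v) v < -(1 / 2) := by
      refine hc.continuousAt.eventually_lt continuousAt_const ?_
      simp only [one_smul, zero_smul, add_zero, hv]
      norm_num
    obtain ⟨δ, hδ, h2⟩ := Metric.eventually_nhds_iff.1 h1
    refine ⟨δ, hδ, fun s ε hs hε => @h2 (s, ε) ?_⟩
    rw [Prod.dist_eq, max_lt_iff, Real.dist_eq, Real.dist_eq, sub_zero]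
    exact ⟨hs, hε⟩
  set η := min (δ / 2) (1 / 2) with hη
  have hη0 : 0 < η := lt_min (by positivity) (by norm_num)
  have hηδ : η < δ := (min_le_left _ _).trans_lt (by linarith)
  have hη1 : η < 1 := (min_le_right _ _).trans_lt (by norm_num)
  have hQc : Continuous fun z : ℝ × ℝ => D (z.1 • w + z.2 • v) (z.1 • w + z.2 • v) := by
    have h1 : Continuous fun z : ℝ × ℝ => z.1 • w + z.2 • v :=
      (continuous_fst.smul continuous_const).add (continuous_snd.smul continuous_const)
    exact (hDc.comp h1).clm_apply h1
  have hQ : ∀ s : ℝ, D (s • w) (s • w) = s * (s * ‖w‖ ^ 2 - A (s • w) w) := fun s => by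
    rw [← inner_smul_self_sub, map_smul, smul_eq_mul]
  have hplus : 0 < D ((1 - η) • w) ((1 - η) • w) := by
    rw [hQ]
    refine mul_pos (by linarith) ?_
    linarith [(deriv_ray_sign hq hmono hw0 hAw (by linarith : 0 < 1 - η)).1 (by linarith)]
  have hminus : D ((1 + η) • w) ((1 + η) • w) < 0 := by
    rw [hQ]
    refine mul_neg_of_pos_of_neg (by linarith) ?_
    linarith [(deriv_ray_sign hq hmono hw0 hAw (by linarith : 0 < 1 + η)).2 (by linarith)]
  obtain ⟨ε, hε0, hεδ, hεp, hεm⟩ : ∃ ε > 0, ε < δ ∧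
      0 < D ((1 - η) • w + ε • v) ((1 - η) • w + ε • v) ∧
      D ((1 + η) • w + ε • v) ((1 + η) • w + ε • v) < 0 := by
    have hcs : ∀ s : ℝ, Continuous fun ε : ℝ => D (s • w + ε • v) (s • w + ε • v) := fun s =>
      hQc.comp (continuous_const.prodMk continuous_id)
    have h1 : ∀ᶠ ε : ℝ in 𝓝 0, 0 < D ((1 - η) • w + ε • v) ((1 - η) • w + ε • v) := by
      refine continuousAt_const.eventually_lt (hcs _).continuousAt ?_
      simpa using hplus
    have h2 : ∀ᶠ ε : ℝ in 𝓝 0, D ((1 + η) • w + ε • v) ((1 + η) • w + ε • v) < 0 := by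
      refine (hcs _).continuousAt.eventually_lt continuousAt_const ?_
      simpa using hminus
    obtain ⟨κ, hκ, h3⟩ := Metric.eventually_nhds_iff.1 (h1.and h2)
    have hm : 0 < min (κ / 2) (δ / 2) := lt_min (by positivity) (by positivity)
    have h4 := @h3 (min (κ / 2) (δ / 2)) (by
      rw [Real.dist_eq, sub_zero, abs_of_pos hm]
      exact (min_le_left _ _).trans_lt (by linarith))
    exact ⟨_, hm, (min_le_right _ _).trans_lt (by linarith), h4.1, h4.2⟩
  obtain ⟨s, hs, hs0⟩ := intermediate_value_Icc' (by linarith : 1 - η ≤ 1 + η)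
    (hQc.comp (continuous_id.prodMk continuous_const : Continuous fun s : ℝ => (s, ε))).continuousOn
    ⟨hεm.le, hεp.le⟩
  have hs0' : D (s • w + ε • v) (s • w + ε • v) = 0 := hs0
  have hspos : 0 < s := by linarith [hs.1]
  have hsδ : |s - 1| < δ := by
    rw [abs_lt]; constructor <;> linarith [hs.1, hs.2]
  have hzne : s • w + ε • v ≠ 0 := fun h => by
    have h1 : D w (s • w + ε • v) = 0 := by rw [h, map_zero]
    rw [map_add, map_smul, map_smul, hDww, hv] at h1
    simp only [smul_eq_mul] at h1
    linarith
  have hzN : s • w + ε • v ∈ nehariManifold (quadraticSub Ψ) :=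
    ⟨hzne, (hJ _).differentiableAt, by rw [(hJ _).fderiv]; exact hs0'⟩
  have hd := hasDerivAt_line hJ (s • w) v
  obtain ⟨e, he, he'⟩ := exists_hasDerivAt_eq_slope
    (fun t : ℝ => quadraticSub Ψ (s • w + t • v)) _ hε0
    (fun t _ => (hd t).continuousAt.continuousWithinAt) (fun t _ => hd t)
  have h1 := hδD s e hsδ (by rw [abs_of_pos he.1]; exact he.2.trans hεδ)
  rw [he', zero_smul, add_zero, sub_zero, div_lt_iff₀ hε0] at h1
  have h2 := quadraticSub_smul_le hΨ hq hmono hw0 hAw hspos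
  have h3 := hmin _ hzN
  linarith

/-- Existence of a ground state for a functional `½‖u‖² - Ψ(u)`, where `Ψ` is `C¹`, is
superquadratic along rays and is continuous in the sense of the compactness assumption `hcomp`. -/
theorem exists_isGroundState [Nontrivial E] (hA : Continuous A)
    (hΨ : ∀ u, HasFDerivAt Ψ (A u) u) (hΨ0 : Ψ 0 = 0) (hq : 2 < q) (hp : 2 < p) (hC : 0 < C)
    (hmono : ∀ u t t', 0 < t → t ≤ t' → A (t • u) u / t ^ (q - 1) ≤ A (t' • u) u / t' ^ (q - 1))
    (hsmall : ∀ u, A u u ≤ 1 / 2 * ‖u‖ ^ 2 + C * ‖u‖ ^ p)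
    (hsuper : ∀ u, u ≠ 0 → ∃ T > (0 : ℝ), quadraticSub Ψ (T • u) < 0)
    (hcomp : ∀ (u : ℕ → E) (M : ℝ), (∀ n, ‖u n‖ ≤ M) → ∃ (φ : ℕ → ℕ) (v : E) (l : ℝ),
      StrictMono φ ∧ Tendsto (fun n => ‖u (φ n)‖) atTop (𝓝 l) ∧ ‖v‖ ≤ l ∧
      (∀ t : ℝ, Tendsto (fun n => Ψ (t • u (φ n))) atTop (𝓝 (Ψ (t • v)))) ∧
      Tendsto (fun n => A (u (φ n)) (u (φ n))) atTop (𝓝 (A v v))) :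
    ∃ u, IsGroundState (quadraticSub Ψ) u := by
  obtain ⟨ρ, hρ, hρA⟩ := exists_pos_deriv_lt hp hC hsmall
  have hq0 : 0 < q := by linarith
  set κ : ℝ := 1 / 2 - 1 / q with hκ
  have hκ0 : 0 < κ := by
    rw [hκ, sub_pos]
    exact one_div_lt_one_div_of_lt two_pos hq
  -- coercivity on the Nehari manifold
  have hcoer : ∀ u ∈ nehariManifold (quadraticSub Ψ), κ * ‖u‖ ^ 2 ≤ quadraticSub Ψ u := fun u hu => by
    obtain ⟨-, h1⟩ := (mem_nehariManifold_iff hΨ u).1 hu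
    have h2 := mul_le_deriv_apply hΨ hΨ0 hq hmono u
    rw [h1] at h2
    have h3 : Ψ u ≤ ‖u‖ ^ 2 / q := by rw [le_div_iff₀ hq0]; linarith
    rw [quadraticSub, hκ, sub_mul, one_div_mul_eq_div q]
    linarith
  set S := quadraticSub Ψ '' nehariManifold (quadraticSub Ψ) with hS
  have hSne : S.Nonempty := by
    obtain ⟨u, hu⟩ := exists_ne (0 : E)
    obtain ⟨t, -, ht⟩ := exists_smul_mem_nehariManifold hA hΨ hΨ0 hρ hρA hu (hsuper u hu)
    exact ⟨_, _, ht, rfl⟩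
  have hSbdd : BddBelow S := by
    refine ⟨0, ?_⟩
    rintro _ ⟨u, hu, rfl⟩
    exact le_trans (by positivity) (hcoer u hu)
  obtain ⟨y, -, hy, hyS⟩ := exists_seq_tendsto_sInf hSne hSbdd
  choose u huN huy using hyS
  obtain ⟨Y, hY⟩ := hy.bddAbove_range
  have hbound : ∀ n, ‖u n‖ ≤ √(Y / κ) := fun n => by
    refine Real.le_sqrt_of_sq_le ?_
    rw [le_div_iff₀ hκ0, mul_comm]
    refine (hcoer _ (huN n)).trans ?_
    rw [huy]
    exact hY ⟨n, rfl⟩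
  obtain ⟨φ, v, l, hφ, hl, hvl, hΨt, hAt⟩ := hcomp u _ hbound
  have hlow : ∀ n, ρ < ‖u n‖ := fun n => by
    by_contra h
    obtain ⟨h0, h1⟩ := (mem_nehariManifold_iff hΨ _).1 (huN n)
    exact (hρA _ h0 (not_lt.1 h)).ne h1
  have hv0 : v ≠ 0 := by
    rintro rfl
    have h1 : ρ ^ 2 ≤ A 0 (0 : E) := by
      refine ge_of_tendsto' hAt fun n => ?_
      rw [((mem_nehariManifold_iff hΨ _).1 (huN (φ n))).2]
      exact pow_le_pow_left₀ hρ.le (hlow _).le 2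
    rw [map_zero] at h1
    have : 0 < ρ ^ 2 := by positivity
    linarith
  obtain ⟨t, ht, htN⟩ := exists_smul_mem_nehariManifold hA hΨ hΨ0 hρ hρA hv0 (hsuper v hv0)
  -- the projection of the limit to the Nehari manifold has at most the limit energy, since the
  -- energy of `u n` is maximal on its ray
  have hle : quadraticSub Ψ (t • v) ≤ sInf S := by
    have h1 : Tendsto (fun n => quadraticSub Ψ (t • u (φ n))) atTop
        (𝓝 (1 / 2 * (t * l) ^ 2 - Ψ (t • v))) := by
      refine Tendsto.sub ?_ (hΨt t)
      refine (((hl.const_mul t).pow 2).const_mul (1 / 2)).congr fun n => ?_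
      rw [norm_smul, Real.norm_of_nonneg ht.le]
    have h2 : 1 / 2 * (t * l) ^ 2 - Ψ (t • v) ≤ sInf S := by
      refine le_of_tendsto_of_tendsto' h1 (hy.comp hφ.tendsto_atTop) fun n => ?_
      obtain ⟨h0, h3⟩ := (mem_nehariManifold_iff hΨ _).1 (huN (φ n))
      refine (quadraticSub_smul_le hΨ hq hmono h0 h3 ht).trans_eq (huy _)
    refine le_trans ?_ h2
    rw [quadraticSub, norm_smul, Real.norm_of_nonneg ht.le]
    gcongr
  have hmin : ∀ z ∈ nehariManifold (quadraticSub Ψ), quadraticSub Ψ (t • v) ≤ quadraticSub Ψ z :=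
    fun z hz => hle.trans (csInf_le hSbdd ⟨z, hz, rfl⟩)
  refine ⟨t • v, htN.1, ?_, ⟨_, htN, rfl⟩, ?_⟩
  · have h := hasFDerivAt_quadraticSub hΨ (t • v)
    rwa [deriv_eq_zero_of_minimizer hA hΨ hq hmono htN hmin] at h
  · rintro _ ⟨z, hz, rfl⟩
    exact hmin z hz

end Nehari

/-! ### The weak gradient -/

/-- A real-valued test function, seen as a complex-valued Schwartz function. -/
noncomputable def toSchwartz {φ : Space N → ℝ} (hφ : ContDiff ℝ ∞ φ) (hc : HasCompactSupport φ) :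
    SchwartzMap (Space N) ℂ :=
  HasCompactSupport.toSchwartzMap (f := fun x => (φ x : ℂ)) (hc.comp_left Complex.ofReal_zero)
    (Complex.ofRealCLM.contDiff.comp hφ)

theorem toSchwartz_apply {φ : Space N → ℝ} (hφ : ContDiff ℝ ∞ φ) (hc : HasCompactSupport φ)
    (x : Space N) : toSchwartz hφ hc x = (φ x : ℂ) := rfl

theorem lineDeriv_toSchwartz_apply {φ : Space N → ℝ} (hφ : ContDiff ℝ ∞ φ)
    (hc : HasCompactSupport φ) (m x : Space N) :
    LineDeriv.lineDerivOp m (toSchwartz hφ hc) x = (fderiv ℝ φ x m : ℂ) := by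
  rw [SchwartzMap.lineDerivOp_apply_eq_fderiv]
  have h1 : HasFDerivAt φ (fderiv ℝ φ x) x :=
    (hφ.differentiable (by simp)).differentiableAt.hasFDerivAt
  have h2 : HasFDerivAt (toSchwartz hφ hc) (Complex.ofRealCLM.comp (fderiv ℝ φ x)) x :=
    Complex.ofRealCLM.hasFDerivAt.comp x h1
  rw [h2.fderiv]
  rfl

theorem fourier_lineDeriv_toSchwartz_apply {φ : Space N → ℝ} (hφ : ContDiff ℝ ∞ φ)
    (hc : HasCompactSupport φ) (i : Fin N) (η : Space N) :
    (𝓕 (LineDeriv.lineDerivOp (EuclideanSpace.single i (1 : ℝ)) (toSchwartz hφ hc)) :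
      SchwartzMap (Space N) ℂ) η =
      2 * Real.pi * Complex.I * (η i : ℂ) * (𝓕 (toSchwartz hφ hc) : SchwartzMap (Space N) ℂ) η := by
  rw [SchwartzMap.fourier_lineDerivOp_eq]
  have h : (fun x : Space N => inner ℝ x (EuclideanSpace.single i (1 : ℝ))).HasTemperateGrowth := by
    fun_prop
  rw [smul_apply, SchwartzMap.smulLeftCLM_apply_apply h]
  simp [EuclideanSpace.inner_single_right, mul_assoc]

/-- The symbol `2πi η_i 𝓕u(η)` of the `i`-th partial derivative is square-integrable. -/
theorem memLp_derivSymbol {u : RealL2 N}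
    (hu : Integrable (fun η : Space N => (2 * Real.pi * ‖η‖) ^ (2 : ℝ) * ‖fourierL2 u η‖ ^ 2))
    (i : Fin N) :
    MemLp (fun η : Space N => 2 * Real.pi * Complex.I * (η i : ℂ) * fourierL2 u η) 2 volume := by
  have hm : AEStronglyMeasurable
      (fun η : Space N => 2 * Real.pi * Complex.I * (η i : ℂ) * fourierL2 u η) volume := by
    refine AEStronglyMeasurable.mul ?_ (Lp.aestronglyMeasurable _)
    exact Continuous.aestronglyMeasurable (by fun_prop)
  rw [memLp_two_iff_integrable_sq_norm hm]
  refine hu.mono' (hm.norm.pow 2) (Eventually.of_forall fun η => ?_)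
  rw [Real.norm_of_nonneg (by positivity), norm_mul, mul_pow, Real.rpow_two]
  gcongr
  rw [norm_mul, norm_mul, norm_mul, Complex.norm_I, Complex.norm_real, Complex.norm_real,
    Real.norm_of_nonneg Real.pi_pos.le, mul_one]
  have := PiLp.norm_apply_le η i
  gcongr
  simp

theorem integral_fderiv_mul_eq {u : RealL2 N}
    (hu : Integrable (fun η : Space N => (2 * Real.pi * ‖η‖) ^ (2 : ℝ) * ‖fourierL2 u η‖ ^ 2))
    (i : Fin N) {φ : Space N → ℝ} (hφ : ContDiff ℝ ∞ φ) (hc : HasCompactSupport φ) :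
    (∫ x, ((u x * fderiv ℝ φ x (EuclideanSpace.single i 1) : ℝ) : ℂ)) =
      -∫ x, (𝓕⁻ (memLp_derivSymbol hu i).toLp : ComplexL2 N) x * (φ x : ℂ) := by
  set W : ComplexL2 N := (memLp_derivSymbol hu i).toLp with hW
  set Φ := toSchwartz hφ hc with hΦ
  set m : Space N := EuclideanSpace.single i 1 with hm
  have h1 : (∫ x, ((u x * fderiv ℝ φ x m : ℝ) : ℂ)) =
      inner ℂ ((LineDeriv.lineDerivOp m Φ).toLp 2 volume) (toComplexL2 u) := by
    rw [L2.inner_def]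
    refine integral_congr_ae ?_
    filter_upwards [toComplexL2_coeFn u, (LineDeriv.lineDerivOp m Φ).coeFn_toLp 2 volume] with x h2 h3
    rw [h2, h3, lineDeriv_toSchwartz_apply]
    simp
  have h4 : (∫ x, (𝓕⁻ W : ComplexL2 N) x * (φ x : ℂ)) = inner ℂ (Φ.toLp 2 volume) (𝓕⁻ W) := by
    rw [L2.inner_def]
    refine integral_congr_ae ?_
    filter_upwards [Φ.coeFn_toLp 2 volume] with x h3
    rw [h3, hΦ, toSchwartz_apply]
    simp
  have h5 : 𝓕 (𝓕⁻ W : ComplexL2 N) = W := FourierTransform.fourier_fourierInv_eq W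
  rw [h1, h4, ← Lp.inner_fourier_eq, ← Lp.inner_fourier_eq (Φ.toLp 2 volume), h5,
    SchwartzMap.toLp_fourier_eq, SchwartzMap.toLp_fourier_eq, L2.inner_def, L2.inner_def,
    ← integral_neg]
  refine integral_congr_ae ?_
  filter_upwards [(𝓕 (LineDeriv.lineDerivOp m Φ) : SchwartzMap (Space N) ℂ).coeFn_toLp 2 volume,
    (𝓕 Φ : SchwartzMap (Space N) ℂ).coeFn_toLp 2 volume,
    (memLp_derivSymbol hu i).coeFn_toLp] with η h6 h7 h8
  rw [h6, h7, h8, hm, hΦ, fourier_lineDeriv_toSchwartz_apply]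
  simp only [RCLike.inner_apply, map_mul, Complex.conj_ofReal, Complex.conj_I, map_ofNat,
    fourierL2]
  ring

theorem integral_mul_re_im {G : ComplexL2 N} {φ : Space N → ℝ} (hφ : ContDiff ℝ ∞ φ)
    (hc : HasCompactSupport φ) :
    ∫ x, (G x).re * φ x = (∫ x, G x * (φ x : ℂ)).re ∧
      ∫ x, (G x).im * φ x = (∫ x, G x * (φ x : ℂ)).im := by
  have hi : Integrable (fun x => G x * (φ x : ℂ)) := by
    refine (L2.integrable_inner (𝕜 := ℂ) ((toSchwartz hφ hc).toLp 2 volume) G).congr ?_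
    filter_upwards [(toSchwartz hφ hc).coeFn_toLp 2 volume] with x h3
    rw [h3, toSchwartz_apply]
    simp
  have h1 := Complex.reCLM.integral_comp_comm hi
  have h2 := Complex.imCLM.integral_comp_comm hi
  simp only [Complex.reCLM_apply, Complex.imCLM_apply, Complex.re_mul_ofReal,
    Complex.im_mul_ofReal] at h1 h2
  exact ⟨h1, h2⟩

theorem exists_isL2WeakGradient {u : RealL2 N}
    (hu : Integrable (fun η : Space N => (2 * Real.pi * ‖η‖) ^ (2 : ℝ) * ‖fourierL2 u η‖ ^ 2)) :
    ∃ g, IsL2WeakGradient u g ∧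
      ∫ x, ‖g x‖ ^ 2 = ∫ η : Space N, (2 * Real.pi * ‖η‖) ^ (2 : ℝ) * ‖fourierL2 u η‖ ^ 2 := by
  set W : Fin N → ComplexL2 N := fun i => (memLp_derivSymbol hu i).toLp with hW
  set G : Fin N → ComplexL2 N := fun i => 𝓕⁻ (W i) with hG
  have hid : ∀ (i : Fin N) (φ : Space N → ℝ), ContDiff ℝ ∞ φ → HasCompactSupport φ →
      (((∫ x, u x * fderiv ℝ φ x (EuclideanSpace.single i 1) : ℝ)) : ℂ) =
        -∫ x, G i x * (φ x : ℂ) := fun i φ hφ hc => by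
    rw [← integral_fderiv_mul_eq hu i hφ hc, integral_complex_ofReal]
  have hG2 : ∀ i, MemLp (fun x => (G i x).re) 2 volume := fun i => (Lp.memLp (G i)).re
  have him : ∀ i, ∀ᵐ x, (G i x).im = 0 := fun i => by
    refine ae_eq_zero_of_integral_contDiff_smul_eq_zero
      ((Lp.memLp (G i)).im.locallyIntegrable (by norm_num)) fun φ hφ hc => ?_
    have h1 := congrArg Complex.im (hid i φ hφ hc)
    rw [Complex.ofReal_im, Complex.neg_im, ← (integral_mul_re_im hφ hc).2] at h1
    simp_rw [smul_eq_mul, mul_comm (φ _)]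
    exact (neg_eq_zero.1 h1.symm)
  set g : Space N → Space N := fun x => ∑ i, (G i x).re • EuclideanSpace.single i (1 : ℝ) with hg
  have hgi : ∀ x i, g x i = (G i x).re := fun x i => by
    simp [hg, Finset.sum_apply, Pi.single_apply]
  refine ⟨g, ⟨?_, fun φ hφ hc i => ?_⟩, ?_⟩
  · refine memLp_finsetSum _ fun i _ => ?_
    exact (ContinuousLinearMap.toSpanSingleton ℝ
      (EuclideanSpace.single i (1 : ℝ) : Space N)).comp_memLp' (hG2 i)
  · have h1 := congrArg Complex.re (hid i φ hφ hc)
    rw [Complex.ofReal_re, Complex.neg_re, ← (integral_mul_re_im hφ hc).1] at h1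
    rw [h1]
    simp_rw [hgi]
  · have h1 : ∫ x, ‖g x‖ ^ 2 = ∫ x, ∑ i, ‖G i x‖ ^ 2 := by
      refine integral_congr_ae ?_
      filter_upwards [ae_all_iff.2 him] with x hx
      rw [EuclideanSpace.norm_sq_eq]
      refine Finset.sum_congr rfl fun i _ => ?_
      rw [hgi, Complex.sq_norm, Complex.normSq_apply, hx i, Real.norm_eq_abs, sq_abs]
      ring
    have h2 : ∀ i, ∫ x, ‖G i x‖ ^ 2 = ∫ η, ‖W i η‖ ^ 2 := fun i => by
      rw [← norm_sq_eq_integral, ← norm_sq_eq_integral, hG, norm_fourierInv_L2]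
    rw [h1, integral_finsetSum _ fun i _ => integrable_norm_sq (G i)]
    simp_rw [h2]
    rw [← integral_finsetSum _ fun i _ => integrable_norm_sq (W i)]
    refine integral_congr_ae ?_
    filter_upwards [ae_all_iff.2 fun i => (memLp_derivSymbol hu i).coeFn_toLp] with η hη
    have h3 : ∀ i, ‖W i η‖ ^ 2 = (2 * Real.pi) ^ 2 * ‖η i‖ ^ 2 * ‖fourierL2 u η‖ ^ 2 := fun i => by
      rw [hW, hη i, norm_mul, norm_mul, norm_mul, norm_mul, Complex.norm_I, Complex.norm_real,
        Complex.norm_real, Real.norm_of_nonneg Real.pi_pos.le, mul_one, Complex.norm_ofNat]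
      ring
    simp_rw [h3]
    rw [← Finset.sum_mul, ← Finset.mul_sum, ← EuclideanSpace.norm_sq_eq, Real.rpow_two]
    ring

theorem IsL2WeakGradient.ae_eq {u : Space N → ℝ} {g g' : Space N → Space N}
    (hg : IsL2WeakGradient u g) (hg' : IsL2WeakGradient u g') : g =ᵐ[volume] g' := by
  have h : ∀ i : Fin N, ∀ᵐ x, g x i = g' x i := fun i => by
    have hL : ∀ g : Space N → Space N, MemLp g 2 volume →
        LocallyIntegrable (fun x => g x i) volume := fun g hg =>
      ((EuclideanSpace.proj i : Space N →L[ℝ] ℝ).comp_memLp' hg).locallyIntegrable (by norm_num)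
    refine ae_eq_of_integral_contDiff_smul_eq (hL g hg.1) (hL g' hg'.1) fun φ hφ hc => ?_
    have h1 := hg.2 φ hφ hc i
    rw [hg'.2 φ hφ hc i] at h1
    simp_rw [smul_eq_mul, mul_comm (φ _)]
    linarith
  filter_upwards [ae_all_iff.2 h] with x hx
  ext i
  exact hx i

theorem dirichletIntegral_eq {u : RealL2 N}
    (hu : Integrable (fun ξ : Space N => ‖ξ‖ ^ (2 : ℝ) * ‖fourierHat u ξ‖ ^ 2)) :
    dirichletIntegral u = ∫ ξ : Space N, ‖ξ‖ ^ (2 : ℝ) * ‖fourierHat u ξ‖ ^ 2 := by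
  obtain ⟨g, hg, hint⟩ := exists_isL2WeakGradient ((integrable_kinetic_iff 2 u).1 hu)
  have hex : ∃ g, IsL2WeakGradient u g := ⟨g, hg⟩
  rw [dirichletIntegral, dif_pos hex, integral_kinetic_eq, ← hint]
  refine integral_congr_ae ?_
  filter_upwards [hex.choose_spec.ae_eq hg] with x hx
  rw [hx]

/-! ### Test functions belong to the energy space -/

theorem integrable_weight_schwartz (hα₀ : 0 < α) (hα₂ : α ≤ 2) (f : SchwartzMap (Space N) ℂ) :
    Integrable (fun η : Space N => (2 * Real.pi * ‖η‖) ^ α * ‖f η‖ ^ 2) := by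
  obtain ⟨C, hC, hfC⟩ := f.decay 0 0
  simp only [pow_zero, one_mul, norm_iteratedFDeriv_zero] at hfC
  have h0 := (f.integrable_pow_mul volume 0).add (f.integrable_pow_mul volume 2)
  refine (h0.const_mul ((2 * Real.pi) ^ α * C)).mono' ?_ (Eventually.of_forall fun η => ?_)
  · have : Measurable (fun η : Space N => (2 * Real.pi * ‖η‖) ^ α) := by fun_prop
    exact this.aestronglyMeasurable.mul (f.continuous.norm.pow 2).aestronglyMeasurable
  · rw [Real.norm_of_nonneg (by positivity), Real.mul_rpow (by positivity) (norm_nonneg _)]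
    have h1 : ‖η‖ ^ α ≤ 1 + ‖η‖ ^ 2 := by
      rcases le_total ‖η‖ 1 with h | h
      · have := Real.rpow_le_one (norm_nonneg η) h hα₀.le
        nlinarith [sq_nonneg ‖η‖]
      · have := Real.rpow_le_rpow_of_exponent_le h hα₂
        rw [Real.rpow_two] at this
        linarith
    have h2 : ‖f η‖ ^ 2 ≤ C * ‖f η‖ := by
      rw [sq]; exact mul_le_mul_of_nonneg_right (hfC η) (norm_nonneg _)
    simp only [Pi.add_apply, pow_zero, one_mul]
    calc (2 * Real.pi) ^ α * ‖η‖ ^ α * ‖f η‖ ^ 2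
        ≤ (2 * Real.pi) ^ α * (1 + ‖η‖ ^ 2) * (C * ‖f η‖) := by gcongr
      _ = _ := by ring

theorem nontrivial_energySpace (hα₀ : 0 < α) (hα₂ : α ≤ 2) (V : CoercivePotential N) :
    Nontrivial (EnergySpace α V) := by
  let b : ContDiffBump (0 : Space N) := ⟨1, 2, one_pos, one_lt_two⟩
  have hb : ContDiff ℝ ∞ b := b.contDiff
  have hc : HasCompactSupport b := b.hasCompactSupport
  have hL : MemLp b 2 volume := b.continuous.memLp_of_hasCompactSupport hc
  set u : RealL2 N := hL.toLp b with hu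
  have hΦ : toComplexL2 u = (toSchwartz hb hc).toLp 2 volume := by
    refine Lp.ext ?_
    filter_upwards [toComplexL2_coeFn u, (toSchwartz hb hc).coeFn_toLp 2 volume,
      hL.coeFn_toLp] with x h1 h2 h3
    rw [h1, h2, h3, toSchwartz_apply]
  have h1 : Integrable (fun η : Space N => (2 * Real.pi * ‖η‖) ^ α * ‖fourierL2 u η‖ ^ 2) := by
    refine (integrable_weight_schwartz hα₀ hα₂
      (𝓕 (toSchwartz hb hc) : SchwartzMap (Space N) ℂ)).congr ?_
    rw [fourierL2, hΦ, SchwartzMap.toLp_fourier_eq]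
    filter_upwards [(𝓕 (toSchwartz hb hc) : SchwartzMap (Space N) ℂ).coeFn_toLp 2 volume] with η h
    rw [h]
  have h2 : Integrable (fun x : Space N => V x * |u x| ^ 2) := by
    have hcs : HasCompactSupport fun x : Space N => V x * |b x| ^ 2 :=
      HasCompactSupport.mul_left (hc.comp_left (g := fun s : ℝ => |s| ^ 2) (by simp))
    refine ((V.continuous_toFun.mul (b.continuous.abs.pow 2)).integrable_of_hasCompactSupport
      hcs).congr ?_
    filter_upwards [hL.coeFn_toLp] with x hx
    rw [hx]
    rfl
  let v : EnergySpace α V := (⟨u, (integrable_kinetic_iff α u).2 h1, h2⟩ : energySubmodule α V)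
  refine ⟨v, 0, fun h => ?_⟩
  have hu0 : u = 0 := congrArg EnergySpace.toL2 h
  have hae : (b : Space N → ℝ) =ᵐ[volume] fun _ => 0 := by
    filter_upwards [hL.coeFn_toLp, (Lp.eq_zero_iff_ae_eq_zero.1 hu0)] with x h3 h4
    rw [← h3]; exact h4
  have h5 := (b.continuous.ae_eq_iff_eq volume continuous_const).1 hae
  have h6 : b 0 = 1 := b.one_of_mem_closedBall (by simp [b])
  rw [h5] at h6
  exact zero_ne_one h6

/-! ### The hypotheses of the minimization argument -/

section Nonlinear

variable {p q : ℝ} {g : Space N → ℝ → ℝ}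

theorem integrable_abs_sq (u : EnergySpace α V) : Integrable (fun x => |u.toL2 x| ^ 2) :=
  integrable_norm_sq u.toL2

theorem integral_abs_sq (u : EnergySpace α V) : ∫ x, |u.toL2 x| ^ 2 = ‖u.toL2‖ ^ 2 :=
  (norm_sq_eq_integral u.toL2).symm

theorem integrable_apply_smul_mul (hg : IsAdmissible p q g) (hp : 2 < p) (hemb : EmbedsInLp α V p)
    (u : EnergySpace α V) (t : ℝ) : Integrable (fun x => g x (t * u.toL2 x) * u.toL2 x) := by
  obtain ⟨C, hC, hgr⟩ := hg.growth
  obtain ⟨S, -, hS⟩ := hemb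
  refine ((((integrable_abs_sq u).const_mul ((|t| + 1) ^ 2)).add
    ((hS u).1.const_mul ((|t| + 1) ^ p))).const_mul C).mono'
    ((measurable_superposition hg.measurable ((measurable_toL2 u).const_mul t)).mul
      (measurable_toL2 u)).aestronglyMeasurable ?_
  filter_upwards [hgr] with x hx
  set s := u.toL2 x
  have hs := abs_nonneg s
  have hm : |t * s| ≤ (|t| + 1) * |s| := by rw [abs_mul]; nlinarith
  have h1 := abs_le_of_growth hp hC hx hm
  rw [mul_pow, Real.mul_rpow (by positivity) hs] at h1
  rw [norm_mul, Real.norm_eq_abs, Real.norm_eq_abs]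
  refine le_trans ?_ h1
  refine mul_le_mul_of_nonneg_left ?_ (abs_nonneg _)
  nlinarith [abs_nonneg t]

theorem apply_smul_eq_integral {A : EnergySpace α V → (EnergySpace α V →L[ℝ] ℝ)}
    (hA : ∀ u h : EnergySpace α V, A u h = ∫ x, g x (u.toL2 x) * h.toL2 x) (u : EnergySpace α V)
    (t : ℝ) : A (t • u) u = ∫ x, g x (t * u.toL2 x) * u.toL2 x := by
  rw [hA]
  refine integral_congr_ae ?_
  filter_upwards [toL2_smul_ae t u] with x hx
  rw [hx]

/-- The monotonicity of `t ↦ Ψ'(tu)u / t^(q-1)`, inherited from that of `g`. -/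
theorem apply_smul_div_le (hg : IsAdmissible p q g) (hp : 2 < p) (hemb : EmbedsInLp α V p)
    {A : EnergySpace α V → (EnergySpace α V →L[ℝ] ℝ)}
    (hA : ∀ u h : EnergySpace α V, A u h = ∫ x, g x (u.toL2 x) * h.toL2 x) (u : EnergySpace α V)
    {t t' : ℝ} (ht : 0 < t) (htt : t ≤ t') :
    A (t • u) u / t ^ (q - 1) ≤ A (t' • u) u / t' ^ (q - 1) := by
  rw [apply_smul_eq_integral hA, apply_smul_eq_integral hA, ← integral_div, ← integral_div]
  refine integral_mono_ae ((integrable_apply_smul_mul hg hp hemb u t).div_const _)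
    ((integrable_apply_smul_mul hg hp hemb u t').div_const _) ?_
  filter_upwards [hg.mono] with x hx
  exact hx _ t t' ht htt

theorem exists_apply_self_le (hg : IsAdmissible p q g) (hp : 2 < p) (hemb : EmbedsInLp α V p)
    {A : EnergySpace α V → (EnergySpace α V →L[ℝ] ℝ)}
    (hA : ∀ u h : EnergySpace α V, A u h = ∫ x, g x (u.toL2 x) * h.toL2 x) :
    ∃ C > 0, ∀ u, A u u ≤ 1 / 2 * ‖u‖ ^ 2 + C * ‖u‖ ^ p := by
  obtain ⟨D, hD, hDu⟩ := exists_norm_toL2_sq_le V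
  obtain ⟨C, hC, hCg⟩ := hg.mul_self_le (1 / (2 * D)) (by positivity)
  have hemb' := hemb
  obtain ⟨S, hS, hSu⟩ := hemb'
  refine ⟨C * S, by positivity, fun u => ?_⟩
  have hi := integrable_apply_smul_mul hg hp hemb u 1
  simp only [one_mul] at hi
  have h1 : A u u ≤ ∫ x, (1 / (2 * D) * |u.toL2 x| ^ 2 + C * |u.toL2 x| ^ p) := by
    rw [hA]
    refine integral_mono_ae hi (((integrable_abs_sq u).const_mul _).add
      ((hSu u).1.const_mul _)) ?_
    filter_upwards [hCg] with x hx
    exact hx _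
  rw [integral_add ((integrable_abs_sq u).const_mul _) ((hSu u).1.const_mul _),
    integral_const_mul, integral_const_mul, integral_abs_sq] at h1
  have h2 : 1 / (2 * D) * ‖u.toL2‖ ^ 2 ≤ 1 / (2 * D) * (D * ‖u‖ ^ 2) :=
    mul_le_mul_of_nonneg_left (hDu α u) (by positivity)
  have h3 : C * ∫ x, |u.toL2 x| ^ p ≤ C * (S * ‖u‖ ^ p) :=
    mul_le_mul_of_nonneg_left (hSu u).2 hC.le
  have h4 : 1 / (2 * D) * (D * ‖u‖ ^ 2) = 1 / 2 * ‖u‖ ^ 2 := by field_simp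
  linarith

theorem integral_abs_rpow_pos {r : ℝ} (hr : 0 < r) (hemb : EmbedsInLp α V r) {u : EnergySpace α V}
    (hu : u ≠ 0) : 0 < ∫ x, |u.toL2 x| ^ r := by
  obtain ⟨S, -, hS⟩ := hemb
  have hnn : 0 ≤ fun x : Space N => |u.toL2 x| ^ r := fun x => by positivity
  refine lt_of_le_of_ne (integral_nonneg hnn) fun h => hu ?_
  refine EnergySpace.toL2_injective ((Lp.eq_zero_iff_ae_eq_zero).2 ?_)
  filter_upwards [(integral_eq_zero_iff_of_nonneg hnn (hS u).1).1 h.symm] with x hx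
  have h1 := (Real.rpow_eq_zero (abs_nonneg _) hr.ne').1 hx
  simpa using h1

/-- Since `G(x, s) ≥ |s|^q - C|s|²` with `q > 2`, the functional tends to `-∞` along rays. -/
theorem exists_quadraticSub_smul_neg (hg : IsAdmissible p q g) (hp : 2 < p) (hq : 2 < q)
    (hemb : EmbedsInLp α V p) (hembq : EmbedsInLp α V q) {u : EnergySpace α V} (hu : u ≠ 0) :
    ∃ T > (0 : ℝ),
      quadraticSub (fun u : EnergySpace α V => ∫ x, primitive g x (u.toL2 x)) (T • u) < 0 := by
  obtain ⟨C, hC, hCg⟩ := hg.le_primitive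
  have hI := integral_abs_rpow_pos (by linarith) hembq hu
  obtain ⟨S, -, hS⟩ := hembq
  set I := ∫ x, |u.toL2 x| ^ q
  set B := 1 / 2 * ‖u‖ ^ 2 + C * ‖u.toL2‖ ^ 2
  have hle : ∀ T > (0 : ℝ), quadraticSub
      (fun u : EnergySpace α V => ∫ x, primitive g x (u.toL2 x)) (T • u) ≤
      T ^ 2 * B - T ^ q * I := fun T hT => by
    have h1 : T ^ q * I - C * T ^ 2 * ‖u.toL2‖ ^ 2 ≤
        ∫ x, primitive g x ((T • u).toL2 x) := by
      rw [← integral_abs_sq, ← integral_const_mul, ← integral_const_mul,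
        ← integral_sub ((hS u).1.const_mul _) ((integrable_abs_sq u).const_mul _)]
      refine integral_mono_ae (((hS u).1.const_mul _).sub ((integrable_abs_sq u).const_mul _))
        (integrable_primitive hg hp hemb (T • u)) ?_
      filter_upwards [hCg, toL2_smul_ae T u] with x hx hTx
      have h2 := hx (T * u.toL2 x)
      rw [abs_mul, abs_of_pos hT, Real.mul_rpow hT.le (abs_nonneg _)] at h2
      rw [hTx]
      refine le_trans (le_of_eq ?_) h2
      ring
    rw [quadraticSub, norm_smul, Real.norm_of_nonneg hT.le]
    have : T ^ 2 * B = 1 / 2 * (T * ‖u‖) ^ 2 + C * T ^ 2 * ‖u.toL2‖ ^ 2 := by simp only [B]; ring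
    linarith
  obtain ⟨T, hTB, hT⟩ := (((tendsto_rpow_atTop (y := q - 2) (by linarith)).eventually_gt_atTop
    (B / I)).and (eventually_gt_atTop 0)).exists
  refine ⟨T, hT, (hle T hT).trans_lt ?_⟩
  rw [div_lt_iff₀ hI] at hTB
  have h3 : T ^ q = T ^ 2 * T ^ (q - 2) := by
    rw [← Real.rpow_two, ← Real.rpow_add hT]
    congr 1
    ring
  have h4 := mul_lt_mul_of_pos_left hTB (pow_pos hT 2)
  rw [h3]
  linarith

/-- Bounded sequences of the energy space have subsequences along which the nonlinear terms
converge. The limit `v` is taken in `L²`; weak convergence in the energy space enters only through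
the lower semicontinuity `‖v‖ ≤ l` of the norm. -/
theorem exists_subseq_tendsto_nonlinear (hg : IsAdmissible p q g) (hN : α < N) (hα : 0 < α)
    (hp : 2 < p) (hp' : p < 2 * N / (N - α))
    {A : EnergySpace α V → (EnergySpace α V →L[ℝ] ℝ)}
    (hA : ∀ u h : EnergySpace α V, A u h = ∫ x, g x (u.toL2 x) * h.toL2 x)
    (u : ℕ → EnergySpace α V) (M : ℝ) (hu : ∀ n, ‖u n‖ ≤ M) :
    ∃ (φ : ℕ → ℕ) (v : EnergySpace α V) (l : ℝ), StrictMono φ ∧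
      Tendsto (fun n => ‖u (φ n)‖) atTop (𝓝 l) ∧ ‖v‖ ≤ l ∧
      (∀ t : ℝ, Tendsto (fun n => ∫ x, primitive g x ((t • u (φ n)).toL2 x)) atTop
        (𝓝 (∫ x, primitive g x ((t • v).toL2 x)))) ∧
      Tendsto (fun n => A (u (φ n)) (u (φ n))) atTop (𝓝 (A v v)) := by
  have hemb : EmbedsInLp α V p := exists_integral_rpow_le hN hα V hp hp'
  obtain ⟨φ, hφ, w, hw⟩ := exists_subseq_tendsto_toL2 hα hu
  obtain ⟨l, -, ψ, hψ, hl⟩ := isCompact_Icc.tendsto_subseq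
    (x := fun n => ‖u (φ n)‖) (s := Set.Icc 0 M) fun n => ⟨norm_nonneg _, hu _⟩
  have hw' : Tendsto (fun n => (u (φ (ψ n))).toL2) atTop (𝓝 w) := hw.comp hψ.tendsto_atTop
  obtain ⟨v, rfl, -⟩ := exists_toL2_eq_of_tendsto (fun n => hu (φ (ψ n))) hw'
  obtain ⟨C, hC, hgr⟩ := hg.growth
  refine ⟨φ ∘ ψ, v, l, hφ.comp hψ, hl, ?_, fun t => ?_, ?_⟩
  · refine le_of_forall_pos_le_add fun ε hε => ?_
    obtain ⟨n₀, hn₀⟩ := eventually_atTop.1 (hl.eventually_le_const (lt_add_of_pos_right l hε))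
    obtain ⟨v', hv', hle⟩ := exists_toL2_eq_of_tendsto
      (u := fun n => u (φ (ψ (n + n₀)))) (fun n => hn₀ (n + n₀) (Nat.le_add_left _ _))
      (hw'.comp (tendsto_add_atTop_nat n₀))
    rwa [EnergySpace.toL2_injective hv'] at hle
  · have h2 : Tendsto (fun n => (t • u (φ (ψ n))).toL2) atTop (𝓝 (t • v).toL2) := hw'.const_smul t
    refine tendsto_integral_superposition (u := fun n => t • u (φ (ψ n))) hp hemb
      (measurable_primitive hg.measurable hg.continuous)
      (fun x => continuous_iff_continuousAt.2 fun s =>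
        (hasDerivAt_primitive (hg.continuous x) s).continuousAt) hC ?_ h2
      (tendsto_integral_abs_sub_rpow hN hα hp hp' (M := |t| * M) (fun n => ?_) h2)
    · filter_upwards [hgr] with x hx s
      exact abs_primitive_le hp hC hx s
    · rw [norm_smul, Real.norm_eq_abs]
      exact mul_le_mul_of_nonneg_left (hu _) (abs_nonneg t)
  · simp_rw [hA]
    refine tendsto_integral_superposition (H := fun x s => g x s * s)
      (u := fun n => u (φ (ψ n))) hp hemb
      (hg.measurable.mul measurable_snd) (fun x => (hg.continuous x).mul continuous_id) hC ?_ hw'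
      (tendsto_integral_abs_sub_rpow hN hα hp hp' (fun n => hu _) hw')
    filter_upwards [hgr] with x hx s
    rw [abs_mul]
    exact abs_le_of_growth hp hC hx le_rfl

end Nonlinear

/-! ### The ground state -/

theorem energyFunctional_eq_quadraticSub {q : ℝ} {f g : Space N → ℝ → ℝ} {Γ : Space N → ℝ}
    (hg : ∀ᵐ x : Space N, ∀ s, primitive f x s - 1 / q * Γ x * |s| ^ q = primitive g x s) :
    (energyFunctional q f Γ : EnergySpace α V → ℝ) =
      quadraticSub fun u => ∫ x, primitive g x (u.toL2 x) := by
  funext u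
  have h1 : (if α = 2 then dirichletIntegral u.toL2
      else ∫ ξ : Space N, ‖ξ‖ ^ α * ‖fourierHat u.toL2 ξ‖ ^ 2) =
      ∫ ξ : Space N, ‖ξ‖ ^ α * ‖fourierHat u.toL2 ξ‖ ^ 2 := by
    split_ifs with h
    · subst h
      exact dirichletIntegral_eq u.integrable_fourier
    · rfl
  have h2 : ∫ x : Space N, nonlinearIntegrand q f Γ u.toL2 x = ∫ x, primitive g x (u.toL2 x) := by
    refine integral_congr_ae ?_
    filter_upwards [hg] with x hx
    exact hx _
  rw [energyFunctional, quadraticSub, h1, h2, EnergySpace.norm_sq_eq]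
  ring

end FractionalSchrodinger

/-- Existence of a ground state for `(-Δ)^(α/2) u + V u = f(x, u) - Γ |u|^(q-2) u` on `ℝ^N` with a
coercive potential. The first two conclusions say that the functional is well defined. -/
theorem theorem1p3 (N : ℕ) (α q : ℝ) (hα₀ : 0 < α) (hα₂ : α ≤ 2) (hN : α < N)
    (V : FractionalSchrodinger.CoercivePotential N)
    (Γ : FractionalSchrodinger.Space N → ℝ)
    (hΓ : FractionalSchrodinger.CoefficientAssumptions Γ)
    (f : FractionalSchrodinger.Space N → ℝ → ℝ)
    (hf : FractionalSchrodinger.NonlinearityAssumptions α q f) :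
    (∀ u : FractionalSchrodinger.EnergySpace α V,
      Integrable (FractionalSchrodinger.nonlinearIntegrand q f Γ u.toL2)) ∧
    (α = 2 → ∀ u : FractionalSchrodinger.EnergySpace α V,
      ∃ g, FractionalSchrodinger.IsL2WeakGradient u.toL2 g) ∧
    ContDiff ℝ 1 (FractionalSchrodinger.energyFunctional q f Γ :
      FractionalSchrodinger.EnergySpace α V → ℝ) ∧
    ∃ u : FractionalSchrodinger.EnergySpace α V,
      FractionalSchrodinger.IsGroundState (FractionalSchrodinger.energyFunctional q f Γ) u := by
  open FractionalSchrodinger in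
  obtain ⟨g, p, hq, hqp, hp', hg, hfg⟩ := exists_isAdmissible hf hΓ
  have hp : 2 < p := hq.trans hqp
  have hemb : EmbedsInLp α V p := exists_integral_rpow_le hN hα₀ V hp hp'
  have hembq : EmbedsInLp α V q := exists_integral_rpow_le hN hα₀ V hq (hqp.trans hp')
  obtain ⟨A, hAc, hA, hΨ⟩ := exists_hasFDerivAt_primitive hg hp hemb
  rw [energyFunctional_eq_quadraticSub hfg]
  refine ⟨fun u => ?_, ?_, ?_, ?_⟩
  · refine (integrable_primitive hg hp hemb u).congr ?_
    filter_upwards [hfg] with x hx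
    exact (hx _).symm
  · rintro rfl u
    obtain ⟨G, hG, -⟩ :=
      exists_isL2WeakGradient ((integrable_kinetic_iff 2 u.toL2).1 u.integrable_fourier)
    exact ⟨G, hG⟩
  · exact contDiff_one_iff_hasFDerivAt.2 ⟨fun u => innerSL ℝ u - A u,
      (innerSL ℝ).continuous.sub hAc, fun u => hasFDerivAt_quadraticSub hΨ u⟩
  · have := nontrivial_energySpace hα₀ hα₂ V
    obtain ⟨C, hC, hsmall⟩ := exists_apply_self_le hg hp hemb hA
    have hΨ0 : ∫ x, primitive g x ((0 : EnergySpace α V).toL2 x) = 0 := by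
      refine integral_eq_zero_of_ae ?_
      filter_upwards [Lp.coeFn_zero ℝ 2 (volume : Measure (Space N))] with x hx
      rw [EnergySpace.toL2_zero, hx]
      exact intervalIntegral.integral_same
    exact exists_isGroundState hAc hΨ hΨ0 hq hp hC
      (fun u t t' ht htt => apply_smul_div_le hg hp hemb hA u ht htt) hsmall
      (fun u hu => exists_quadraticSub_smul_neg hg hp hq hemb hembq hu)
      (exists_subseq_tendsto_nonlinear hg hN hα₀ hp hp' hA)
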